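/- Let $d\ge 1$, $d_0\ge d$, let $g_1,\dots,g_d$ be a basis of $\mathbb R^d\subset\mathbb R^{d_0}$ and $\Gamma=\mathbb Z g_1+\dots+\mathbb Z g_d$. Let $\mathcal G=(\mathcal V,\mathcal E)$ be a connected oriented metric graph with vertices $\mathcal V\subset\mathbb R^{d_0}$ (loops and multiple edges allowed), locally finite (bounded sets contain finitely many vertices, every vertex has finite multiplicity) and invariant under translations by $\Gamma$. The edge $e$ is the interval $[0,l_e]$ with $0<l_e<\infty$ and $l_{e+g}=l_e$ for $g\in\Gamma$. Let $\widetilde{\mathcal V}$ be the set of vertices whose $\mathbb R^d$-component lies in the cell $\mathcal C=\{\sum_j x_jg_j: 0\le x_j<1\}$, and assume that $\widetilde{\mathcal V}$ is finite. Every $v\in\mathcal V$ is uniquely $v=\widetilde v+g_v$ with $\widetilde v\in\widetilde{\mathcal V}$, $g_v\in\Gamma$; for $e=(v,u)$ put $g_e=g_u-g_v$. The fundamental graph $\widetilde{\mathcal G}=\mathcal G/\Gamma$ has vertex set $\widetilde{\mathcal V}$, and its edges $\widetilde e\in\widetilde{\mathcal E}$ are identified with the edges of $\mathcal G$ that originate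 in $\widetilde{\mathcal V}$, an edge $(\widetilde v,\widetilde u+g)$ becoming an edge from $\widetilde v$ to $\widetilde u$ of the same length; $\widetilde e+g$ is the translate by $g\in\Gamma$ of this representative. Let $b,A$ be real functions on $\mathcal G$ with $b_{e+g}=b_e$, $A_{e+g}=A_e$ for $g\in\Gamma$, $b_e,A_e\in C^1([0,l_e])$, and $b_e\ge c_0>0$ with $c_0$ independent of $e$. The magnetic Laplacian $\Delta(A)$ in $L_2(\mathcal G)=\bigoplus_e L_2(0,l_e)$ is $$(\Delta(A)f)_e=-\Big(\frac{d}{dx}+iA_e\Big)b_e^2\Big(\frac{d}{dx}+iA_e\Big)f_e ,$$ with domain the set of all $f\in W_2^2(\mathcal G)$ that are continuous on $\mathcal G$, including at the vertices, and satisfy at every vertex $v$ the Kirchhoff condition $$\sum_{e=(v,u)}b_e^2(0)\big(f_e'(0)+iA_e(0)f_e(0)\big)-\sum_{e=(u,v)}b_e^2(l_e)\big(f_e'(l_e)+iA_e(l_e)f_e(l_e)\big)=0,$$ where a loop contributes to both sums. For $t\in\mathbb R^d$ let $\widetilde\Delta(A,t)$ be the operator in $L_2(\widetilde{\mathcal G})$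 defined in the same way on the graph $\widetilde{\mathcal G}$ with weights $b_{\widetilde e}$ and magnetic potential $A_{\widetilde e}(x)+\frac{1}{l_e}\langle g_e,t\rangle$. Let $\widetilde\Gamma$ be the lattice generated by the basis $\widetilde g_1,\dots,\widetilde g_d$ with $\langle\widetilde g_i,g_j\rangle=2\pi\delta_{ij}$, let $\widetilde{\mathcal C}=\{t\in\mathbb R^d:|t|\le|t-g|\text{ for all }0\ne g\in\widetilde\Gamma\}$ be the first Brillouin zone, and let $\mathcal L=\int_{\widetilde{\mathcal C}}\oplus L_2(\widetilde{\mathcal G})\,dt=L_2(\widetilde{\mathcal C};L_2(\widetilde{\mathcal G}))$. **Theorem 3.2.** The map $$(Uf)_{\widetilde e}(x,t)=\frac1{\sqrt{|\widetilde{\mathcal C}|}}\sum_{g\in\Gamma}f_{\widetilde e+g}(x)\,e^{-i\langle g,t\rangle}e^{-\frac{ix}{l_e}\langle g_e,t\rangle},$$ defined on compactly supported $f\in L_2(\mathcal G)$ (those vanishing on all but finitely many edges), extends uniquely to a bounded operator $U:L_2(\mathcal G)\to\mathcal L$; this extension is unitary, and $$U\,\Delta(A)\,U^{-1}=\int_{\widetilde{\mathcal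 C}}\oplus\,\widetilde\Delta(A,t)\,dt$$ as an equality of unbounded operators, domains included. Here the domain of the direct integral is the set of $\psi\in\mathcal L$ such that $\psi(t)\in\operatorname{dom}\widetilde\Delta(A,t)$ for almost every $t\in\widetilde{\mathcal C}$ and $t\mapsto\widetilde\Delta(A,t)\psi(t)$ belongs to $\mathcal L$, and this function is the image of $\psi$. -/

import Mathlib

open MeasureTheory Set
open scoped ContDiff

noncomputable section

/-! ### Sobolev functions on an edge -/

/-- On the interval `(0, l)` the function `g` is the distributional derivative of `f`:
`∫ φ' f = - ∫ φ g` for every test function `φ ∈ C_c^∞(0, l)`. -/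
structure HasWeakDeriv (l : ℝ) (f g : ℝ → ℂ) : Prop where
  integrable_fun : IntegrableOn f (Ioo 0 l)
  integrable_deriv : IntegrableOn g (Ioo 0 l)
  integral_eq : ∀ φ : ℝ → ℝ, ContDiff ℝ ∞ φ → HasCompactSupport φ → tsupport φ ⊆ Ioo 0 l →
    ∫ x in Ioo 0 l, deriv φ x • f x = - ∫ x in Ioo 0 l, φ x • g x

namespace HasWeakDeriv

theorem integrable_smul_test {l : ℝ} {f : ℝ → ℂ} (hf : IntegrableOn f (Ioo 0 l))
    {φ : ℝ → ℝ} (hφ : Continuous φ) (hc : HasCompactSupport φ) :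
    IntegrableOn (fun x => φ x • f x) (Ioo 0 l) := by
  obtain ⟨C, hC⟩ := hc.exists_bound_of_continuous hφ
  exact Integrable.bdd_smul hf C hφ.aestronglyMeasurable (Filter.Eventually.of_forall hC)

theorem add {l : ℝ} {f₁ g₁ f₂ g₂ : ℝ → ℂ} (h₁ : HasWeakDeriv l f₁ g₁)
    (h₂ : HasWeakDeriv l f₂ g₂) :
    HasWeakDeriv l (fun x => f₁ x + f₂ x) (fun x => g₁ x + g₂ x) := by
  refine ⟨h₁.1.add h₂.1, h₁.2.add h₂.2, fun φ hφ hc hs => ?_⟩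
  have hd : Continuous (deriv φ) := hφ.continuous_deriv (by simp)
  simp only [smul_add]
  rw [integral_add (integrable_smul_test h₁.1 hd hc.deriv) (integrable_smul_test h₂.1 hd hc.deriv),
    integral_add (integrable_smul_test h₁.2 hφ.continuous hc)
      (integrable_smul_test h₂.2 hφ.continuous hc), h₁.3 φ hφ hc hs, h₂.3 φ hφ hc hs]
  ring

theorem const_mul {l : ℝ} {f g : ℝ → ℂ} (c : ℂ) (h : HasWeakDeriv l f g) :
    HasWeakDeriv l (fun x => c * f x) (fun x => c * g x) := by
  refine ⟨h.1.const_mul c, h.2.const_mul c, fun φ hφ hc hs => ?_⟩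
  have key : ∀ (ψ : ℝ → ℝ) (F : ℝ → ℂ),
      ∫ x in Ioo 0 l, ψ x • (c * F x) = c * ∫ x in Ioo 0 l, ψ x • F x := fun ψ F => by
    rw [← integral_const_mul]
    exact integral_congr_ae (Filter.Eventually.of_forall fun x => (mul_smul_comm _ _ _).symm)
  rw [key, key, h.3 φ hφ hc hs]
  ring

theorem zero (l : ℝ) : HasWeakDeriv l (fun _ => 0) (fun _ => 0) :=
  ⟨integrableOn_zero, integrableOn_zero, fun φ _ _ _ => by simp⟩

theorem congr {l : ℝ} {f g f₁ g₁ : ℝ → ℂ} (h : HasWeakDeriv l f g)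
    (hf : f =ᵐ[volume.restrict (Ioo 0 l)] f₁) (hg : g =ᵐ[volume.restrict (Ioo 0 l)] g₁) :
    HasWeakDeriv l f₁ g₁ := by
  refine ⟨h.1.congr hf, h.2.congr hg, fun φ hφ hc hs => ?_⟩
  rw [← integral_congr_ae (hf.mono fun x hx => by simp only [hx] :
      (fun x => deriv φ x • f x) =ᵐ[volume.restrict (Ioo 0 l)] fun x => deriv φ x • f₁ x),
    ← integral_congr_ae (hg.mono fun x hx => by simp only [hx] :
      (fun x => φ x • g x) =ᵐ[volume.restrict (Ioo 0 l)] fun x => φ x • g₁ x)]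
  exact h.3 φ hφ hc hs

theorem eq_zero_of_fun_eq_zero {l : ℝ} {f g : ℝ → ℂ} (h : HasWeakDeriv l f g)
    (hf : f =ᵐ[volume.restrict (Ioo 0 l)] fun _ => 0) :
    g =ᵐ[volume.restrict (Ioo 0 l)] fun _ => 0 := by
  have h0 := h.congr hf (Filter.EventuallyEq.refl _ g)
  rw [Filter.EventuallyEq, ae_restrict_iff' measurableSet_Ioo]
  refine isOpen_Ioo.ae_eq_zero_of_integral_contDiff_smul_eq_zero
    h0.2.locallyIntegrableOn fun φ hφ hc hs => ?_
  have h1 := h0.3 φ hφ hc hs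
  simp only [smul_zero, integral_zero] at h1
  rw [setIntegral_eq_integral_of_forall_compl_eq_zero] at h1
  · exact neg_eq_zero.mp h1.symm
  · intro x hx
    rw [image_eq_zero_of_notMem_tsupport fun hh => hx (hs hh), zero_smul]

end HasWeakDeriv

/-! ### Metric graphs and magnetic Laplacians with Kirchhoff vertex conditions -/

/-- An oriented metric graph with vertices `V` and edges `E`, in which every vertex has finite
multiplicity.  Loops and multiple edges are allowed; the edge `e` runs from `src e` to `tgt e` and
is the interval `[0, len e]`. -/
structure MetricGraph (V E : Type*) where
  src : E → V
  tgt : E → V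
  len : E → ℝ
  len_pos : ∀ e, 0 < len e
  finite_src : ∀ v, {e | src e = v}.Finite
  finite_tgt : ∀ v, {e | tgt e = v}.Finite

namespace MetricGraph

variable {V E : Type*} (G : MetricGraph V E)

/-- The Hilbert space `L₂(G) = ⨁_e L₂(0, l_e)`. -/
abbrev L2 : Type _ :=
  lp (fun e : E => Lp ℂ 2 ((volume : Measure ℝ).restrict (Ioo 0 (G.len e)))) 2

/-- `f ∈ W₂²(G)`, with edgewise distributional derivatives `f₁` and `f₂` of order one and two. All
three are in `L₂(G)`, that is, the sum of the squared edgewise Sobolev norms is finite. -/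
def IsSobolevTwo (f f₁ f₂ : G.L2) : Prop :=
  ∀ e, HasWeakDeriv (G.len e) (f e) (f₁ e) ∧ HasWeakDeriv (G.len e) (f₁ e) (f₂ e)

/-- `u` is, on every edge, the continuous representative of `f` on the closed interval
`[0, l_e]`; its values at `0` and `l_e` are the boundary values of `f`. -/
def IsContRep (f : G.L2) (u : E → ℝ → ℂ) : Prop :=
  ∀ e, ContinuousOn (u e) (Icc 0 (G.len e)) ∧
    (f e : ℝ → ℂ) =ᵐ[volume.restrict (Ioo 0 (G.len e))] u e

/-- An edgewise continuous function takes one well-defined value at every vertex. -/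
def IsContAtVertices (u : E → ℝ → ℂ) : Prop :=
  ∃ val : V → ℂ, ∀ e, u e 0 = val (G.src e) ∧ u e (G.len e) = val (G.tgt e)

open Classical in
/-- The magnetic co-normal derivative at the vertex `v` along the edge `e` of the function with
boundary values `u` and derivative `u₁`. A loop contributes at both of its ends. -/
def conormal (b A : E → ℝ → ℝ) (u u₁ : E → ℝ → ℂ) (v : V) (e : E) : ℂ :=
  (if G.src e = v then
    (b e 0 : ℂ) ^ 2 * (u₁ e 0 + Complex.I * A e 0 * u e 0) else 0) +
  (if G.tgt e = v then
    -((b e (G.len e) : ℂ) ^ 2 *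
      (u₁ e (G.len e) + Complex.I * A e (G.len e) * u e (G.len e))) else 0)

/-- The Kirchhoff condition: at every vertex the co-normal derivatives sum up to zero. -/
def IsKirchhoff (b A : E → ℝ → ℝ) (u u₁ : E → ℝ → ℂ) : Prop :=
  ∀ v, ∑ᶠ e, G.conormal b A u u₁ v e = 0

/-- The flux `b² (d/dx + i A) f` on the edge `e`, where `f₁` is the derivative of `f`. -/
def flux (b A : E → ℝ → ℝ) (f f₁ : G.L2) (e : E) (x : ℝ) : ℂ :=
  (b e x : ℂ) ^ 2 * (f₁ e x + Complex.I * A e x * f e x)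

/-- `h = - (d/dx + i A) b² (d/dx + i A) f` on every edge, where `f₁` is the derivative of `f`. -/
def IsMagneticExpr (b A : E → ℝ → ℝ) (f f₁ h : G.L2) : Prop :=
  ∀ e, HasWeakDeriv (G.len e) (G.flux b A f f₁ e)
    (fun x => - h e x - Complex.I * A e x * G.flux b A f f₁ e x)

theorem conormal_support (b A : E → ℝ → ℝ) (u u₁ : E → ℝ → ℂ) (v : V) :
    (Function.support (G.conormal b A u u₁ v)).Finite := by
  refine ((G.finite_src v).union (G.finite_tgt v)).subset fun e he => ?_
  by_contra hne
  simp only [mem_union, mem_ofPred_eq, not_or] at hne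
  exact he (by simp [conormal, hne.1, hne.2])

theorem coe_add_ae (f g : G.L2) (e : E) :
    ((f + g : G.L2) e : ℝ → ℂ) =ᵐ[volume.restrict (Ioo 0 (G.len e))]
      fun x => f e x + g e x :=
  Lp.coeFn_add (f e) (g e)

theorem coe_smul_ae (c : ℂ) (f : G.L2) (e : E) :
    ((c • f : G.L2) e : ℝ → ℂ) =ᵐ[volume.restrict (Ioo 0 (G.len e))]
      fun x => c * f e x :=
  Lp.coeFn_smul c (f e)

theorem coe_zero_ae (e : E) :
    ((0 : G.L2) e : ℝ → ℂ) =ᵐ[volume.restrict (Ioo 0 (G.len e))] fun _ => 0 :=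
  Lp.coeFn_zero _ _ _

/-- The graph of the magnetic Laplacian: the pairs `(f, h)` for which `f` is in the domain
(`W₂²(G)`, continuous, Kirchhoff) and `h = - (d/dx + i A) b² (d/dx + i A) f`. -/
def laplacianGraph (b A : E → ℝ → ℝ) : Submodule ℂ (G.L2 × G.L2) where
  carrier := {p | ∃ (f₁ f₂ : G.L2) (u u₁ : E → ℝ → ℂ),
    G.IsSobolevTwo p.1 f₁ f₂ ∧ G.IsContRep p.1 u ∧ G.IsContRep f₁ u₁ ∧
    G.IsContAtVertices u ∧ G.IsKirchhoff b A u u₁ ∧ G.IsMagneticExpr b A p.1 f₁ p.2}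
  zero_mem' := by
    refine ⟨0, 0, fun _ _ => 0, fun _ _ => 0, fun e => ?_, fun e => ?_, fun e => ?_,
      ⟨fun _ => 0, fun e => ⟨rfl, rfl⟩⟩, fun v => ?_, fun e => ?_⟩
    · exact ⟨(HasWeakDeriv.zero _).congr (G.coe_zero_ae e).symm (G.coe_zero_ae e).symm,
        (HasWeakDeriv.zero _).congr (G.coe_zero_ae e).symm (G.coe_zero_ae e).symm⟩
    · exact ⟨continuousOn_const, G.coe_zero_ae e⟩
    · exact ⟨continuousOn_const, G.coe_zero_ae e⟩
    · simp [conormal]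
    · refine (HasWeakDeriv.zero _).congr ?_ ?_
      · filter_upwards [G.coe_zero_ae e] with x hx
        simp only [flux, Prod.fst_zero, hx]; ring
      · filter_upwards [G.coe_zero_ae e] with x hx
        simp only [flux, Prod.fst_zero, Prod.snd_zero, hx]; ring
  add_mem' := by
    rintro ⟨f, h⟩ ⟨g, k⟩ ⟨f₁, f₂, u, u₁, hs, hu, hu₁, ⟨va, hva⟩, hk, hm⟩
      ⟨g₁, g₂, w, w₁, hs', hw, hw₁, ⟨vb, hvb⟩, hk', hm'⟩
    refine ⟨f₁ + g₁, f₂ + g₂, fun e x => u e x + w e x, fun e x => u₁ e x + w₁ e x,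
      fun e => ?_, fun e => ?_, fun e => ?_,
      ⟨fun v => va v + vb v, fun e => ⟨?_, ?_⟩⟩, fun v => ?_, fun e => ?_⟩
    · exact ⟨((hs e).1.add (hs' e).1).congr (G.coe_add_ae _ _ e).symm (G.coe_add_ae _ _ e).symm,
        ((hs e).2.add (hs' e).2).congr (G.coe_add_ae _ _ e).symm (G.coe_add_ae _ _ e).symm⟩
    · refine ⟨(hu e).1.add (hw e).1, ?_⟩
      filter_upwards [G.coe_add_ae f g e, (hu e).2, (hw e).2] with x h1 h2 h3
      rw [← h2, ← h3]; exact h1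
    · refine ⟨(hu₁ e).1.add (hw₁ e).1, ?_⟩
      filter_upwards [G.coe_add_ae f₁ g₁ e, (hu₁ e).2, (hw₁ e).2] with x h1 h2 h3
      rw [← h2, ← h3]; exact h1
    · simp only [(hva e).1, (hvb e).1]
    · simp only [(hva e).2, (hvb e).2]
    · have := finsum_add_distrib (G.conormal_support b A u u₁ v) (G.conormal_support b A w w₁ v)
      rw [hk v, hk' v, add_zero] at this
      rw [← this]
      refine finsum_congr fun e => ?_
      unfold conormal
      split_ifs <;> ring
    · refine ((hm e).add (hm' e)).congr ?_ ?_
      · filter_upwards [G.coe_add_ae f g e, G.coe_add_ae f₁ g₁ e] with x h1 h2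
        simp only [flux, Prod.mk_add_mk, h1, h2]; ring
      · filter_upwards [G.coe_add_ae f g e, G.coe_add_ae f₁ g₁ e, G.coe_add_ae h k e]
          with x h1 h2 h3
        simp only [flux, Prod.mk_add_mk, h1, h2, h3]; ring
  smul_mem' := by
    rintro c ⟨f, h⟩ ⟨f₁, f₂, u, u₁, hs, hu, hu₁, ⟨va, hva⟩, hk, hm⟩
    refine ⟨c • f₁, c • f₂, fun e x => c * u e x, fun e x => c * u₁ e x,
      fun e => ?_, fun e => ?_, fun e => ?_,
      ⟨fun v => c * va v, fun e => ⟨?_, ?_⟩⟩, fun v => ?_, fun e => ?_⟩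
    · exact ⟨((hs e).1.const_mul c).congr (G.coe_smul_ae _ _ e).symm (G.coe_smul_ae _ _ e).symm,
        ((hs e).2.const_mul c).congr (G.coe_smul_ae _ _ e).symm (G.coe_smul_ae _ _ e).symm⟩
    · refine ⟨continuousOn_const.mul (hu e).1, ?_⟩
      filter_upwards [G.coe_smul_ae c f e, (hu e).2] with x h1 h2
      rw [← h2]; exact h1
    · refine ⟨continuousOn_const.mul (hu₁ e).1, ?_⟩
      filter_upwards [G.coe_smul_ae c f₁ e, (hu₁ e).2] with x h1 h2
      rw [← h2]; exact h1
    · simp only [(hva e).1]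
    · simp only [(hva e).2]
    · have := mul_finsum (G.conormal b A u u₁ v) c
      rw [hk v, mul_zero] at this
      rw [this]
      refine finsum_congr fun e => ?_
      unfold conormal
      split_ifs <;> ring
    · refine ((hm e).const_mul c).congr ?_ ?_
      · filter_upwards [G.coe_smul_ae c f e, G.coe_smul_ae c f₁ e] with x h1 h2
        simp only [flux, Prod.smul_mk, h1, h2]; ring
      · filter_upwards [G.coe_smul_ae c f e, G.coe_smul_ae c f₁ e, G.coe_smul_ae c h e]
          with x h1 h2 h3
        simp only [flux, Prod.smul_mk, h1, h2, h3]; ring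

theorem laplacianGraph_functional (b A : E → ℝ → ℝ) (p : G.L2 × G.L2)
    (hp : p ∈ G.laplacianGraph b A) (h0 : p.1 = 0) : p.2 = 0 := by
  obtain ⟨f, h⟩ := p
  obtain ⟨f₁, f₂, u, u₁, hs, -, -, -, -, hm⟩ := hp
  simp only at h0 hs hm ⊢
  subst h0
  ext e : 2
  have h1 := (hs e).1.eq_zero_of_fun_eq_zero (G.coe_zero_ae e)
  have h2 : G.flux b A 0 f₁ e =ᵐ[volume.restrict (Ioo 0 (G.len e))] fun _ => 0 := by
    filter_upwards [h1, G.coe_zero_ae e] with x hx hx'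
    simp only [flux, hx, hx']; ring
  have h3 := (hm e).eq_zero_of_fun_eq_zero h2
  refine Lp.ext ?_
  filter_upwards [h2, h3, G.coe_zero_ae e] with x hx hx' h4
  rw [h4]
  simp only [hx, mul_zero, sub_zero, neg_eq_zero] at hx'
  exact hx'

/-- The magnetic Laplacian `f ↦ - (d/dx + i A) b² (d/dx + i A) f` with magnetic potential `A` and
weight `b`, as an unbounded operator in `L₂(G)`. Its domain consists of the `f ∈ W₂²(G)` that are
continuous on the graph and satisfy the Kirchhoff condition at every vertex. -/
def magneticLaplacian (b A : E → ℝ → ℝ) : G.L2 →ₗ.[ℂ] G.L2 :=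
  (G.laplacianGraph b A).toLinearPMap

theorem magneticLaplacian_graph (b A : E → ℝ → ℝ) :
    (G.magneticLaplacian b A).graph = G.laplacianGraph b A :=
  Submodule.toLinearPMap_graph_eq _ (G.laplacianGraph_functional b A)

end MetricGraph

/-! ### Direct integrals and unitary conjugation of unbounded operators -/

section Operators

variable {T : Type*} [MeasurableSpace T]
  {H : Type*} [NormedAddCommGroup H] [InnerProductSpace ℂ H]
  {K : Type*} [NormedAddCommGroup K] [InnerProductSpace ℂ K]

/-- The graph of the direct integral of the operators `S t`. -/
def directIntegralGraph (μ : Measure T) (S : T → H →ₗ.[ℂ] H) :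
    Submodule ℂ (Lp H 2 μ × Lp H 2 μ) where
  carrier := {p | ∀ᵐ t ∂μ, (p.1 t, p.2 t) ∈ (S t).graph}
  zero_mem' := by
    simp only [mem_ofPred_eq, Prod.fst_zero, Prod.snd_zero]
    filter_upwards [Lp.coeFn_zero H 2 μ] with t ht
    rw [ht]
    exact (S t).graph.zero_mem
  add_mem' := by
    rintro ⟨f, h⟩ ⟨g, k⟩ h1 h2
    simp only [mem_ofPred_eq, Prod.mk_add_mk] at h1 h2 ⊢
    filter_upwards [h1, h2, Lp.coeFn_add f g, Lp.coeFn_add h k] with t a1 a2 a3 a4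
    rw [a3, a4]
    exact (S t).graph.add_mem a1 a2
  smul_mem' := by
    rintro c ⟨f, h⟩ h1
    simp only [mem_ofPred_eq, Prod.smul_mk] at h1 ⊢
    filter_upwards [h1, Lp.coeFn_smul c f, Lp.coeFn_smul c h] with t a1 a2 a3
    rw [a2, a3]
    exact (S t).graph.smul_mem c a1

/-- The direct integral `∫ ⊕ S t dμ(t)` of unbounded operators in the constant-fibre direct
integral `∫ ⊕ H dμ(t) = L₂(T, μ; H)`: `ψ` is in its domain when `ψ t` is in the domain of `S t`
for almost all `t` and `t ↦ S t (ψ t)` is in `L₂(T, μ; H)`, which is then the image of `ψ`. -/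
def directIntegral (μ : Measure T) (S : T → H →ₗ.[ℂ] H) : Lp H 2 μ →ₗ.[ℂ] Lp H 2 μ :=
  (directIntegralGraph μ S).toLinearPMap

theorem directIntegral_graph (μ : Measure T) (S : T → H →ₗ.[ℂ] H) :
    (directIntegral μ S).graph = directIntegralGraph μ S := by
  refine Submodule.toLinearPMap_graph_eq _ ?_
  rintro ⟨f, h⟩ h1 (rfl : f = 0)
  refine Lp.ext ?_
  filter_upwards [(h1 : ∀ᵐ t ∂μ, ((0 : Lp H 2 μ) t, h t) ∈ (S t).graph),
    Lp.coeFn_zero H 2 μ] with t a1 a2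
  rw [a2] at a1 ⊢
  exact (S t).graph_fst_eq_zero_snd a1 rfl

/-- The operator `U S U⁻¹` with domain `U (dom S)`. -/
def unitaryConj (U : H ≃ₗᵢ[ℂ] K) (S : H →ₗ.[ℂ] H) : K →ₗ.[ℂ] K where
  domain := S.domain.comap (U.symm.toLinearEquiv : K →ₗ[ℂ] H)
  toFun :=
    { toFun := fun ψ => U (S ⟨U.symm ψ, ψ.2⟩)
      map_add' := fun ψ χ => by
        rw [← map_add, ← S.map_add]
        congr 2
        exact Subtype.ext (map_add U.symm (ψ : K) χ)
      map_smul' := fun c ψ => by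
        rw [RingHom.id_apply, ← map_smul, ← S.map_smul]
        congr 2
        exact Subtype.ext (map_smul U.symm c (ψ : K)) }

end Operators

/-! ### Periodic metric graphs -/

/-- Points of `ℝ^{d₀}`, `d₀ = d + k`, split into the `d` coordinates along the periods and the `k`
transverse ones. -/
abbrev Point (d k : ℕ) : Type := EuclideanSpace ℝ (Fin d) × EuclideanSpace ℝ (Fin k)

/-- The lattice generated by the basis `g₁, …, g_d`. -/
abbrev periodLattice {d : ℕ} (g : Module.Basis (Fin d) ℝ (EuclideanSpace ℝ (Fin d))) :
    Submodule ℤ (EuclideanSpace ℝ (Fin d)) :=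
  Submodule.span ℤ (Set.range g)

/-- An oriented connected metric graph in `ℝ^{d₀}`, `d₀ = d + k`, which is locally finite and
periodic in `ℝ^d` with periods `g₁, …, g_d`. Loops and multiple edges are allowed; the translation
of edges by lattice vectors is written `shift`. -/
structure PeriodicMetricGraph (d k : ℕ)
    (g : Module.Basis (Fin d) ℝ (EuclideanSpace ℝ (Fin d))) (E : Type*) where
  verts : Set (Point d k)
  src : E → verts
  tgt : E → verts
  len : E → ℝ
  len_pos : ∀ e, 0 < len e
  connected : ∀ v w : verts, Relation.EqvGen (fun a c => ∃ e, src e = a ∧ tgt e = c) v w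
  locallyFinite : ∀ B : Set (Point d k), Bornology.IsBounded B → (verts ∩ B).Finite
  finite_src : ∀ v, {e | src e = v}.Finite
  finite_tgt : ∀ v, {e | tgt e = v}.Finite
  verts_add : ∀ γ : periodLattice g, ∀ v ∈ verts, (v.1 + γ, v.2) ∈ verts
  shift : periodLattice g → E → E
  shift_zero : ∀ e, shift 0 e = e
  shift_add : ∀ γ δ e, shift (γ + δ) e = shift γ (shift δ e)
  src_shift : ∀ γ e, (src (shift γ e) : Point d k) = ((src e).1.1 + γ, (src e).1.2)
  tgt_shift : ∀ γ e, (tgt (shift γ e) : Point d k) = ((tgt e).1.1 + γ, (tgt e).1.2)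
  len_shift : ∀ γ e, len (shift γ e) = len e
  /-- The fundamental graph has finitely many vertices. -/
  finite_cell : {v ∈ verts | v.1 ∈ ZSpan.fundamentalDomain g}.Finite

namespace PeriodicMetricGraph

variable {d k : ℕ} {g : Module.Basis (Fin d) ℝ (EuclideanSpace ℝ (Fin d))} {E : Type*}
  (G : PeriodicMetricGraph d k g E)

/-- The underlying metric graph. -/
def toMetricGraph : MetricGraph G.verts E where
  src := G.src
  tgt := G.tgt
  len := G.len
  len_pos := G.len_pos
  finite_src := G.finite_src
  finite_tgt := G.finite_tgt

/-- The fundamental vertex set: the vertices in the elementary cell. -/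
def cellVerts : Set (Point d k) := {v ∈ G.verts | v.1 ∈ ZSpan.fundamentalDomain g}

/-- The edges of the fundamental graph, represented by the edges that originate in the fundamental
vertex set. -/
abbrev CellEdge : Type _ := {e : E // (G.src e : Point d k) ∈ G.cellVerts}

/-- The lattice vector `g_e = g_u - g_v` of the edge `e = (v, u)`, where `g_v` is the lattice
part of the vertex `v`. -/
def edgeIndex (e : E) : periodLattice g :=
  ZSpan.floor g (G.tgt e).1.1 - ZSpan.floor g (G.src e).1.1

/-- The representative in the fundamental vertex set of the class of the vertex `v`. -/
def reduce (v : G.verts) : G.cellVerts :=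
  ⟨(ZSpan.fract g v.1.1, v.1.2), by
    constructor
    · have := G.verts_add (-(ZSpan.floor g v.1.1)) v.1 v.2
      simpa [ZSpan.fract_apply, sub_eq_add_neg] using this
    · exact ZSpan.fract_mem_fundamentalDomain g _⟩

instance finite_cellEdge : Finite G.CellEdge := by
  have h : {e : E | (G.src e : Point d k) ∈ G.cellVerts}.Finite := by
    have h1 : (Subtype.val ⁻¹' G.cellVerts : Set G.verts).Finite :=
      Set.Finite.preimage Subtype.val_injective.injOn G.finite_cell
    have h2 := h1.biUnion fun v _ => G.finite_src v
    refine h2.subset fun e he => ?_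
    simp only [mem_iUnion, mem_ofPred_eq, exists_prop]
    exact ⟨G.src e, he, rfl⟩
  exact h.to_subtype

/-- The fundamental graph, that is, the quotient of the graph by the lattice. -/
def fundamentalGraph : MetricGraph G.cellVerts G.CellEdge where
  src := fun e => ⟨G.src e, e.2⟩
  tgt := fun e => G.reduce (G.tgt e)
  len := fun e => G.len e
  len_pos := fun e => G.len_pos e
  finite_src := fun _ => Set.toFinite _
  finite_tgt := fun _ => Set.toFinite _

end PeriodicMetricGraph

/-! ### Brillouin zone, fibre operators and the Gelfand transform -/

/-- The dual basis: `⟨dualVec g i, g j⟩ = 2 π δ_{ij}`. -/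
def dualVec {d : ℕ} (g : Module.Basis (Fin d) ℝ (EuclideanSpace ℝ (Fin d))) (i : Fin d) :
    EuclideanSpace ℝ (Fin d) :=
  (2 * Real.pi) •
    (InnerProductSpace.toDual ℝ (EuclideanSpace ℝ (Fin d))).symm
      (LinearMap.toContinuousLinearMap (g.coord i))

theorem inner_dualVec {d : ℕ} (g : Module.Basis (Fin d) ℝ (EuclideanSpace ℝ (Fin d)))
    (i j : Fin d) : inner ℝ (dualVec g i) (g j) = if i = j then 2 * Real.pi else 0 := by
  rw [dualVec, real_inner_smul_left, InnerProductSpace.toDual_symm_apply]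
  simp [Finsupp.single_apply, eq_comm]

/-- The dual lattice. -/
def dualLattice {d : ℕ} (g : Module.Basis (Fin d) ℝ (EuclideanSpace ℝ (Fin d))) :
    Submodule ℤ (EuclideanSpace ℝ (Fin d)) :=
  Submodule.span ℤ (Set.range (dualVec g))

/-- The first Brillouin zone. -/
def brillouinZone {d : ℕ} (g : Module.Basis (Fin d) ℝ (EuclideanSpace ℝ (Fin d))) :
    Set (EuclideanSpace ℝ (Fin d)) :=
  {t | ∀ h ∈ dualLattice g, h ≠ 0 → ‖t‖ ≤ ‖t - h‖}

namespace PeriodicMetricGraph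

variable {d k : ℕ} {g : Module.Basis (Fin d) ℝ (EuclideanSpace ℝ (Fin d))} {E : Type*}
  (G : PeriodicMetricGraph d k g E)

/-- The direct integral of the spaces `L₂` of the fundamental graph over the Brillouin zone. -/
abbrev FibreSpace : Type _ :=
  Lp G.fundamentalGraph.L2 2 ((volume : Measure (EuclideanSpace ℝ (Fin d))).restrict
    (brillouinZone g))

/-- The fibre operator at the quasimomentum `t`: the magnetic Laplacian on the fundamental graph
with the magnetic potential `A_e + ⟨g_e, t⟩ / l_e`. -/
def fibreLaplacian (b A : E → ℝ → ℝ) (t : EuclideanSpace ℝ (Fin d)) :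
    G.fundamentalGraph.L2 →ₗ.[ℂ] G.fundamentalGraph.L2 :=
  G.fundamentalGraph.magneticLaplacian (fun e => b e)
    (fun e x => A e x + inner ℝ (G.edgeIndex e : EuclideanSpace ℝ (Fin d)) t / G.len e)

/-- The value at `(t, e, x)` of the Gelfand transform of `f`. -/
def gelfand (f : G.toMetricGraph.L2) (t : EuclideanSpace ℝ (Fin d)) (e : G.CellEdge) (x : ℝ) : ℂ :=
  ((Real.sqrt (volume.real (brillouinZone g)))⁻¹ : ℝ) *
    ∑' γ : periodLattice g, f (G.shift γ e) x *
      Complex.exp (-Complex.I * (inner ℝ (γ : EuclideanSpace ℝ (Fin d)) t : ℝ)) *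
      Complex.exp (-Complex.I * (x / G.len e) *
        (inner ℝ (G.edgeIndex e : EuclideanSpace ℝ (Fin d)) t : ℝ))

/-- The bounded operator `U` acts by the formula of the Gelfand transform on the functions with
compact support, that is, on those vanishing on all but finitely many edges. -/
def IsGelfandTransform (U : G.toMetricGraph.L2 →L[ℂ] G.FibreSpace) : Prop :=
  ∀ f : G.toMetricGraph.L2, {e | f e ≠ 0}.Finite →
    ∀ᵐ t ∂(volume : Measure (EuclideanSpace ℝ (Fin d))).restrict (brillouinZone g),
      ∀ e : G.CellEdge, ∀ᵐ x ∂(volume : Measure ℝ).restrict (Ioo 0 (G.len e)),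
        (U f t e : ℝ → ℂ) x = G.gelfand f t e x

end PeriodicMetricGraph

end

/-!
The magnetic equation on an edge is a first order system for the function `u` and the flux
`w = b² (u' + i A u)`. Whether a pair `(f, h)` of `L₂` functions solves it, and which boundary
values `u` and `w` then have, is decided by bounded operators on the `L₂` space of the edge:
`exists_edgeOperators` builds them from the Volterra operator after gauging `A` away. Hence the
graph of the magnetic Laplacian consists of the pairs `(f, h)` that satisfy linear relations
between the images of their edge components under bounded operators: the edge systems are
solvable, `u` is continuous at the vertices and the fluxes at a vertex sum up to zero. The Sobolev
bounds are automatic (`exists_sobolevOperators`), since up to translation there are finitely many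
edges.

On each edge the Gelfand transform is, up to the phase `exp (- i x ⟨g_e, t⟩ / l_e)`, the Fourier
series of the sequence of components on the translated edges. The characters of the period lattice
are orthogonal on the Brillouin zone, which is a fundamental domain of the dual lattice
(`integral_character`), and complete, also for vector-valued functions
(`ae_eq_zero_of_fourierCoeff`); this yields the unitary map `gelfandEquiv`.

Bounded operators on a single edge commute with the Fourier series (`map_orbitPair`), and a linear
relation between shifted Fourier coefficients holds for all shifts if and only if the relation with
the shifts replaced by characters holds at almost all `t`
(`forall_sum_fourierCoeff_eq_zero_iff`). The end of the edge `e` lies `g_e` cells away from its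
origin, so the relations on the periodic graph turn into the relations of the fundamental graph
with the factors `exp (- i ⟨g_e, t⟩)` at the ends of the edges
(`mem_laplacianGraph_iff_orbitPair`). The phase above is the gauge transformation that trades these
factors for the potential `A + ⟨g_e, t⟩ / l_e` (`mem_fibreLaplacian_graph_iff`). Thus the unitary
map takes the graph of the magnetic Laplacian onto that of the direct integral
(`mem_laplacianGraph_iff_ae`), and two operators with the same graph are equal. The argument only
compares graphs; self-adjointness plays no role.
-/

open scoped Pointwise

noncomputable section

/-! ### Weak derivatives on an interval -/

/-- Integration by parts against the primitive of an integrable function, by Fubini. -/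
theorem setIntegral_deriv_mul_primitive {l : ℝ} {η η' g : ℝ → ℂ}
    (hη : ContinuousOn η (Icc 0 l)) (hη' : ContinuousOn η' (Icc 0 l))
    (hd : ∀ x ∈ Ioo 0 l, HasDerivAt η (η' x) x) (h1 : η l = 0)
    (hg : IntegrableOn g (Ioo 0 l)) :
    ∫ x in Ioo 0 l, η' x * ∫ y in (0:ℝ)..x, g y = - ∫ x in Ioo 0 l, η x * g x := by
  set μ : Measure ℝ := volume.restrict (Ioo 0 l)
  have hη'i : Integrable η' μ := (hη'.integrableOn_Icc).mono_set Ioo_subset_Icc_self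
  have hF : Integrable (Function.uncurry fun x y : ℝ =>
      (if y < x then η' x * g y else 0 : ℂ)) (μ.prod μ) := by
    have h := (hη'i.mul_prod hg).indicator (s := {p : ℝ × ℝ | p.2 < p.1})
      (measurableSet_lt measurable_snd measurable_fst)
    refine h.congr (Filter.Eventually.of_forall fun p => ?_)
    simp [Set.indicator, Function.uncurry]
  have hswap := integral_integral_swap hF
  have hL : ∀ x ∈ Ioo 0 l, ∫ y, (if y < x then η' x * g y else 0 : ℂ) ∂μ
      = η' x * ∫ y in (0:ℝ)..x, g y := by
    intro x hx
    have : (fun y => (if y < x then η' x * g y else 0 : ℂ))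
        = (Iio x).indicator fun y => η' x * g y := by
      ext y; simp [Set.indicator]
    rw [this, integral_indicator measurableSet_Iio, Measure.restrict_restrict measurableSet_Iio,
      integral_const_mul, intervalIntegral.integral_of_le hx.1.le, integral_Ioc_eq_integral_Ioo]
    congr 3
    ext y; simp only [mem_inter_iff, mem_Iio, mem_Ioo]
    constructor
    · rintro ⟨a, b, c⟩; exact ⟨b, a⟩
    · rintro ⟨a, b⟩; exact ⟨b, a, b.trans hx.2⟩
  have hR : ∀ y ∈ Ioo 0 l, ∫ x, (if y < x then η' x * g y else 0 : ℂ) ∂μ = - (η y * g y) := by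
    intro y hy
    have : (fun x => (if y < x then η' x * g y else 0 : ℂ))
        = (Ioi y).indicator fun x => η' x * g y := by
      ext x; simp [Set.indicator]
    rw [this, integral_indicator measurableSet_Ioi, Measure.restrict_restrict measurableSet_Ioi,
      integral_mul_const]
    have hset : Ioi y ∩ Ioo 0 l = Ioo y l := by
      ext x; simp only [mem_inter_iff, mem_Ioi, mem_Ioo]
      exact ⟨fun ⟨a, _, c⟩ => ⟨a, c⟩, fun ⟨a, b⟩ => ⟨a, hy.1.trans a, b⟩⟩
    have hsub : Icc y l ⊆ Icc 0 l := Icc_subset_Icc_left hy.1.le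
    have hftc := intervalIntegral.integral_eq_sub_of_hasDerivAt_of_le hy.2.le
      (hη.mono hsub) (fun x hx => hd x ⟨hy.1.trans hx.1, hx.2⟩)
      ((hη'.mono hsub).intervalIntegrable_of_Icc hy.2.le)
    rw [hset, ← integral_Ioc_eq_integral_Ioo, ← intervalIntegral.integral_of_le hy.2.le, hftc, h1]
    ring
  rw [setIntegral_congr_fun measurableSet_Ioo hL, setIntegral_congr_fun measurableSet_Ioo hR,
    integral_neg] at hswap
  exact hswap

namespace HasWeakDeriv

theorem continuousOn_primitive {l : ℝ} (hl : 0 < l) {g : ℝ → ℂ} (hg : IntegrableOn g (Ioo 0 l)) :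
    ContinuousOn (fun x => ∫ y in (0:ℝ)..x, g y) (Icc 0 l) := by
  have h : IntegrableOn g (uIcc 0 l) := by
    rw [uIcc_of_le hl.le]; exact (integrableOn_Icc_iff_integrableOn_Ioo (by simp) (by simp)).mpr hg
  exact (intervalIntegral.continuousOn_primitive_interval h).mono Icc_subset_uIcc

theorem integrableOn_of_continuousOn {l : ℝ} {a : ℝ → ℂ} (ha : ContinuousOn a (Icc 0 l)) :
    IntegrableOn a (Ioo 0 l) :=
  ha.integrableOn_Icc.mono_set Ioo_subset_Icc_self

theorem integrableOn_mul_of_continuousOn {l : ℝ} {a f : ℝ → ℂ} (ha : ContinuousOn a (Icc 0 l))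
    (hf : IntegrableOn f (Ioo 0 l)) : IntegrableOn (fun x => a x * f x) (Ioo 0 l) := by
  obtain ⟨C, hC⟩ := isCompact_Icc.exists_bound_of_continuousOn ha
  refine Integrable.bdd_mul hf
    ((ha.mono Ioo_subset_Icc_self).aestronglyMeasurable measurableSet_Ioo) (c := C) ?_
  filter_upwards [ae_restrict_mem measurableSet_Ioo] with x hx
  exact hC x (Ioo_subset_Icc_self hx)

theorem zero_of_tsupport {l : ℝ} {φ : ℝ → ℝ} (hs : tsupport φ ⊆ Ioo 0 l) {x : ℝ}
    (hx : x ∉ Ioo 0 l) : φ x = 0 :=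
  image_eq_zero_of_notMem_tsupport fun hh => hx (hs hh)

/-- A primitive of an integrable function times a continuously differentiable one has the weak
derivative given by the product rule. -/
theorem of_mul_primitive {l : ℝ} (hl : 0 < l) {a a' g : ℝ → ℂ} (c : ℂ)
    (ha : ContinuousOn a (Icc 0 l)) (ha' : ContinuousOn a' (Icc 0 l))
    (hd : ∀ x ∈ Ioo 0 l, HasDerivAt a (a' x) x) (hg : IntegrableOn g (Ioo 0 l)) :
    HasWeakDeriv l (fun x => a x * (c + ∫ y in (0:ℝ)..x, g y))
      (fun x => a' x * (c + ∫ y in (0:ℝ)..x, g y) + a x * g x) := by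
  set u : ℝ → ℂ := fun x => ∫ y in (0:ℝ)..x, g y with hu
  have huc : ContinuousOn u (Icc 0 l) := continuousOn_primitive hl hg
  have hcu : ContinuousOn (fun x => c + u x) (Icc 0 l) := continuousOn_const.add huc
  have hi1 := integrableOn_of_continuousOn (ha.mul hcu)
  have hi2 := integrableOn_of_continuousOn (ha'.mul hcu)
  have hi3 := integrableOn_mul_of_continuousOn ha hg
  refine ⟨hi1, hi2.add hi3, fun φ hφ hc hs => ?_⟩
  have hdφ : ∀ x, HasDerivAt (fun x => (φ x : ℂ)) ((deriv φ x : ℝ) : ℂ) x := fun x =>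
    ((hφ.differentiable (by simp)).differentiableAt (x := x)).hasDerivAt.ofReal_comp
  have hφc : ContinuousOn (fun x => (φ x : ℂ)) (Icc 0 l) :=
    (Complex.continuous_ofReal.comp hφ.continuous).continuousOn
  have hφ'c : ContinuousOn (fun x => ((deriv φ x : ℝ) : ℂ)) (Icc 0 l) :=
    (Complex.continuous_ofReal.comp (hφ.continuous_deriv (by simp))).continuousOn
  have h0 : φ 0 = 0 := zero_of_tsupport hs (by simp)
  have h1 : φ l = 0 := zero_of_tsupport hs (by simp)
  set η : ℝ → ℂ := fun x => φ x * a x with hη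
  set η' : ℝ → ℂ := fun x => ((deriv φ x : ℝ) : ℂ) * a x + φ x * a' x with hη'
  have hηc : ContinuousOn η (Icc 0 l) := hφc.mul ha
  have hη'c : ContinuousOn η' (Icc 0 l) := (hφ'c.mul ha).add (hφc.mul ha')
  have hηd : ∀ x ∈ Ioo 0 l, HasDerivAt η (η' x) x := fun x hx => (hdφ x).mul (hd x hx)
  have hparts := setIntegral_deriv_mul_primitive hηc hη'c hηd (by simp [hη, h1]) hg
  -- the constant part only sees the boundary values of the test function
  have hconst : ∫ x in Ioo 0 l, η' x * c = 0 := by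
    have := intervalIntegral.integral_eq_sub_of_hasDerivAt_of_le hl.le hηc hηd
      (hη'c.intervalIntegrable_of_Icc hl.le)
    rw [integral_mul_const, ← integral_Ioc_eq_integral_Ioo,
      ← intervalIntegral.integral_of_le hl.le, this]
    simp [hη, h0, h1]
  have e1 : ∀ x, deriv φ x • (a x * (c + u x))
      = η' x * c + η' x * u x - φ x * (a' x * (c + u x)) := fun x => by
    simp only [hη', Complex.real_smul]; ring
  have e2 : ∀ x, φ x • (a' x * (c + u x) + a x * g x)
      = φ x * (a' x * (c + u x)) + η x * g x := fun x => by
    simp only [hη, Complex.real_smul]; ring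
  refine (integral_congr_ae (Filter.Eventually.of_forall e1)).trans (Eq.trans ?_
    (congrArg Neg.neg (integral_congr_ae (Filter.Eventually.of_forall e2)).symm))
  have j1 : IntegrableOn (fun x => η' x * c) (Ioo 0 l) :=
    integrableOn_of_continuousOn (hη'c.mul (continuousOn_const (c := c)))
  have j2 : IntegrableOn (fun x => η' x * u x) (Ioo 0 l) :=
    integrableOn_of_continuousOn (hη'c.mul huc)
  have j3 : IntegrableOn (fun x => φ x * (a' x * (c + u x))) (Ioo 0 l) :=
    integrableOn_of_continuousOn (hφc.mul (ha'.mul hcu))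
  have j4 := integrableOn_mul_of_continuousOn hηc hg
  have k1 : ∫ x in Ioo 0 l, (η' x * c + η' x * u x - φ x * (a' x * (c + u x)))
      = (∫ x in Ioo 0 l, (η' x * c + η' x * u x)) - ∫ x in Ioo 0 l, φ x * (a' x * (c + u x)) :=
    integral_sub (j1.add j2) j3
  have k2 := integral_add j1 j2
  have k3 := integral_add j3 j4
  rw [k1, k2, k3, hconst, hparts]
  ring

theorem of_primitive {l : ℝ} (hl : 0 < l) {g : ℝ → ℂ} (c : ℂ) (hg : IntegrableOn g (Ioo 0 l)) :
    HasWeakDeriv l (fun x => c + ∫ y in (0:ℝ)..x, g y) g := by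
  have := of_mul_primitive hl (a := fun _ => 1) (a' := fun _ => 0) c continuousOn_const
    continuousOn_const (fun x _ => hasDerivAt_const x 1) hg
  simpa using this

theorem sub {l : ℝ} {f₁ g₁ f₂ g₂ : ℝ → ℂ} (h₁ : HasWeakDeriv l f₁ g₁)
    (h₂ : HasWeakDeriv l f₂ g₂) :
    HasWeakDeriv l (fun x => f₁ x - f₂ x) (fun x => g₁ x - g₂ x) := by
  have := h₁.add (h₂.const_mul (-1))
  simpa only [neg_one_mul, ← sub_eq_add_neg] using this

theorem deriv_unique {l : ℝ} {f g₁ g₂ : ℝ → ℂ} (h₁ : HasWeakDeriv l f g₁)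
    (h₂ : HasWeakDeriv l f g₂) : g₁ =ᵐ[volume.restrict (Ioo 0 l)] g₂ := by
  have := (h₁.sub h₂).eq_zero_of_fun_eq_zero (Filter.Eventually.of_forall fun x => sub_self _)
  exact this.mono fun x hx => sub_eq_zero.mp hx

/-- The lemma of du Bois-Reymond. -/
theorem ae_eq_const_of_deriv_zero {l : ℝ} (hl : 0 < l) {f : ℝ → ℂ}
    (h : HasWeakDeriv l f fun _ => 0) :
    ∃ c : ℂ, f =ᵐ[volume.restrict (Ioo 0 l)] fun _ => c := by
  obtain ⟨φ₀, hφ₀, hc₀, hs₀, hi₀⟩ : ∃ φ : ℝ → ℝ, ContDiff ℝ ∞ φ ∧ HasCompactSupport φ ∧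
      tsupport φ ⊆ Ioo 0 l ∧ ∫ x, φ x = 1 := by
    let B : ContDiffBump (l / 2) := ⟨l / 8, l / 4, by positivity, by linarith⟩
    refine ⟨B.normed volume, B.contDiff_normed, B.hasCompactSupport_normed, ?_, B.integral_normed⟩
    rw [B.tsupport_normed_eq]
    intro x hx
    have hx' : |x - l / 2| ≤ l / 4 := by simpa [Real.dist_eq] using hx
    rw [abs_le] at hx'
    constructor <;> linarith [hx'.1, hx'.2]
  set c : ℂ := ∫ x in Ioo 0 l, φ₀ x • f x with hcdef
  refine ⟨c, ?_⟩
  suffices hz : (fun x => f x - c) =ᵐ[volume.restrict (Ioo 0 l)] fun _ => 0 from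
    hz.mono fun x hx => sub_eq_zero.mp hx
  rw [Filter.EventuallyEq, ae_restrict_iff' measurableSet_Ioo]
  have hfc : IntegrableOn (fun x => f x - c) (Ioo 0 l) :=
    h.1.sub (integrableOn_of_continuousOn continuousOn_const)
  refine isOpen_Ioo.ae_eq_zero_of_integral_contDiff_smul_eq_zero hfc.locallyIntegrableOn
    fun φ hφ hc hs => ?_
  -- the test function `η` has mean zero, so its primitive is a test function again
  set m : ℝ := ∫ x, φ x with hm
  set η : ℝ → ℝ := fun x => φ x - m * φ₀ x with hη
  have hηs : ContDiff ℝ ∞ η := hφ.sub (contDiff_const.mul hφ₀)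
  have hη0 : ∫ x, η x = 0 := by
    have := integral_sub (μ := volume) (hφ.continuous.integrable_of_hasCompactSupport hc)
      ((hφ₀.continuous.integrable_of_hasCompactSupport hc₀).const_mul m)
    rw [hη, this, integral_const_mul, hi₀, mul_one, sub_self]
  obtain ⟨α, β, hα, hβ, hαβ⟩ : ∃ α β : ℝ, 0 < α ∧ β < l ∧ ∀ x, x ∉ Icc α β → η x = 0 := by
    have hK : IsCompact (tsupport φ ∪ tsupport φ₀) := hc.isCompact.union hc₀.isCompact
    have hKs : tsupport φ ∪ tsupport φ₀ ⊆ Ioo 0 l := union_subset hs hs₀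
    have hz : ∀ x, x ∉ tsupport φ ∪ tsupport φ₀ → η x = 0 := fun x hx => by
      simp only [mem_union, not_or] at hx
      simp [hη, image_eq_zero_of_notMem_tsupport hx.1, image_eq_zero_of_notMem_tsupport hx.2]
    rcases (tsupport φ ∪ tsupport φ₀).eq_empty_or_nonempty with he | hne
    · exact ⟨l / 2, l / 2, by linarith, by linarith, fun x _ => hz x (by simp [he])⟩
    · obtain ⟨α, hα, hαm⟩ := hK.exists_isLeast hne
      obtain ⟨β, hβ, hβm⟩ := hK.exists_isGreatest hne
      exact ⟨α, β, (hKs hα).1, (hKs hβ).2, fun x hx =>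
        hz x fun hh => hx ⟨hαm hh, hβm hh⟩⟩
  set Φ : ℝ → ℝ := fun x => ∫ y in (0:ℝ)..x, η y with hΦ
  have hΦd : ∀ x, HasDerivAt Φ (η x) x := fun x =>
    (hηs.continuous.integral_hasStrictDerivAt 0 x).hasDerivAt
  have hΦ' : deriv Φ = η := funext fun x => (hΦd x).deriv
  have hΦs : ContDiff ℝ ∞ Φ := by
    rw [contDiff_infty_iff_deriv, hΦ']
    exact ⟨fun x => (hΦd x).differentiableAt, hηs⟩
  have hηi : Integrable η := (hφ.continuous.integrable_of_hasCompactSupport hc).sub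
    ((hφ₀.continuous.integrable_of_hasCompactSupport hc₀).const_mul m)
  have hΦz : ∀ x, x ∉ Icc α β → Φ x = 0 := by
    intro x hx
    rcases lt_or_ge x α with hxα | hxα
    · have : ∀ y ∈ uIcc 0 x, η y = 0 := fun y hy => hαβ y fun hy' => by
        rcases le_total 0 x with h0 | h0
        · rw [uIcc_of_le h0] at hy; linarith [hy.2, hy'.1]
        · rw [uIcc_of_ge h0] at hy; linarith [hy.2, hy'.1]
      simp only [hΦ]
      rw [intervalIntegral.integral_congr (g := fun _ => 0) this]
      simp
    · have hxβ : β < x := by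
        by_contra hh; exact hx ⟨hxα, not_lt.mp hh⟩
      have hx0 : 0 ≤ x := hα.le.trans hxα
      simp only [hΦ]
      rw [intervalIntegral.integral_of_le hx0, setIntegral_eq_integral_of_forall_compl_eq_zero,
        hη0]
      intro y hy
      refine hαβ y fun hy' => hy ⟨hα.trans_le hy'.1, hy'.2.trans hxβ.le⟩
  have hΦt : tsupport Φ ⊆ Icc α β :=
    closure_minimal (fun x hx => by by_contra hh; exact hx (hΦz x hh)) isClosed_Icc
  have hkey := h.3 Φ hΦs (HasCompactSupport.of_support_subset_isCompact isCompact_Icc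
    (subset_tsupport _ |>.trans hΦt)) (hΦt.trans fun x hx => ⟨hα.trans_le hx.1, hx.2.trans_lt hβ⟩)
  simp only [smul_zero, integral_zero, neg_zero, hΦ'] at hkey
  have hz : ∀ x, x ∉ Ioo 0 l → φ x • (f x - c) = 0 := fun x hx => by
    rw [zero_of_tsupport hs hx, zero_smul]
  rw [← setIntegral_eq_integral_of_forall_compl_eq_zero hz]
  have hmI : ∫ x in Ioo 0 l, (φ x : ℂ) = m := by
    rw [setIntegral_eq_integral_of_forall_compl_eq_zero
      (fun x hx => by rw [zero_of_tsupport hs hx]; simp), hm]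
    exact integral_ofReal
  have i1 := integrable_smul_test h.1 hφ.continuous hc
  have i2 := integrable_smul_test h.1 hφ₀.continuous hc₀
  have e1 : ∀ x, η x • f x = φ x • f x - m * (φ₀ x • f x) := fun x => by
    simp only [hη, Complex.real_smul]; push_cast; ring
  simp only [e1] at hkey
  rw [integral_sub i1 (i2.const_mul _), integral_const_mul] at hkey
  have e2 : ∀ x, φ x • (f x - c) = φ x • f x - φ x * c := fun x => by
    simp only [Complex.real_smul]; ring
  simp only [e2]
  have i3 : IntegrableOn (fun x => (φ x : ℂ) * c) (Ioo 0 l) :=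
    integrableOn_of_continuousOn
      ((Complex.continuous_ofReal.comp hφ.continuous).mul continuous_const).continuousOn
  rw [integral_sub i1 i3, integral_mul_const, hmI]
  exact hkey

/-- A function with an integrable weak derivative is a primitive of it. -/
theorem exists_eq_primitive {l : ℝ} (hl : 0 < l) {f g : ℝ → ℂ} (h : HasWeakDeriv l f g) :
    ∃ c : ℂ, f =ᵐ[volume.restrict (Ioo 0 l)] fun x => c + ∫ y in (0:ℝ)..x, g y := by
  have h0 := h.sub (of_primitive hl 0 h.2)
  simp only [sub_self, zero_add] at h0
  obtain ⟨c, hc⟩ := ae_eq_const_of_deriv_zero hl h0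
  exact ⟨c, hc.mono fun x hx => sub_eq_iff_eq_add.mp hx⟩

/-- The product rule for a weakly differentiable and a continuously differentiable function. -/
theorem mul_left {l : ℝ} (hl : 0 < l) {a a' f g : ℝ → ℂ} (ha : ContinuousOn a (Icc 0 l))
    (ha' : ContinuousOn a' (Icc 0 l)) (hd : ∀ x ∈ Ioo 0 l, HasDerivAt a (a' x) x)
    (h : HasWeakDeriv l f g) :
    HasWeakDeriv l (fun x => a x * f x) (fun x => a' x * f x + a x * g x) := by
  obtain ⟨c, hc⟩ := h.exists_eq_primitive hl
  refine (of_mul_primitive hl c ha ha' hd h.2).congr ?_ ?_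
  · filter_upwards [hc] with x hx; rw [hx]
  · filter_upwards [hc] with x hx; rw [hx]

/-- Two continuous functions on a closed interval that agree almost everywhere are equal. -/
theorem eqOn_of_ae_eq {l : ℝ} (hl : 0 < l) {u v : ℝ → ℂ} (hu : ContinuousOn u (Icc 0 l))
    (hv : ContinuousOn v (Icc 0 l)) (h : u =ᵐ[volume.restrict (Ioo 0 l)] v) :
    EqOn u v (Icc 0 l) := by
  refine Measure.eqOn_Icc_of_ae_eq volume hl.ne ?_ hu hv
  rwa [← restrict_Ioo_eq_restrict_Icc]

/-- The fundamental theorem of calculus for the continuous representative. -/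
theorem eq_primitive {l : ℝ} (hl : 0 < l) {u g : ℝ → ℂ} (hu : ContinuousOn u (Icc 0 l))
    (h : HasWeakDeriv l u g) {x : ℝ} (hx : x ∈ Icc 0 l) :
    u x = u 0 + ∫ y in (0:ℝ)..x, g y := by
  obtain ⟨c, hc⟩ := h.exists_eq_primitive hl
  have he := eqOn_of_ae_eq hl hu (continuousOn_const.add (continuousOn_primitive hl h.2)) hc
  have h0 := he (left_mem_Icc.mpr hl.le)
  have h0' : u 0 = c := by simpa using h0
  rw [h0']; exact he hx

end HasWeakDeriv

/-! ### Bounded operators in `L₂` of an edge -/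

/-- The space `L₂(0, l)` of an edge of length `l`. -/
abbrev EdgeL2 (l : ℝ) : Type := Lp ℂ 2 ((volume : Measure ℝ).restrict (Ioo 0 l))

namespace EdgeL2

variable {l : ℝ}

theorem integrableOn (f : EdgeL2 l) : IntegrableOn f (Ioo 0 l) :=
  (Lp.memLp f).integrable one_le_two

theorem memLp_of_continuousOn {u : ℝ → ℂ} (hu : ContinuousOn u (Icc 0 l)) :
    MemLp u 2 ((volume : Measure ℝ).restrict (Ioo 0 l)) := by
  obtain ⟨C, hC⟩ := isCompact_Icc.exists_bound_of_continuousOn hu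
  refine MemLp.of_bound ((hu.mono Ioo_subset_Icc_self).aestronglyMeasurable measurableSet_Ioo) C ?_
  filter_upwards [ae_restrict_mem measurableSet_Ioo] with x hx
  exact hC x (Ioo_subset_Icc_self hx)

theorem memLp_mul {a : ℝ → ℂ} (ha : ContinuousOn a (Icc 0 l)) (f : EdgeL2 l) :
    MemLp (fun x => a x * f x) 2 ((volume : Measure ℝ).restrict (Ioo 0 l)) := by
  obtain ⟨C, hC⟩ := isCompact_Icc.exists_bound_of_continuousOn ha
  refine (Lp.memLp f).of_le_mul (c := C)
    (((ha.mono Ioo_subset_Icc_self).aestronglyMeasurable measurableSet_Ioo).mul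
      (Lp.memLp f).1) ?_
  filter_upwards [ae_restrict_mem measurableSet_Ioo] with x hx
  rw [norm_mul]
  exact mul_le_mul_of_nonneg_right (hC x (Ioo_subset_Icc_self hx)) (norm_nonneg _)

/-- The multiplication by a function which is continuous on the closed edge. -/
def mul (a : ℝ → ℂ) (ha : ContinuousOn a (Icc 0 l)) : EdgeL2 l →L[ℂ] EdgeL2 l :=
  LinearMap.mkContinuousOfExistsBound
    { toFun := fun f => (memLp_mul ha f).toLp
      map_add' := fun f g => by
        refine Lp.ext ?_
        filter_upwards [(memLp_mul ha (f + g)).coeFn_toLp, (memLp_mul ha f).coeFn_toLp,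
          (memLp_mul ha g).coeFn_toLp, Lp.coeFn_add f g,
          Lp.coeFn_add (memLp_mul ha f).toLp (memLp_mul ha g).toLp] with x h1 h2 h3 h4 h5
        rw [h1, h5, Pi.add_apply, h2, h3, h4, Pi.add_apply, mul_add]
      map_smul' := fun c f => by
        refine Lp.ext ?_
        filter_upwards [(memLp_mul ha (c • f)).coeFn_toLp, (memLp_mul ha f).coeFn_toLp,
          Lp.coeFn_smul c f, Lp.coeFn_smul c (memLp_mul ha f).toLp] with x h1 h2 h4 h5
        rw [h1, RingHom.id_apply, h5, Pi.smul_apply, h2, h4, Pi.smul_apply, smul_eq_mul,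
          smul_eq_mul, mul_left_comm] } <| by
    obtain ⟨C, hC⟩ := isCompact_Icc.exists_bound_of_continuousOn ha
    refine ⟨C, fun f => Lp.norm_le_mul_norm_of_ae_le_mul ?_⟩
    filter_upwards [(memLp_mul ha f).coeFn_toLp, ae_restrict_mem measurableSet_Ioo] with x h1 hx
    simp only [LinearMap.coe_mk, AddHom.coe_mk]
    rw [h1, norm_mul]
    exact mul_le_mul_of_nonneg_right (hC x (Ioo_subset_Icc_self hx)) (norm_nonneg _)

theorem coeFn_mul {a : ℝ → ℂ} (ha : ContinuousOn a (Icc 0 l)) (f : EdgeL2 l) :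
    (mul a ha f : ℝ → ℂ) =ᵐ[volume.restrict (Ioo 0 l)] fun x => a x * f x :=
  (memLp_mul ha f).coeFn_toLp

theorem norm_mul_le {a : ℝ → ℂ} (ha : ContinuousOn a (Icc 0 l)) {C : ℝ}
    (hC : ∀ x ∈ Ioo 0 l, ‖a x‖ ≤ C) (f : EdgeL2 l) : ‖mul a ha f‖ ≤ C * ‖f‖ := by
  refine Lp.norm_le_mul_norm_of_ae_le_mul ?_
  filter_upwards [coeFn_mul ha f, ae_restrict_mem measurableSet_Ioo] with x h1 hx
  rw [h1, norm_mul]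
  exact mul_le_mul_of_nonneg_right (hC x hx) (norm_nonneg _)

theorem exists_integral_norm_le (l : ℝ) :
    ∃ C, 0 ≤ C ∧ ∀ f : EdgeL2 l, ∫ x in Ioo 0 l, ‖f x‖ ≤ C * ‖f‖ := by
  refine ⟨((volume.restrict (Ioo 0 l)) univ ^ (1 / (1 : ENNReal).toReal - 1 / (2 : ENNReal).toReal)
    : ENNReal).toReal, ENNReal.toReal_nonneg, fun f => ?_⟩
  have h := eLpNorm_le_eLpNorm_mul_rpow_measure_univ (μ := volume.restrict (Ioo 0 l)) (p := 1)
    (q := 2) one_le_two (Lp.memLp f).1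
  have h1 := integral_norm_eq_lintegral_enorm (Lp.memLp f).1
  rw [h1, ← eLpNorm_one_eq_lintegral_enorm, Lp.norm_def, mul_comm, ← ENNReal.toReal_mul]
  refine ENNReal.toReal_mono (ENNReal.mul_ne_top (Lp.memLp f).2.ne ?_) h
  refine (ENNReal.rpow_lt_top_of_nonneg ?_ ?_).ne
  · norm_num
  · simp

/-- The integral over the edge. -/
def integralCLM (l : ℝ) : EdgeL2 l →L[ℂ] ℂ :=
  LinearMap.mkContinuousOfExistsBound
    { toFun := fun f => ∫ x in Ioo 0 l, f x
      map_add' := fun f g => by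
        rw [← integral_add f.integrableOn g.integrableOn]
        exact integral_congr_ae (Lp.coeFn_add f g)
      map_smul' := fun c f => by
        rw [RingHom.id_apply, ← integral_smul]
        exact integral_congr_ae (Lp.coeFn_smul c f) } <| by
    obtain ⟨C, -, hC⟩ := exists_integral_norm_le l
    exact ⟨C, fun f => (norm_integral_le_integral_norm _).trans (hC f)⟩

theorem integralCLM_apply (hl : 0 < l) (f : EdgeL2 l) :
    integralCLM l f = ∫ x in (0:ℝ)..l, f x := by
  rw [intervalIntegral.integral_of_le hl.le, integral_Ioc_eq_integral_Ioo]
  rfl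

theorem primitive_congr {f g : ℝ → ℂ} (h : f =ᵐ[volume.restrict (Ioo 0 l)] g) {x : ℝ}
    (hx : x ∈ Icc 0 l) : ∫ y in (0:ℝ)..x, f y = ∫ y in (0:ℝ)..x, g y := by
  rw [intervalIntegral.integral_of_le hx.1, intervalIntegral.integral_of_le hx.1,
    integral_Ioc_eq_integral_Ioo, integral_Ioc_eq_integral_Ioo]
  exact integral_congr_ae (ae_restrict_of_ae_restrict_of_subset (Ioo_subset_Ioo_right hx.2) h)

theorem intervalIntegrable {f : ℝ → ℂ} (hf : IntegrableOn f (Ioo 0 l)) {x : ℝ}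
    (hx : x ∈ Icc 0 l) : IntervalIntegrable f volume 0 x := by
  rw [intervalIntegrable_iff_integrableOn_Ioo_of_le hx.1]
  exact hf.mono_set (Ioo_subset_Ioo_right hx.2)

theorem continuousOn_primitive_coe (hl : 0 < l) (f : EdgeL2 l) :
    ContinuousOn (fun x => ∫ y in (0:ℝ)..x, f y) (Icc 0 l) :=
  HasWeakDeriv.continuousOn_primitive hl f.integrableOn

/-- The Volterra operator `f ↦ ∫₀ˣ f`. -/
def primitive (hl : 0 < l) : EdgeL2 l →L[ℂ] EdgeL2 l :=
  LinearMap.mkContinuousOfExistsBound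
    { toFun := fun f => (memLp_of_continuousOn (continuousOn_primitive_coe hl f)).toLp
      map_add' := fun f g => by
        refine Lp.ext ?_
        filter_upwards [(memLp_of_continuousOn (continuousOn_primitive_coe hl (f + g))).coeFn_toLp,
          (memLp_of_continuousOn (continuousOn_primitive_coe hl f)).coeFn_toLp,
          (memLp_of_continuousOn (continuousOn_primitive_coe hl g)).coeFn_toLp,
          Lp.coeFn_add (memLp_of_continuousOn (continuousOn_primitive_coe hl f)).toLp
            (memLp_of_continuousOn (continuousOn_primitive_coe hl g)).toLp,
          ae_restrict_mem measurableSet_Ioo] with x h1 h2 h3 h4 hx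
        have hx' := Ioo_subset_Icc_self hx
        rw [h1, h4, Pi.add_apply, h2, h3, primitive_congr (Lp.coeFn_add f g) hx',
          ← intervalIntegral.integral_add (intervalIntegrable f.integrableOn hx')
            (intervalIntegrable g.integrableOn hx')]
        rfl
      map_smul' := fun c f => by
        refine Lp.ext ?_
        filter_upwards [(memLp_of_continuousOn (continuousOn_primitive_coe hl (c • f))).coeFn_toLp,
          (memLp_of_continuousOn (continuousOn_primitive_coe hl f)).coeFn_toLp,
          Lp.coeFn_smul c (memLp_of_continuousOn (continuousOn_primitive_coe hl f)).toLp,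
          ae_restrict_mem measurableSet_Ioo] with x h1 h2 h4 hx
        have hx' := Ioo_subset_Icc_self hx
        rw [h1, RingHom.id_apply, h4, Pi.smul_apply, h2, primitive_congr (Lp.coeFn_smul c f) hx',
          ← intervalIntegral.integral_smul]
        rfl } <| by
    obtain ⟨C, hC0, hC⟩ := exists_integral_norm_le l
    refine ⟨measureUnivNNReal (volume.restrict (Ioo 0 l)) ^ (ENNReal.toReal 2)⁻¹ * C,
      fun f => ?_⟩
    have := Lp.norm_le_of_ae_bound (μ := volume.restrict (Ioo 0 l)) (p := 2)
      (f := (memLp_of_continuousOn (continuousOn_primitive_coe hl f)).toLp)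
      (C := C * ‖f‖) (by positivity) ?_
    · rw [mul_assoc]
      exact this
    · filter_upwards [(memLp_of_continuousOn (continuousOn_primitive_coe hl f)).coeFn_toLp,
        ae_restrict_mem measurableSet_Ioo] with x h1 hx
      rw [h1, intervalIntegral.integral_of_le hx.1.le, integral_Ioc_eq_integral_Ioo]
      refine (norm_integral_le_integral_norm _).trans (le_trans ?_ (hC f))
      exact setIntegral_mono_set f.integrableOn.norm
        (Filter.Eventually.of_forall fun _ => norm_nonneg _)
        (Ioo_subset_Ioo_right hx.2.le).eventuallyLE

theorem coeFn_primitive (hl : 0 < l) (f : EdgeL2 l) :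
    (primitive hl f : ℝ → ℂ) =ᵐ[volume.restrict (Ioo 0 l)] fun x => ∫ y in (0:ℝ)..x, f y :=
  (memLp_of_continuousOn (continuousOn_primitive_coe hl f)).coeFn_toLp

/-- The constant function one. -/
def one (l : ℝ) : EdgeL2 l :=
  (memLp_of_continuousOn (l := l) (continuousOn_const (c := (1 : ℂ)))).toLp

theorem coeFn_one (l : ℝ) : (one l : ℝ → ℂ) =ᵐ[volume.restrict (Ioo 0 l)] fun _ => 1 :=
  (memLp_of_continuousOn (l := l) (continuousOn_const (c := (1 : ℂ)))).coeFn_toLp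

end EdgeL2

/-! ### The magnetic equation on an edge as a first order system -/

/-- The first order system behind the magnetic Laplacian on an edge: `u` is the continuous
representative of `f`, `w` is the continuous representative of the flux `b² (d/dx + i A) f`, and
`h = - (d/dx + i A) w`. -/
structure IsFluxPair (l : ℝ) (b A : ℝ → ℝ) (f h u w : ℝ → ℂ) : Prop where
  continuousOn_fun : ContinuousOn u (Icc 0 l)
  continuousOn_flux : ContinuousOn w (Icc 0 l)
  ae_eq : f =ᵐ[volume.restrict (Ioo 0 l)] u
  weakDeriv_fun : HasWeakDeriv l u fun x => ((b x : ℂ) ^ 2)⁻¹ * w x - Complex.I * A x * u x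
  weakDeriv_flux : HasWeakDeriv l w fun x => - h x - Complex.I * A x * w x

namespace IsFluxPair

variable {l : ℝ} {b A : ℝ → ℝ} {f h u w : ℝ → ℂ}

theorem congr (hp : IsFluxPair l b A f h u w) {b' A' : ℝ → ℝ} {f' h' : ℝ → ℂ}
    (hb : EqOn b b' (Icc 0 l)) (hA : EqOn A A' (Icc 0 l))
    (hf : f =ᵐ[volume.restrict (Ioo 0 l)] f') (hh : h =ᵐ[volume.restrict (Ioo 0 l)] h') :
    IsFluxPair l b' A' f' h' u w := by
  refine ⟨hp.1, hp.2, hf.symm.trans hp.3, hp.4.congr Filter.EventuallyEq.rfl ?_,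
    hp.5.congr Filter.EventuallyEq.rfl ?_⟩
  · filter_upwards [ae_restrict_mem measurableSet_Ioo] with x hx
    rw [hb (Ioo_subset_Icc_self hx), hA (Ioo_subset_Icc_self hx)]
  · filter_upwards [ae_restrict_mem measurableSet_Ioo, hh] with x hx hx'
    rw [hA (Ioo_subset_Icc_self hx), hx']

theorem congr_iff {l l' : ℝ} {b b' A A' : ℝ → ℝ} {f f' h h' u w : ℝ → ℂ} (hl : l = l')
    (hb : EqOn b b' (Icc 0 l)) (hA : EqOn A A' (Icc 0 l))
    (hf : f =ᵐ[volume.restrict (Ioo 0 l)] f') (hh : h =ᵐ[volume.restrict (Ioo 0 l)] h') :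
    IsFluxPair l b A f h u w ↔ IsFluxPair l' b' A' f' h' u w := by
  subst hl
  exact ⟨fun H => H.congr hb hA hf hh, fun H => H.congr hb.symm hA.symm hf.symm hh.symm⟩

/-- Gauge covariance: multiplication by `m` with `m' = - i a m` adds `a` to the potential. -/
theorem gauge (hl : 0 < l) {a : ℝ → ℝ} {m : ℝ → ℂ} (ha : ContinuousOn a (Icc 0 l))
    (hm : ContinuousOn m (Icc 0 l))
    (hd : ∀ x ∈ Ioo 0 l, HasDerivAt m (-(Complex.I * a x) * m x) x)
    (hp : IsFluxPair l b A f h u w) :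
    IsFluxPair l b (fun x => A x + a x) (fun x => m x * f x) (fun x => m x * h x)
      (fun x => m x * u x) (fun x => m x * w x) := by
  have ham : ContinuousOn (fun x => -(Complex.I * a x) * m x) (Icc 0 l) :=
    ((continuousOn_const.mul (Complex.continuous_ofReal.comp_continuousOn ha)).neg).mul hm
  refine ⟨hm.mul hp.1, hm.mul hp.2, hp.3.mono fun x hx => by simp only [hx],
    (hp.4.mul_left hl hm ham hd).congr Filter.EventuallyEq.rfl ?_,
    (hp.5.mul_left hl hm ham hd).congr Filter.EventuallyEq.rfl ?_⟩
  · exact Filter.Eventually.of_forall fun x => by push_cast; ring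
  · exact Filter.Eventually.of_forall fun x => by push_cast; ring

end IsFluxPair

/-- The two ends of an edge of length `l`: the origin `0` and the terminal point `l`. -/
def endPos (l : ℝ) : Bool → ℝ
  | false => 0
  | true => l

/-- Bounded operators that encode the first order system of an edge: the pairs `(f, h)` for which
it is solvable are the kernel of `defect`, and `value`, `flux` and `fluxFun` recover the
boundary values of the solution, those of its flux, and the flux itself. -/
structure EdgeOperators (l : ℝ) (b A : ℝ → ℝ) where
  defect : EdgeL2 l × EdgeL2 l →L[ℂ] EdgeL2 l
  value : Bool → EdgeL2 l × EdgeL2 l →L[ℂ] ℂ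
  flux : Bool → EdgeL2 l × EdgeL2 l →L[ℂ] ℂ
  fluxFun : EdgeL2 l × EdgeL2 l →L[ℂ] EdgeL2 l
  exists_of_defect : ∀ p, defect p = 0 → ∃ u w, IsFluxPair l b A p.1 p.2 u w
  defect_eq_zero : ∀ p u w, IsFluxPair l b A p.1 p.2 u w → defect p = 0
  value_eq : ∀ p u w, IsFluxPair l b A p.1 p.2 u w → ∀ s, u (endPos l s) = value s p
  flux_eq : ∀ p u w, IsFluxPair l b A p.1 p.2 u w → ∀ s, w (endPos l s) = flux s p
  fluxFun_ae : ∀ p u w, IsFluxPair l b A p.1 p.2 u w →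
    fluxFun p =ᵐ[volume.restrict (Ioo 0 l)] w

section Solve

variable {l : ℝ} {b : ℝ → ℝ}

theorem continuousOn_inv_sq (hb : ContinuousOn b (Icc 0 l)) (hpos : ∀ x ∈ Icc 0 l, 0 < b x) :
    ContinuousOn (fun x => ((b x : ℂ) ^ 2)⁻¹) (Icc 0 l) :=
  ((Complex.continuous_ofReal.comp_continuousOn hb).pow 2).inv₀ fun x hx =>
    pow_ne_zero 2 (Complex.ofReal_ne_zero.mpr (hpos x hx).ne')

/-- The solution of `w' = 0`, `u' = b⁻² w` with initial values `u 0 = c.1` and `w 0 = c.2`. -/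
def homogeneousSolution (hl : 0 < l) (κ : ℝ → ℂ) (hκ : ContinuousOn κ (Icc 0 l)) :
    ℂ × ℂ →L[ℂ] EdgeL2 l :=
  (ContinuousLinearMap.fst ℂ ℂ ℂ).smulRight (EdgeL2.one l) +
    (ContinuousLinearMap.snd ℂ ℂ ℂ).smulRight
      (EdgeL2.primitive hl (EdgeL2.mul κ hκ (EdgeL2.one l)))

theorem homogeneousSolution_ae (hl : 0 < l) {κ : ℝ → ℂ} (hκ : ContinuousOn κ (Icc 0 l))
    (c : ℂ × ℂ) :
    (homogeneousSolution hl κ hκ c : ℝ → ℂ) =ᵐ[volume.restrict (Ioo 0 l)]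
      fun x => c.1 + ∫ y in (0:ℝ)..x, c.2 * κ y := by
  have h1 : (EdgeL2.mul κ hκ (EdgeL2.one l) : ℝ → ℂ) =ᵐ[volume.restrict (Ioo 0 l)] κ := by
    filter_upwards [EdgeL2.coeFn_mul hκ (EdgeL2.one l), EdgeL2.coeFn_one l] with x h1 h2
    rw [h1, h2, mul_one]
  have h2 := EdgeL2.coeFn_primitive hl (EdgeL2.mul κ hκ (EdgeL2.one l))
  simp only [homogeneousSolution, add_apply,
    ContinuousLinearMap.smulRight_apply, ContinuousLinearMap.coe_fst', ContinuousLinearMap.coe_snd']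
  filter_upwards [h2, EdgeL2.coeFn_one l, ae_restrict_mem measurableSet_Ioo,
    Lp.coeFn_add (c.1 • EdgeL2.one l)
      (c.2 • EdgeL2.primitive hl (EdgeL2.mul κ hκ (EdgeL2.one l))),
    Lp.coeFn_smul c.1 (EdgeL2.one l),
    Lp.coeFn_smul c.2 (EdgeL2.primitive hl (EdgeL2.mul κ hκ (EdgeL2.one l)))]
    with x a1 a2 hx a4 a5 a6
  rw [a4, Pi.add_apply, a5, a6, Pi.smul_apply, Pi.smul_apply, a1, a2,
    EdgeL2.primitive_congr h1 (Ioo_subset_Icc_self hx), intervalIntegral.integral_const_mul]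
  simp

theorem homogeneousSolution_injective (hl : 0 < l) {κ : ℝ → ℂ} (hκ : ContinuousOn κ (Icc 0 l))
    (h0 : κ 0 ≠ 0) : Function.Injective (homogeneousSolution hl κ hκ) := by
  rw [injective_iff_map_eq_zero]
  intro c hc
  have hae := homogeneousSolution_ae hl hκ c
  rw [hc] at hae
  have hz : (fun x => c.1 + ∫ y in (0:ℝ)..x, c.2 * κ y)
      =ᵐ[volume.restrict (Ioo 0 l)] fun _ => 0 :=
    hae.symm.trans (Lp.coeFn_zero _ _ _)
  have hi : IntegrableOn (fun y => c.2 * κ y) (Ioo 0 l) :=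
    HasWeakDeriv.integrableOn_of_continuousOn (continuousOn_const.mul hκ)
  have e1 := HasWeakDeriv.eqOn_of_ae_eq hl
    (continuousOn_const.add (HasWeakDeriv.continuousOn_primitive hl hi)) continuousOn_const hz
    (left_mem_Icc.mpr hl.le)
  have e2 := HasWeakDeriv.eqOn_of_ae_eq hl (continuousOn_const.mul hκ) continuousOn_const
    ((HasWeakDeriv.of_primitive hl c.1 hi).eq_zero_of_fun_eq_zero hz) (left_mem_Icc.mpr hl.le)
  refine Prod.ext ?_ ?_
  · simpa using e1
  · simpa [h0] using e2

/-- The initial values depend boundedly on the solution: the solutions form a finite-dimensional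
space, on which the orthogonal projection can be followed by the inverse of
`homogeneousSolution`. -/
theorem homogeneousSolution_hasLeftInverse (hl : 0 < l) {κ : ℝ → ℂ}
    (hκ : ContinuousOn κ (Icc 0 l)) (h0 : κ 0 ≠ 0) :
    ∃ Λ : EdgeL2 l →L[ℂ] ℂ × ℂ, ∀ c, Λ (homogeneousSolution hl κ hκ c) = c := by
  set L := homogeneousSolution hl κ hκ
  have hinj := homogeneousSolution_injective hl hκ h0
  have : FiniteDimensional ℂ L.range := inferInstanceAs (FiniteDimensional ℂ (LinearMap.range _))
  let e : (ℂ × ℂ) ≃ₗ[ℂ] L.range := LinearEquiv.ofInjective L.toLinearMap hinj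
  refine ⟨(LinearMap.toContinuousLinearMap e.symm.toLinearMap).comp
    (L.range.orthogonalProjectionOnto), fun c => ?_⟩
  have : L.range.orthogonalProjectionOnto (L c) = e c := by
    exact Submodule.orthogonalProjectionOnto_mem_subspace_eq_self (K := L.range) (e c)
  simp [this]

/-- The edge operators without magnetic potential: with `V` the Volterra operator the system
reads `w = w(0) - V h` and `f = u(0) + V b⁻² w`, and its two initial values are bounded
functionals of `f + V b⁻² V h`. -/
theorem exists_edgeOperators_zero (hl : 0 < l) (hb : ContinuousOn b (Icc 0 l))
    (hpos : ∀ x ∈ Icc 0 l, 0 < b x) : Nonempty (EdgeOperators l b fun _ => 0) := by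
  set κ : ℝ → ℂ := fun x => ((b x : ℂ) ^ 2)⁻¹ with hκdef
  have hκ : ContinuousOn κ (Icc 0 l) := continuousOn_inv_sq hb hpos
  have hκ0 : κ 0 ≠ 0 := inv_ne_zero <| pow_ne_zero 2 <|
    Complex.ofReal_ne_zero.mpr (hpos 0 (left_mem_Icc.mpr hl.le)).ne'
  obtain ⟨Λ, hΛ⟩ := homogeneousSolution_hasLeftInverse hl hκ hκ0
  set L := homogeneousSolution hl κ hκ with hL
  set K := EdgeL2.mul κ hκ with hK
  set V := EdgeL2.primitive hl with hV
  let R : EdgeL2 l × EdgeL2 l →L[ℂ] EdgeL2 l :=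
    ContinuousLinearMap.fst ℂ _ _ + (V.comp (K.comp V)).comp (ContinuousLinearMap.snd ℂ _ _)
  let C : EdgeL2 l × EdgeL2 l →L[ℂ] ℂ × ℂ := Λ.comp R
  let c0 : EdgeL2 l × EdgeL2 l →L[ℂ] ℂ := (ContinuousLinearMap.fst ℂ ℂ ℂ).comp C
  let c1 : EdgeL2 l × EdgeL2 l →L[ℂ] ℂ := (ContinuousLinearMap.snd ℂ ℂ ℂ).comp C
  let W : EdgeL2 l × EdgeL2 l →L[ℂ] EdgeL2 l :=
    c1.smulRight (EdgeL2.one l) - V.comp (ContinuousLinearMap.snd ℂ _ _)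
  let w' : EdgeL2 l × EdgeL2 l → ℝ → ℂ := fun p x => c1 p + ∫ y in (0:ℝ)..x, - p.2 y
  have hW : ∀ p, W p =ᵐ[volume.restrict (Ioo 0 l)] w' p := fun p => by
    have : W p = c1 p • EdgeL2.one l - V p.2 := rfl
    rw [this]
    filter_upwards [Lp.coeFn_sub (c1 p • EdgeL2.one l) (V p.2),
      Lp.coeFn_smul (c1 p) (EdgeL2.one l), EdgeL2.coeFn_one l, EdgeL2.coeFn_primitive hl p.2]
      with x a1 a2 a3 a4
    rw [a1, Pi.sub_apply, a2, Pi.smul_apply, a3, a4]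
    simp [w', intervalIntegral.integral_neg, sub_eq_add_neg]
  have hneg : ∀ p : EdgeL2 l × EdgeL2 l, IntegrableOn (fun y => - p.2 y) (Ioo 0 l) :=
    fun p => p.2.integrableOn.neg
  have hw'c : ∀ p, ContinuousOn (w' p) (Icc 0 l) := fun p =>
    continuousOn_const.add (HasWeakDeriv.continuousOn_primitive hl (hneg p))
  have hKW : ∀ p, K (W p) =ᵐ[volume.restrict (Ioo 0 l)] fun x => κ x * w' p x := fun p => by
    filter_upwards [EdgeL2.coeFn_mul hκ (W p), hW p] with x a1 a2
    rw [a1, a2]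
  let u' : EdgeL2 l × EdgeL2 l → ℝ → ℂ := fun p x => c0 p + ∫ y in (0:ℝ)..x, κ y * w' p y
  have hi : ∀ p, IntegrableOn (fun y => κ y * w' p y) (Ioo 0 l) := fun p =>
    HasWeakDeriv.integrableOn_of_continuousOn (hκ.mul (hw'c p))
  have hu'c : ∀ p, ContinuousOn (u' p) (Icc 0 l) := fun p =>
    continuousOn_const.add (HasWeakDeriv.continuousOn_primitive hl (hi p))
  -- the function with the recovered initial values, as an element of `L₂`
  have hU : ∀ p, (L (C p) - V (K (V p.2)) : EdgeL2 l) =ᵐ[volume.restrict (Ioo 0 l)] u' p :=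
    fun p => by
      have e : L (C p) - V (K (V p.2)) = c0 p • EdgeL2.one l + V (K (W p)) := by
        have e1 : W p = c1 p • EdgeL2.one l - V p.2 := rfl
        have e2 : L (C p) = c0 p • EdgeL2.one l + c1 p • V (K (EdgeL2.one l)) := rfl
        rw [e1, e2]; simp only [map_sub, map_smul]; abel
      rw [e]
      filter_upwards [Lp.coeFn_add (c0 p • EdgeL2.one l) (V (K (W p))),
        Lp.coeFn_smul (c0 p) (EdgeL2.one l), EdgeL2.coeFn_one l,
        EdgeL2.coeFn_primitive hl (K (W p)), ae_restrict_mem measurableSet_Ioo]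
        with x a1 a2 a3 a4 hx
      rw [a1, Pi.add_apply, a2, Pi.smul_apply, a3, a4,
        EdgeL2.primitive_congr (hKW p) (Ioo_subset_Icc_self hx)]
      simp [u']
  -- every solution has the recovered initial values
  have huniq : ∀ p u w, IsFluxPair l b (fun _ => 0) p.1 p.2 u w →
      C p = (u 0, w 0) ∧ L (C p) = R p := by
    intro p u w hp
    have hw : ∀ x ∈ Icc 0 l, w x = w 0 + ∫ y in (0:ℝ)..x, - p.2 y := fun x hx => by
      have := hp.weakDeriv_flux.eq_primitive hl hp.2 hx
      simpa using this
    have hu : ∀ x ∈ Icc 0 l, u x = u 0 + ∫ y in (0:ℝ)..x, κ y * w y := fun x hx => by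
      have := hp.weakDeriv_fun.eq_primitive hl hp.1 hx
      simpa using this
    have hKV : K (w 0 • EdgeL2.one l - V p.2)
        =ᵐ[volume.restrict (Ioo 0 l)] fun x => κ x * w x := by
      filter_upwards [EdgeL2.coeFn_mul hκ (w 0 • EdgeL2.one l - V p.2),
        Lp.coeFn_sub (w 0 • EdgeL2.one l) (V p.2),
        Lp.coeFn_smul (w 0) (EdgeL2.one l), EdgeL2.coeFn_one l, EdgeL2.coeFn_primitive hl p.2,
        ae_restrict_mem measurableSet_Ioo] with x a0 a1 a2 a3 a4 hx
      rw [a0, a1, Pi.sub_apply, a2, Pi.smul_apply, a3, a4, hw x (Ioo_subset_Icc_self hx)]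
      simp [intervalIntegral.integral_neg, sub_eq_add_neg]
    have hf : p.1 = u 0 • EdgeL2.one l + V (K (w 0 • EdgeL2.one l - V p.2)) := by
      refine Lp.ext ?_
      filter_upwards [Lp.coeFn_add (u 0 • EdgeL2.one l) (V (K (w 0 • EdgeL2.one l - V p.2))),
        Lp.coeFn_smul (u 0) (EdgeL2.one l), EdgeL2.coeFn_one l,
        EdgeL2.coeFn_primitive hl (K (w 0 • EdgeL2.one l - V p.2)), hp.3,
        ae_restrict_mem measurableSet_Ioo] with x a1 a2 a3 a4 a5 hx
      rw [a1, Pi.add_apply, a2, Pi.smul_apply, a3, a4, a5, hu x (Ioo_subset_Icc_self hx),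
        EdgeL2.primitive_congr hKV (Ioo_subset_Icc_self hx)]
      simp
    have hR : R p = L (u 0, w 0) := by
      have e1 : R p = p.1 + V (K (V p.2)) := rfl
      have e2 : L (u 0, w 0) = u 0 • EdgeL2.one l + w 0 • V (K (EdgeL2.one l)) := rfl
      rw [e1, e2, hf]; simp only [map_sub, map_smul]; abel
    have hC : C p = (u 0, w 0) := by
      have : C p = Λ (R p) := rfl
      rw [this, hR, hΛ]
    exact ⟨hC, by rw [hC, hR]⟩
  refine ⟨⟨R - L.comp C,
    fun s => match s with
      | false => c0
      | true => c0 + (EdgeL2.integralCLM l).comp (K.comp W),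
    fun s => match s with
      | false => c1
      | true => c1 - (EdgeL2.integralCLM l).comp (ContinuousLinearMap.snd ℂ _ _),
    W, ?_, ?_, ?_, ?_, ?_⟩⟩
  · intro p hp
    have hp' : R p = L (C p) := sub_eq_zero.mp hp
    have hf : p.1 = L (C p) - V (K (V p.2)) := by
      rw [← hp']; exact (add_sub_cancel_right _ _).symm
    refine ⟨u' p, w' p, hu'c p, hw'c p, ?_, ?_, ?_⟩
    · rw [hf]; exact hU p
    · refine (HasWeakDeriv.of_primitive hl (c0 p) (hi p)).congr Filter.EventuallyEq.rfl ?_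
      exact Filter.Eventually.of_forall fun x => by simp [hκdef]
    · refine (HasWeakDeriv.of_primitive hl (c1 p) (hneg p)).congr Filter.EventuallyEq.rfl ?_
      exact Filter.Eventually.of_forall fun x => by simp
  · intro p u w hp
    exact sub_eq_zero.mpr (huniq p u w hp).2.symm
  all_goals
    intro p u w hp
    have hC := (huniq p u w hp).1
    have h0 : c0 p = u 0 := congrArg Prod.fst hC
    have h1 : c1 p = w 0 := congrArg Prod.snd hC
    have hw : ∀ x ∈ Icc 0 l, w x = w' p x := fun x hx => by
      have := hp.weakDeriv_flux.eq_primitive hl hp.2 hx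
      simp only [Complex.ofReal_zero, mul_zero, zero_mul, sub_zero] at this
      simp only [w', h1]; exact this
  · intro s
    cases s
    · exact h0.symm
    · have hu := hp.weakDeriv_fun.eq_primitive hl hp.1 (right_mem_Icc.mpr hl.le)
      simp only [endPos, add_apply, ContinuousLinearMap.comp_apply,
        EdgeL2.integralCLM_apply hl, h0]
      rw [hu, EdgeL2.primitive_congr (hKW p) (right_mem_Icc.mpr hl.le)]
      congr 1
      refine intervalIntegral.integral_congr fun x hx => ?_
      rw [uIcc_of_le hl.le] at hx
      simp only [hw x hx, hκdef]
      simp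
  · intro s
    cases s
    · exact h1.symm
    · simp only [endPos, sub_apply, ContinuousLinearMap.comp_apply,
        EdgeL2.integralCLM_apply hl]
      rw [hw l (right_mem_Icc.mpr hl.le)]
      simp [w', intervalIntegral.integral_neg, sub_eq_add_neg]
  · filter_upwards [hW p, ae_restrict_mem measurableSet_Ioo] with x a hx
    rw [a, hw x (Ioo_subset_Icc_self hx)]

end Solve

/-! ### Gauging the magnetic potential away -/

section Phase

variable {l : ℝ} {A : ℝ → ℝ}

/-- The phase `exp (i c ∫₀ˣ A)`, which gauges the potential away for `c = 1`. The potential is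
extended by its boundary values, so that the phase is differentiable at the ends of the edge. -/
def gaugePhase (hl : 0 < l) (A : ℝ → ℝ) (c : ℝ) (x : ℝ) : ℂ :=
  Complex.exp (Complex.I * (c * ∫ y in (0:ℝ)..x, IccExtend hl.le ((Icc 0 l).domRestrict A) y : ℝ))

theorem hasDerivAt_gaugePhase (hl : 0 < l) (hA : ContinuousOn A (Icc 0 l)) (c : ℝ) {x : ℝ}
    (hx : x ∈ Icc 0 l) :
    HasDerivAt (gaugePhase hl A c) (Complex.I * (c * A x : ℝ) * gaugePhase hl A c x) x := by
  have hc : Continuous (IccExtend hl.le ((Icc 0 l).domRestrict A)) :=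
    (continuousOn_iff_continuous_domRestrict.mp hA).Icc_extend'
  have h1 := (hc.integral_hasStrictDerivAt 0 x).hasDerivAt
  rw [IccExtend_of_mem hl.le _ hx] at h1
  have h2 := ((h1.const_mul c).ofReal_comp.const_mul Complex.I).cexp
  rw [mul_comm] at h2
  exact h2

theorem continuousOn_gaugePhase (hl : 0 < l) (hA : ContinuousOn A (Icc 0 l)) (c : ℝ) :
    ContinuousOn (gaugePhase hl A c) (Icc 0 l) := fun _ hx =>
  (hasDerivAt_gaugePhase hl hA c hx).continuousAt.continuousWithinAt

theorem gaugePhase_neg_mul (hl : 0 < l) (A : ℝ → ℝ) (x : ℝ) :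
    gaugePhase hl A (-1) x * gaugePhase hl A 1 x = 1 := by
  rw [gaugePhase, gaugePhase, ← Complex.exp_add]
  push_cast
  simp

end Phase

section Solve

variable {l : ℝ} {b A : ℝ → ℝ}

/-- The edge operators for a magnetic potential, by gauging the potential away. -/
theorem exists_edgeOperators (hl : 0 < l) (hb : ContinuousOn b (Icc 0 l))
    (hA : ContinuousOn A (Icc 0 l)) (hpos : ∀ x ∈ Icc 0 l, 0 < b x) :
    Nonempty (EdgeOperators l b A) := by
  obtain ⟨O⟩ := exists_edgeOperators_zero hl hb hpos
  set m := gaugePhase hl A 1 with hm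
  set m' := gaugePhase hl A (-1) with hm'
  have hmc : ContinuousOn m (Icc 0 l) := continuousOn_gaugePhase hl hA 1
  have hmc' : ContinuousOn m' (Icc 0 l) := continuousOn_gaugePhase hl hA (-1)
  have hmm : ∀ x, m' x * m x = 1 := gaugePhase_neg_mul hl A
  set M := EdgeL2.mul m hmc
  set M' := EdgeL2.mul m' hmc'
  let Q : EdgeL2 l × EdgeL2 l →L[ℂ] EdgeL2 l × EdgeL2 l := M.prodMap M
  have hforth : ∀ (p : EdgeL2 l × EdgeL2 l) u w, IsFluxPair l b A p.1 p.2 u w →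
      IsFluxPair l b (fun _ => 0) (Q p).1 (Q p).2 (fun x => m x * u x) (fun x => m x * w x) := by
    intro p u w hp
    refine (hp.gauge hl (a := fun x => - A x) hA.neg hmc fun x hx => ?_).congr (fun _ _ => rfl)
      (fun x _ => by ring) (EdgeL2.coeFn_mul hmc p.1).symm (EdgeL2.coeFn_mul hmc p.2).symm
    have := hasDerivAt_gaugePhase hl hA 1 (Ioo_subset_Icc_self hx)
    convert this using 1
    push_cast; ring
  have hback : ∀ (p : EdgeL2 l × EdgeL2 l) u w,
      IsFluxPair l b (fun _ => 0) (Q p).1 (Q p).2 u w →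
      IsFluxPair l b A p.1 p.2 (fun x => m' x * u x) (fun x => m' x * w x) := by
    intro p u w hp
    have key : ∀ f : EdgeL2 l, (fun x => m' x * M f x) =ᵐ[volume.restrict (Ioo 0 l)] f :=
      fun f => by
        filter_upwards [EdgeL2.coeFn_mul hmc f] with x hx
        rw [hx, ← mul_assoc, hmm, one_mul]
    refine (hp.gauge hl (a := A) hA hmc' fun x hx => ?_).congr (fun _ _ => rfl)
      (fun x _ => by ring) (key p.1) (key p.2)
    have := hasDerivAt_gaugePhase hl hA (-1) (Ioo_subset_Icc_self hx)
    convert this using 1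
    push_cast; ring
  refine ⟨⟨O.defect.comp Q, fun s => m' (endPos l s) • (O.value s).comp Q,
    fun s => m' (endPos l s) • (O.flux s).comp Q, M'.comp (O.fluxFun.comp Q), ?_, ?_, ?_, ?_, ?_⟩⟩
  · intro p hp
    obtain ⟨u, w, h⟩ := O.exists_of_defect (Q p) hp
    exact ⟨_, _, hback p u w h⟩
  · intro p u w hp
    exact O.defect_eq_zero (Q p) _ _ (hforth p u w hp)
  · intro p u w hp s
    have := O.value_eq (Q p) _ _ (hforth p u w hp) s
    change _ = m' (endPos l s) * O.value s (Q p)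
    rw [← this, ← mul_assoc, hmm, one_mul]
  · intro p u w hp s
    have := O.flux_eq (Q p) _ _ (hforth p u w hp) s
    change _ = m' (endPos l s) * O.flux s (Q p)
    rw [← this, ← mul_assoc, hmm, one_mul]
  · intro p u w hp
    filter_upwards [O.fluxFun_ae (Q p) _ _ (hforth p u w hp),
      EdgeL2.coeFn_mul hmc' (O.fluxFun (Q p))] with x h1 h2
    change M' (O.fluxFun (Q p)) x = _
    rw [h2, h1, ← mul_assoc, hmm, one_mul]

/-- On the solutions of the first order system the first and second derivatives of the function
are bounded in terms of the two sides of the equation. -/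
theorem exists_sobolevOperators (hl : 0 < l) (hb : ContDiffOn ℝ 1 b (Icc 0 l))
    (hA : ContDiffOn ℝ 1 A (Icc 0 l)) (hpos : ∀ x ∈ Icc 0 l, 0 < b x) :
    ∃ D₁ D₂ : EdgeL2 l × EdgeL2 l →L[ℂ] EdgeL2 l, ∀ p u w, IsFluxPair l b A p.1 p.2 u w →
      HasWeakDeriv l p.1 (D₁ p) ∧ HasWeakDeriv l (D₁ p) (D₂ p) := by
  obtain ⟨O⟩ := exists_edgeOperators hl hb.continuousOn hA.continuousOn hpos
  set κ : ℝ → ℂ := fun x => ((b x : ℂ) ^ 2)⁻¹ with hκdef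
  have hκ1 : ContDiffOn ℝ 1 κ (Icc 0 l) :=
    ((Complex.ofRealCLM.contDiff.comp_contDiffOn hb).pow 2).inv fun x hx =>
      pow_ne_zero 2 (Complex.ofReal_ne_zero.mpr (hpos x hx).ne')
  set a : ℝ → ℂ := fun x => Complex.I * A x with hadef
  have ha1 : ContDiffOn ℝ 1 a (Icc 0 l) :=
    contDiffOn_const.mul (Complex.ofRealCLM.contDiff.comp_contDiffOn hA)
  have huniq : UniqueDiffOn ℝ (Icc 0 l) := uniqueDiffOn_Icc hl
  set κ' := derivWithin κ (Icc 0 l)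
  set a' := derivWithin a (Icc 0 l)
  have hκ : ContinuousOn κ (Icc 0 l) := hκ1.continuousOn
  have ha : ContinuousOn a (Icc 0 l) := ha1.continuousOn
  have hκ' : ContinuousOn κ' (Icc 0 l) := hκ1.continuousOn_derivWithin huniq le_rfl
  have ha' : ContinuousOn a' (Icc 0 l) := ha1.continuousOn_derivWithin huniq le_rfl
  have hd : ∀ {q : ℝ → ℂ}, ContDiffOn ℝ 1 q (Icc 0 l) → ∀ x ∈ Ioo 0 l,
      HasDerivAt q (derivWithin q (Icc 0 l) x) x := fun hq x hx =>
    ((hq.differentiableOn one_ne_zero x (Ioo_subset_Icc_self hx)).hasDerivWithinAt).hasDerivAt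
      (Icc_mem_nhds hx.1 hx.2)
  let F : EdgeL2 l × EdgeL2 l →L[ℂ] EdgeL2 l := ContinuousLinearMap.fst ℂ _ _
  let H : EdgeL2 l × EdgeL2 l →L[ℂ] EdgeL2 l := ContinuousLinearMap.snd ℂ _ _
  let D₁ := (EdgeL2.mul κ hκ).comp O.fluxFun - (EdgeL2.mul a ha).comp F
  let P := (EdgeL2.mul κ' hκ').comp O.fluxFun
    - (EdgeL2.mul κ hκ).comp (H + (EdgeL2.mul a ha).comp O.fluxFun)
  let S := (EdgeL2.mul a' ha').comp F + (EdgeL2.mul a ha).comp D₁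
  refine ⟨D₁, P - S, fun p u w hp => ?_⟩
  have hw := O.fluxFun_ae p u w hp
  have hD₁ : D₁ p =ᵐ[volume.restrict (Ioo 0 l)] fun x => κ x * w x - a x * u x := by
    have e : D₁ p = EdgeL2.mul κ hκ (O.fluxFun p) - EdgeL2.mul a ha p.1 := rfl
    rw [e]
    filter_upwards [Lp.coeFn_sub (EdgeL2.mul κ hκ (O.fluxFun p)) (EdgeL2.mul a ha p.1),
      EdgeL2.coeFn_mul hκ (O.fluxFun p), EdgeL2.coeFn_mul ha p.1, hw, hp.3] with x a1 a2 a3 a4 a5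
    rw [a1, Pi.sub_apply, a2, a3, a4, a5]
  have h1 : HasWeakDeriv l u (D₁ p) := hp.weakDeriv_fun.congr Filter.EventuallyEq.rfl hD₁.symm
  refine ⟨h1.congr hp.3.symm Filter.EventuallyEq.rfl, ?_⟩
  have h2 := (hp.weakDeriv_flux.mul_left hl hκ hκ' (hd hκ1)).sub (h1.mul_left hl ha ha' (hd ha1))
  refine h2.congr hD₁.symm ?_
  have e : (P - S) p = EdgeL2.mul κ' hκ' (O.fluxFun p)
    - EdgeL2.mul κ hκ (p.2 + EdgeL2.mul a ha (O.fluxFun p))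
    - (EdgeL2.mul a' ha' p.1 + EdgeL2.mul a ha (D₁ p)) := rfl
  rw [e]
  filter_upwards [Lp.coeFn_sub (EdgeL2.mul κ' hκ' (O.fluxFun p)
      - EdgeL2.mul κ hκ (p.2 + EdgeL2.mul a ha (O.fluxFun p)))
      (EdgeL2.mul a' ha' p.1 + EdgeL2.mul a ha (D₁ p)),
    Lp.coeFn_sub (EdgeL2.mul κ' hκ' (O.fluxFun p))
      (EdgeL2.mul κ hκ (p.2 + EdgeL2.mul a ha (O.fluxFun p))),
    Lp.coeFn_add (EdgeL2.mul a' ha' p.1) (EdgeL2.mul a ha (D₁ p)),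
    Lp.coeFn_add p.2 (EdgeL2.mul a ha (O.fluxFun p)),
    EdgeL2.coeFn_mul hκ' (O.fluxFun p),
    EdgeL2.coeFn_mul hκ (p.2 + EdgeL2.mul a ha (O.fluxFun p)),
    EdgeL2.coeFn_mul ha (O.fluxFun p), EdgeL2.coeFn_mul ha' p.1,
    EdgeL2.coeFn_mul ha (D₁ p), hw, hp.3] with x a1 a2 a3 a4 a5 a6 a7 a8 a9 a10 a11
  rw [a1, Pi.sub_apply, a2, Pi.sub_apply, a3, Pi.add_apply, a5, a6, a4, Pi.add_apply, a7, a8, a9,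
    a10, a11]
  simp only [hadef]
  ring

end Solve

/-! ### The magnetic Laplacian through first order systems -/

namespace MetricGraph

variable {V E : Type*} (G : MetricGraph V E)

open Classical in
/-- The contribution of the edge `e` with fluxes `w` to the Kirchhoff sum at the vertex `v`. -/
def outflow (w : E → ℝ → ℂ) (v : V) (e : E) : ℂ :=
  (if G.src e = v then w e 0 else 0) + (if G.tgt e = v then - w e (G.len e) else 0)

/-- The graph of the magnetic Laplacian in terms of the first order systems on the edges. -/
theorem mem_laplacianGraph_iff {b A : E → ℝ → ℝ}
    (hb : ∀ e, ContinuousOn (b e) (Icc 0 (G.len e)))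
    (hA : ∀ e, ContinuousOn (A e) (Icc 0 (G.len e)))
    (hpos : ∀ e, ∀ x ∈ Icc 0 (G.len e), 0 < b e x) (p : G.L2 × G.L2) :
    p ∈ G.laplacianGraph b A ↔ ∃ u w : E → ℝ → ℂ,
      (∀ e, IsFluxPair (G.len e) (b e) (A e) (p.1 e) (p.2 e) (u e) (w e)) ∧
      (∃ f₁ f₂ : G.L2, G.IsSobolevTwo p.1 f₁ f₂) ∧ G.IsContAtVertices u ∧
      ∀ v, ∑ᶠ e, G.outflow w v e = 0 := by
  have hAc : ∀ e, ContinuousOn (fun x => Complex.I * A e x) (Icc 0 (G.len e)) := fun e =>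
    continuousOn_const.mul (Complex.continuous_ofReal.comp_continuousOn (hA e))
  constructor
  · rintro ⟨f₁, f₂, u, u₁, hs, hu, hu₁, hc, hk, hm⟩
    set w : E → ℝ → ℂ := fun e x => (b e x : ℂ) ^ 2 * (u₁ e x + Complex.I * A e x * u e x)
      with hw
    have hb0 : ∀ e, ∀ x ∈ Icc 0 (G.len e), (b e x : ℂ) ^ 2 ≠ 0 := fun e x hx =>
      pow_ne_zero 2 (Complex.ofReal_ne_zero.mpr (hpos e x hx).ne')
    have hfl : ∀ e, G.flux b A p.1 f₁ e =ᵐ[volume.restrict (Ioo 0 (G.len e))] w e := fun e => by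
      filter_upwards [(hu e).2, (hu₁ e).2] with x a1 a2
      simp only [flux, hw, a1, a2]
    refine ⟨u, w, fun e => ⟨(hu e).1, ?_, (hu e).2, ?_, ?_⟩, ⟨f₁, f₂, hs⟩, hc, fun v => ?_⟩
    · exact ((Complex.continuous_ofReal.comp_continuousOn (hb e)).pow 2).mul
        ((hu₁ e).1.add ((hAc e).mul (hu e).1))
    · refine (hs e).1.congr (hu e).2 ?_
      filter_upwards [(hu₁ e).2, ae_restrict_mem measurableSet_Ioo] with x a1 hx
      simp only [hw]
      rw [a1, ← mul_assoc, inv_mul_cancel₀ (hb0 e x (Ioo_subset_Icc_self hx))]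
      ring
    · refine (hm e).congr (hfl e) ?_
      filter_upwards [hfl e] with x hx
      rw [hx]
    · rw [← hk v]
      rfl
  · rintro ⟨u, w, hp, ⟨f₁, f₂, hs⟩, hc, hk⟩
    set u₁ : E → ℝ → ℂ := fun e x => ((b e x : ℂ) ^ 2)⁻¹ * w e x - Complex.I * A e x * u e x
      with hu₁
    have h1 : ∀ e, f₁ e =ᵐ[volume.restrict (Ioo 0 (G.len e))] u₁ e := fun e =>
      (hs e).1.deriv_unique ((hp e).weakDeriv_fun.congr (hp e).ae_eq.symm Filter.EventuallyEq.rfl)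
    have hw : ∀ e, ∀ x ∈ Icc 0 (G.len e),
        (b e x : ℂ) ^ 2 * (u₁ e x + Complex.I * A e x * u e x) = w e x := fun e x hx => by
      have : (b e x : ℂ) ^ 2 ≠ 0 := pow_ne_zero 2 (Complex.ofReal_ne_zero.mpr (hpos e x hx).ne')
      simp only [hu₁]
      rw [sub_add_cancel, mul_inv_cancel_left₀ this]
    have hfl : ∀ e, G.flux b A p.1 f₁ e =ᵐ[volume.restrict (Ioo 0 (G.len e))] w e := fun e => by
      filter_upwards [(hp e).ae_eq, h1 e, ae_restrict_mem measurableSet_Ioo] with x a1 a2 hx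
      simp only [flux, a1, a2]
      exact hw e x (Ioo_subset_Icc_self hx)
    refine ⟨f₁, f₂, u, u₁, hs, fun e => ⟨(hp e).1, (hp e).ae_eq⟩, fun e => ⟨?_, h1 e⟩, hc,
      fun v => ?_, fun e => ?_⟩
    · exact ((continuousOn_inv_sq (hb e) (hpos e)).mul (hp e).2).sub ((hAc e).mul (hp e).1)
    · rw [← hk v]
      refine finsum_congr fun e => ?_
      simp only [conormal, outflow, hw e 0 (left_mem_Icc.mpr (G.len_pos e).le),
        hw e _ (right_mem_Icc.mpr (G.len_pos e).le)]
    · refine (hp e).weakDeriv_flux.congr (hfl e).symm ?_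
      filter_upwards [hfl e] with x hx
      rw [hx]

end MetricGraph

/-! ### The Brillouin zone -/

section Brillouin

variable {d : ℕ} (g : Module.Basis (Fin d) ℝ (EuclideanSpace ℝ (Fin d)))

theorem linearIndependent_dualVec : LinearIndependent ℝ (dualVec g) := by
  rw [Fintype.linearIndependent_iff]
  intro c hc j
  have h := congrArg (fun v => inner ℝ v (g j)) hc
  simp only [sum_inner, real_inner_smul_left, inner_dualVec, inner_zero_left, mul_ite, mul_zero,
    Finset.sum_ite_eq', Finset.mem_univ, if_true] at h
  exact (mul_eq_zero.mp h).resolve_right (by positivity)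

/-- The dual basis as a basis. -/
def dualVecBasis : Module.Basis (Fin d) ℝ (EuclideanSpace ℝ (Fin d)) :=
  basisOfLinearIndependentOfCardEqFinrank' (dualVec g) (linearIndependent_dualVec g) (by simp)

theorem dualLattice_eq_span : dualLattice g = Submodule.span ℤ (range (dualVecBasis g)) := by
  simp [dualLattice, dualVecBasis]

instance : DiscreteTopology (dualLattice g) := by
  rw [dualLattice_eq_span]; infer_instance

instance : Countable (dualLattice g) := by
  rw [dualLattice_eq_span]; infer_instance

theorem exists_inner_eq_of_mem_lattices {γ h : EuclideanSpace ℝ (Fin d)} (hγ : γ ∈ periodLattice g)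
    (hh : h ∈ dualLattice g) : ∃ n : ℤ, inner ℝ γ h = 2 * Real.pi * n := by
  induction hγ using Submodule.span_induction with
  | mem x hx =>
    obtain ⟨j, rfl⟩ := hx
    induction hh using Submodule.span_induction with
    | mem y hy =>
      obtain ⟨i, rfl⟩ := hy
      refine ⟨if i = j then 1 else 0, ?_⟩
      rw [real_inner_comm, inner_dualVec]
      split_ifs <;> simp
    | zero => exact ⟨0, by simp⟩
    | add y z _ _ h1 h2 =>
      obtain ⟨n, hn⟩ := h1
      obtain ⟨m, hm⟩ := h2
      exact ⟨n + m, by rw [inner_add_right, hn, hm]; push_cast; ring⟩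
    | smul a y _ h1 =>
      obtain ⟨n, hn⟩ := h1
      exact ⟨a * n, by
        rw [← Int.cast_smul_eq_zsmul ℝ a y, real_inner_smul_right, hn]; push_cast; ring⟩
  | zero => exact ⟨0, by simp⟩
  | add y z _ _ h1 h2 =>
    obtain ⟨n, hn⟩ := h1
    obtain ⟨m, hm⟩ := h2
    exact ⟨n + m, by rw [inner_add_left, hn, hm]; push_cast; ring⟩
  | smul a y _ h1 =>
    obtain ⟨n, hn⟩ := h1
    exact ⟨a * n, by
      rw [← Int.cast_smul_eq_zsmul ℝ a y, real_inner_smul_left, hn]; push_cast; ring⟩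

/-- A point whose inner products with the basis are in `2 π ℤ` belongs to the dual lattice. -/
theorem mem_dualLattice_of_inner {t : EuclideanSpace ℝ (Fin d)}
    (ht : ∀ j, ∃ n : ℤ, inner ℝ (g j) t = 2 * Real.pi * n) : t ∈ dualLattice g := by
  choose n hn using ht
  have : t = ∑ i, n i • dualVec g i := by
    refine InnerProductSpace.ext_inner_left_basis (𝕜 := ℝ) g fun j => ?_
    rw [hn, inner_sum]
    simp only [← Int.cast_smul_eq_zsmul ℝ, real_inner_smul_right]
    simp only [real_inner_comm (dualVec g _) (g j), inner_dualVec, mul_ite, mul_zero,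
      Finset.sum_ite_eq', Finset.mem_univ, if_true]
    ring
  rw [this]
  exact Submodule.sum_mem _ fun i _ => Submodule.smul_mem _ _ (Submodule.subset_span ⟨i, rfl⟩)

theorem isClosed_brillouinZone : IsClosed (brillouinZone g) := by
  have : brillouinZone g = ⋂ h ∈ dualLattice g, ⋂ (_ : h ≠ 0), {t | ‖t‖ ≤ ‖t - h‖} := by
    ext t; simp [brillouinZone]
  rw [this]
  exact isClosed_biInter fun h _ => isClosed_iInter fun _ =>
    isClosed_le continuous_norm (continuous_id.sub continuous_const).norm

/-- The points that are strictly closer to the origin than to the other points of the dual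
lattice. -/
def strictBrillouinZone : Set (EuclideanSpace ℝ (Fin d)) :=
  {t | ∀ h : dualLattice g, h ≠ 0 → ‖t‖ < ‖t - h‖}

theorem measurableSet_strictBrillouinZone : MeasurableSet (strictBrillouinZone g) := by
  have : strictBrillouinZone g
      = ⋂ h : dualLattice g, ⋂ (_ : h ≠ 0), {t : EuclideanSpace ℝ (Fin d) | ‖t‖ < ‖t - h‖} := by
    ext t; simp [strictBrillouinZone]
  rw [this]
  exact MeasurableSet.iInter fun h => MeasurableSet.iInter fun _ =>
    (isOpen_lt continuous_norm (continuous_id.sub continuous_const).norm).measurableSet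

theorem volume_norm_eq_norm_sub {h : EuclideanSpace ℝ (Fin d)} (hh : h ≠ 0) :
    volume {t | ‖t‖ = ‖t - h‖} = 0 := by
  have : {t | ‖t‖ = ‖t - h‖}
      = (AffineSubspace.perpBisector 0 h : Set (EuclideanSpace ℝ (Fin d))) := by
    ext t
    simp [AffineSubspace.mem_perpBisector_iff_dist_eq, dist_eq_norm]
  rw [this]
  refine Measure.addHaar_affineSubspace volume _ fun ht => ?_
  exact hh (AffineSubspace.perpBisector_eq_top.mp ht).symm

theorem ae_mem_strictBrillouinZone :
    ∀ᵐ t ∂(volume.restrict (brillouinZone g)), t ∈ strictBrillouinZone g := by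
  have h1 : ∀ᵐ t : EuclideanSpace ℝ (Fin d), ∀ h : dualLattice g, h ≠ 0 → ‖t‖ ≠ ‖t - h‖ := by
    rw [ae_all_iff]
    intro h
    by_cases hh : h = 0
    · simp [hh]
    · have := volume_norm_eq_norm_sub (h := (h : EuclideanSpace ℝ (Fin d))) (by simpa using hh)
      have h2 : ∀ᵐ t : EuclideanSpace ℝ (Fin d), ‖t‖ ≠ ‖t - h‖ := by
        rw [ae_iff]; simpa using this
      filter_upwards [h2] with t ht _ using ht
  filter_upwards [ae_restrict_of_ae h1, ae_restrict_mem (isClosed_brillouinZone g).measurableSet]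
    with t h2 h3 h hh
  exact lt_of_le_of_ne (h3 h h.2 (by simpa using hh)) (h2 h hh)

instance : VAddInvariantMeasure (dualLattice g) (EuclideanSpace ℝ (Fin d)) volume :=
  ⟨fun h s _ => measure_preimage_add volume (h : EuclideanSpace ℝ (Fin d)) s⟩

/-- Translating by the nearest point of the dual lattice moves `t` into the Brillouin zone. -/
theorem exists_vadd_mem_brillouinZone (t : EuclideanSpace ℝ (Fin d)) :
    ∃ h : dualLattice g, h +ᵥ t ∈ brillouinZone g := by
  have hcl : IsClosed (dualLattice g : Set (EuclideanSpace ℝ (Fin d))) :=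
    haveI : DiscreteTopology (dualLattice g).toAddSubgroup :=
      inferInstanceAs (DiscreteTopology (dualLattice g))
    AddSubgroup.isClosed_of_discrete (H := (dualLattice g).toAddSubgroup)
  obtain ⟨h, hh, hmin⟩ := hcl.exists_infDist_eq_dist ⟨0, (dualLattice g).zero_mem⟩ t
  refine ⟨⟨-h, (dualLattice g).neg_mem hh⟩, fun k hk _ => ?_⟩
  have h1 : Metric.infDist t (dualLattice g) ≤ dist t (h + k) :=
    Metric.infDist_le_dist_of_mem ((dualLattice g).add_mem hh hk)
  rw [hmin, dist_eq_norm, dist_eq_norm] at h1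
  have e1 : (⟨-h, (dualLattice g).neg_mem hh⟩ : dualLattice g) +ᵥ t = t - h := by
    change -h + t = t - h
    abel
  rw [e1, sub_sub]
  exact h1

theorem isAddFundamentalDomain_brillouinZone :
    IsAddFundamentalDomain (dualLattice g) (brillouinZone g) volume := by
  refine IsAddFundamentalDomain.mk'' (isClosed_brillouinZone g).measurableSet.nullMeasurableSet
    (Filter.Eventually.of_forall (exists_vadd_mem_brillouinZone g)) (fun h hh => ?_)
    fun h => (measurePreserving_vadd h volume).quasiMeasurePreserving
  have hh' : (h : EuclideanSpace ℝ (Fin d)) ≠ 0 := by simpa using hh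
  refine measure_mono_null ?_ (volume_norm_eq_norm_sub hh')
  rintro t ⟨⟨s, hs, rfl⟩, ht⟩
  change ‖(h : EuclideanSpace ℝ (Fin d)) + s‖ = ‖(h : EuclideanSpace ℝ (Fin d)) + s - h‖
  refine le_antisymm (ht h h.2 hh') ?_
  have := hs (-h) ((dualLattice g).neg_mem h.2) (by simpa using hh')
  rw [add_sub_cancel_left, add_comm]
  simpa using this

theorem volume_brillouinZone :
    volume (brillouinZone g) = volume (ZSpan.fundamentalDomain (dualVecBasis g)) := by
  refine (isAddFundamentalDomain_brillouinZone g).measure_eq ?_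
  rw [dualLattice_eq_span]
  exact ZSpan.isAddFundamentalDomain (dualVecBasis g) volume

theorem volume_brillouinZone_ne_top : volume (brillouinZone g) ≠ ⊤ := by
  rw [volume_brillouinZone]
  exact (ZSpan.fundamentalDomain_isBounded _).measure_lt_top.ne

theorem volume_brillouinZone_ne_zero : volume (brillouinZone g) ≠ 0 := by
  rw [volume_brillouinZone]
  exact ZSpan.measure_fundamentalDomain_ne_zero _

instance : IsFiniteMeasure ((volume : Measure (EuclideanSpace ℝ (Fin d))).restrict
    (brillouinZone g)) :=
  ⟨by rw [Measure.restrict_apply_univ]; exact (volume_brillouinZone_ne_top g).lt_top⟩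

theorem volume_real_brillouinZone_pos : 0 < volume.real (brillouinZone g) :=
  ENNReal.toReal_pos (volume_brillouinZone_ne_zero g) (volume_brillouinZone_ne_top g)

end Brillouin

/-! ### Fourier series on the Brillouin zone -/

/-- The character `t ↦ exp (i ⟨v, t⟩)`. -/
def character {d : ℕ} (v t : EuclideanSpace ℝ (Fin d)) : ℂ :=
  Complex.exp (Complex.I * (inner ℝ v t : ℝ))

section Character

variable {d : ℕ} (v w t s : EuclideanSpace ℝ (Fin d))

theorem character_add : character (v + w) t = character v t * character w t := by
  simp only [character, inner_add_left, ← Complex.exp_add]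
  push_cast; ring_nf

theorem character_add_right : character v (t + s) = character v t * character v s := by
  simp only [character, inner_add_right, ← Complex.exp_add]
  push_cast; ring_nf

@[simp] theorem character_zero : character 0 t = 1 := by simp [character]

theorem character_neg : character (-v) t = (starRingEnd ℂ) (character v t) := by
  simp only [character, ← Complex.exp_conj, inner_neg_left, map_mul, Complex.conj_I,
    Complex.conj_ofReal]
  push_cast; ring_nf

@[simp] theorem norm_character : ‖character v t‖ = 1 := by
  rw [character, mul_comm]; exact Complex.norm_exp_ofReal_mul_I _

theorem continuous_character : Continuous (character v) :=
  Complex.continuous_exp.comp (continuous_const.mul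
    (Complex.continuous_ofReal.comp (continuous_const.inner continuous_id)))

theorem integrable_character_smul {Y : Type*} [NormedAddCommGroup Y] [NormedSpace ℂ Y]
    {μ : Measure (EuclideanSpace ℝ (Fin d))} {F : EuclideanSpace ℝ (Fin d) → Y}
    (hF : Integrable F μ) : Integrable (fun t => character v t • F t) μ :=
  hF.bdd_smul 1 (continuous_character v).aestronglyMeasurable
    (Filter.Eventually.of_forall fun t => (norm_character v t).le)

end Character

section Fourier

variable {d : ℕ} (g : Module.Basis (Fin d) ℝ (EuclideanSpace ℝ (Fin d)))

theorem character_vadd {γ : EuclideanSpace ℝ (Fin d)} (hγ : γ ∈ periodLattice g)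
    (h : dualLattice g) (t : EuclideanSpace ℝ (Fin d)) :
    character γ (h +ᵥ t) = character γ t := by
  obtain ⟨n, hn⟩ := exists_inner_eq_of_mem_lattices g hγ h.2
  change character γ ((h : EuclideanSpace ℝ (Fin d)) + t) = _
  rw [character_add_right, character, hn]
  have : Complex.I * ((2 * Real.pi * n : ℝ) : ℂ) = n * (2 * Real.pi * Complex.I) := by
    push_cast; ring
  rw [this, Complex.exp_int_mul_two_pi_mul_I, one_mul]

/-- The characters of the period lattice are orthogonal on the Brillouin zone: translating the
integral by `v` multiplies it by `exp (i ⟨γ, v⟩)`, which can be made `-1`. -/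
theorem integral_character {γ : EuclideanSpace ℝ (Fin d)} (hγ : γ ∈ periodLattice g)
    (h0 : γ ≠ 0) : ∫ t in brillouinZone g, character γ t = 0 := by
  set v : EuclideanSpace ℝ (Fin d) := (Real.pi / ‖γ‖ ^ 2) • γ with hv
  have hγv : character γ v = -1 := by
    have : inner ℝ γ v = Real.pi := by
      rw [hv, real_inner_smul_right, real_inner_self_eq_norm_sq]
      field_simp
    rw [character, this, mul_comm, Complex.exp_pi_mul_I]
  have hfd := isAddFundamentalDomain_brillouinZone g
  have h1 := hfd.setIntegral_eq (hfd.vadd_of_comm v) (f := character γ) (character_vadd g hγ)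
  have h2 : ∫ t in v +ᵥ brillouinZone g, character γ t
      = ∫ t in brillouinZone g, character γ (v + t) := by
    have := (measurePreserving_vadd v
      (volume : Measure (EuclideanSpace ℝ (Fin d)))).setIntegral_image_emb
      (measurableEmbedding_const_vadd v) (character γ) (brillouinZone g)
    exact this
  simp only [character_add_right, hγv, neg_one_mul] at h2
  rw [h2, integral_neg] at h1
  exact CharZero.eq_neg_self_iff.mp h1

/-- The projection of `ℝ^d` onto the torus `ℝ^d / dual lattice`, in the coordinates given by the
dual basis. -/
def toTorus (t : EuclideanSpace ℝ (Fin d)) : UnitAddTorus (Fin d) :=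
  fun j : Fin d => ((inner ℝ (g j) t / (2 * Real.pi) : ℝ) : UnitAddCircle)

theorem continuous_toTorus : Continuous (toTorus g) :=
  continuous_pi fun _ => (AddCircle.continuous_mk' 1).comp
    ((continuous_const.inner continuous_id).div_const _)

theorem injOn_toTorus : InjOn (toTorus g) (strictBrillouinZone g) := by
  intro t ht s hs hts
  have hmem : t - s ∈ dualLattice g := by
    refine mem_dualLattice_of_inner g fun j => ?_
    have hj := congrFun hts j
    simp only [toTorus] at hj
    rw [QuotientAddGroup.eq_iff_sub_mem, AddSubgroup.mem_zmultiples_iff] at hj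
    obtain ⟨n, hn⟩ := hj
    refine ⟨n, ?_⟩
    rw [← sub_div, ← inner_sub_right, zsmul_one, eq_div_iff (by positivity)] at hn
    rw [← hn]; ring
  by_contra hne
  have h0 : (⟨t - s, hmem⟩ : dualLattice g) ≠ 0 := by
    simpa [Subtype.ext_iff, sub_eq_zero] using hne
  have h1 := ht ⟨t - s, hmem⟩ h0
  have h2 := hs (-⟨t - s, hmem⟩) (neg_ne_zero.mpr h0)
  simp only [Submodule.coe_neg, sub_neg_eq_add] at h1 h2
  rw [sub_sub_cancel] at h1
  rw [add_sub_cancel] at h2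
  exact lt_asymm h1 h2

theorem mFourier_toTorus (n : Fin d → ℤ) (t : EuclideanSpace ℝ (Fin d)) :
    UnitAddTorus.mFourier n (toTorus g t) = character (∑ j, n j • g j) t := by
  simp only [UnitAddTorus.mFourier, ContinuousMap.coe_mk, toTorus, fourier_coe_apply, character,
    sum_inner, ← Int.cast_smul_eq_zsmul ℝ, real_inner_smul_left]
  rw [← Complex.exp_sum]
  congr 1
  push_cast
  rw [Finset.mul_sum]
  refine Finset.sum_congr rfl fun j _ => ?_
  have : (Real.pi : ℂ) ≠ 0 := Complex.ofReal_ne_zero.mpr Real.pi_ne_zero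
  field_simp

variable {g}
variable {Y : Type*} [NormedAddCommGroup Y] [NormedSpace ℂ Y]

/-- Trigonometric polynomials are dense in the continuous functions on the torus. -/
theorem integral_comp_toTorus_smul {F : EuclideanSpace ℝ (Fin d) → Y}
    (hF : IntegrableOn F (brillouinZone g))
    (h0 : ∀ γ : periodLattice g, ∫ t in brillouinZone g, character γ t • F t = 0)
    (φ : C(UnitAddTorus (Fin d), ℂ)) :
    ∫ t in brillouinZone g, φ (toTorus g t) • F t = 0 := by
  have hint : ∀ φ : C(UnitAddTorus (Fin d), ℂ),
      IntegrableOn (fun t => φ (toTorus g t) • F t) (brillouinZone g) := fun φ =>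
    hF.bdd_smul ‖φ‖ (φ.continuous.comp (continuous_toTorus g)).aestronglyMeasurable
      (Filter.Eventually.of_forall fun t => φ.norm_coe_le_norm _)
  let I : C(UnitAddTorus (Fin d), ℂ) →L[ℂ] Y := LinearMap.mkContinuous
    { toFun := fun φ => ∫ t in brillouinZone g, φ (toTorus g t) • F t
      map_add' := fun φ ψ => by
        rw [← integral_add (hint φ) (hint ψ)]
        exact integral_congr_ae (Filter.Eventually.of_forall fun t => add_smul _ _ _)
      map_smul' := fun c φ => by
        rw [RingHom.id_apply, ← integral_smul]
        exact integral_congr_ae (Filter.Eventually.of_forall fun t => mul_smul _ _ _) }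
    (∫ t in brillouinZone g, ‖F t‖) fun φ => by
      refine (norm_integral_le_integral_norm _).trans ?_
      rw [mul_comm, ← integral_const_mul]
      refine integral_mono (hint φ).norm (hF.norm.const_mul _) fun t => ?_
      simp only [norm_smul]
      exact mul_le_mul_of_nonneg_right (φ.norm_coe_le_norm _) (norm_nonneg _)
  have hI : I = 0 := by
    refine ContinuousLinearMap.ext_on (s := range UnitAddTorus.mFourier)
      (Submodule.dense_iff_topologicalClosure_eq_top.mpr
        UnitAddTorus.span_mFourier_closure_eq_top) ?_
    rintro _ ⟨n, rfl⟩
    have := h0 ⟨∑ j, n j • g j, Submodule.sum_mem _ fun i _ =>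
      Submodule.smul_mem _ _ (Submodule.subset_span ⟨i, rfl⟩)⟩
    simp only [← mFourier_toTorus] at this
    exact this
  exact congrArg (fun J : C(UnitAddTorus (Fin d), ℂ) →L[ℂ] Y => J φ) hI

/-- The closed subsets of the torus are handled by approximating their indicators by continuous
functions, and they generate the Borel subsets. -/
theorem setIntegral_preimage_toTorus {F : EuclideanSpace ℝ (Fin d) → Y}
    (hF : IntegrableOn F (brillouinZone g))
    (h0 : ∀ γ : periodLattice g, ∫ t in brillouinZone g, character γ t • F t = 0)
    {B : Set (UnitAddTorus (Fin d))} (hB : MeasurableSet B) :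
    ∫ t in toTorus g ⁻¹' B, F t ∂(volume.restrict (brillouinZone g)) = 0 := by
  set μ := (volume : Measure (EuclideanSpace ℝ (Fin d))).restrict (brillouinZone g)
  have hmeas : Measurable (toTorus g) := (continuous_toTorus g).measurable
  have htot : ∫ t, F t ∂μ = 0 := by simpa using h0 0
  refine MeasurableSpace.induction_on_inter
    (C := fun B _ => ∫ t in toTorus g ⁻¹' B, F t ∂μ = 0)
    (BorelSpace.measurable_eq.trans borel_eq_generateFrom_isClosed) isPiSystem_isClosed
    ?_ (fun B hB => ?_) (fun B hB ih => ?_) (fun f hd hm ih => ?_) B hB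
  · simp
  · replace hB : IsClosed B := hB
    have hlim : Filter.Tendsto (fun n => ∫ t, ((hB.apprSeq n (toTorus g t) : ℝ) : ℂ) • F t ∂μ)
        Filter.atTop (nhds (∫ t, (toTorus g ⁻¹' B).indicator F t ∂μ)) := by
      refine tendsto_integral_of_dominated_convergence (fun t => ‖F t‖) (fun n => ?_) hF.norm
        (fun n => ?_) ?_
      · refine AEStronglyMeasurable.smul ?_ hF.1
        exact (Complex.continuous_ofReal.comp (NNReal.continuous_coe.comp
          ((hB.apprSeq n).continuous.comp (continuous_toTorus g)))).aestronglyMeasurable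
      · refine Filter.Eventually.of_forall fun t => ?_
        rw [norm_smul]
        refine mul_le_of_le_one_left (norm_nonneg _) ?_
        rw [Complex.norm_real, Real.norm_of_nonneg NNReal.zero_le_coe]
        exact_mod_cast HasOuterApproxClosed.apprSeq_apply_le_one hB n (toTorus g t)
      · refine Filter.Eventually.of_forall fun t => ?_
        have h1 := (tendsto_pi_nhds.mp (HasOuterApproxClosed.tendsto_apprSeq hB)) (toTorus g t)
        have h2 : Filter.Tendsto (fun n => ((hB.apprSeq n (toTorus g t) : ℝ) : ℂ)) Filter.atTop
            (nhds (((B.indicator (fun _ => (1 : NNReal)) (toTorus g t) : NNReal) : ℝ) : ℂ)) :=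
          ((Complex.continuous_ofReal.comp NNReal.continuous_coe).tendsto _).comp h1
        have h3 := h2.smul_const (F t)
        convert h3 using 2
        by_cases hb : toTorus g t ∈ B <;> simp [Set.indicator, hb]
    have hz : ∀ n, ∫ t, ((hB.apprSeq n (toTorus g t) : ℝ) : ℂ) • F t ∂μ = 0 := fun n =>
      integral_comp_toTorus_smul hF h0 ⟨fun x => ((hB.apprSeq n x : ℝ) : ℂ),
        Complex.continuous_ofReal.comp (NNReal.continuous_coe.comp (hB.apprSeq n).continuous)⟩
    simp only [hz] at hlim
    rw [← integral_indicator (hmeas hB.measurableSet)]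
    exact tendsto_nhds_unique hlim tendsto_const_nhds
  · rw [preimage_compl, setIntegral_compl (hmeas hB) hF, ih, htot, sub_zero]
  · rw [preimage_iUnion, integral_iUnion (fun i => hmeas (hm i))
      (fun i j hij => (hd hij).preimage _) hF.integrableOn]
    exact (tsum_congr ih).trans tsum_zero

/-- The characters of the period lattice are complete on the Brillouin zone, also for functions
with values in a Banach space. Trigonometric polynomials are dense in the continuous functions on
the torus, so the integral of `F` over every pullback of a Borel set of the torus vanishes; up to
null sets every Borel subset of the Brillouin zone is such a pullback. -/
theorem ae_eq_zero_of_fourierCoeff [CompleteSpace Y] {F : EuclideanSpace ℝ (Fin d) → Y}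
    (hF : IntegrableOn F (brillouinZone g))
    (h0 : ∀ γ : periodLattice g, ∫ t in brillouinZone g, character γ t • F t = 0) :
    ∀ᵐ t ∂(volume.restrict (brillouinZone g)), F t = 0 := by
  refine Integrable.ae_eq_zero_of_forall_setIntegral_eq_zero hF fun S hS _ => ?_
  have hSm : MeasurableSet (S ∩ strictBrillouinZone g) :=
    hS.inter (measurableSet_strictBrillouinZone g)
  have himg : MeasurableSet (toTorus g '' (S ∩ strictBrillouinZone g)) :=
    hSm.image_of_continuousOn_injOn (continuous_toTorus g).continuousOn
      ((injOn_toTorus g).mono inter_subset_right)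
  rw [← setIntegral_preimage_toTorus hF h0 himg]
  refine setIntegral_congr_set ?_
  filter_upwards [ae_mem_strictBrillouinZone g] with t ht
  refine propext ⟨fun hts => ⟨t, ⟨hts, ht⟩, rfl⟩, ?_⟩
  rintro ⟨s, ⟨hs, hs'⟩, hst⟩
  rwa [injOn_toTorus g hs' ht hst] at hs

end Fourier

section Relations

variable {d : ℕ} {g : Module.Basis (Fin d) ℝ (EuclideanSpace ℝ (Fin d))}
variable {Y : Type*} [NormedAddCommGroup Y] [NormedSpace ℂ Y] [CompleteSpace Y]

/-- A finite linear relation between shifted Fourier coefficients amounts to the relation between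
the functions in which the shifts turn into characters. -/
theorem forall_sum_fourierCoeff_eq_zero_iff {J : Type*} (S : Finset J)
    {F : J → EuclideanSpace ℝ (Fin d) → Y} (hF : ∀ j, IntegrableOn (F j) (brillouinZone g))
    {c : ℂ} (hc : c ≠ 0) {y : J → periodLattice g → Y}
    (hy : ∀ j γ, y j γ = c • ∫ t in brillouinZone g, character γ t • F j t)
    (δ : J → periodLattice g) :
    (∀ γ, ∑ j ∈ S, y j (γ - δ j) = 0) ↔
      ∀ᵐ t ∂(volume.restrict (brillouinZone g)), ∑ j ∈ S, character (-δ j) t • F j t = 0 := by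
  have hi : ∀ j, IntegrableOn (fun t => character (-δ j) t • F j t) (brillouinZone g) := fun j =>
    integrable_character_smul _ (hF j)
  have key : ∀ γ : periodLattice g, ∑ j ∈ S, y j (γ - δ j)
      = c • ∫ t in brillouinZone g, character γ t • ∑ j ∈ S, character (-δ j) t • F j t := by
    intro γ
    simp only [Finset.smul_sum]
    rw [integral_finsetSum S fun j _ => integrable_character_smul _ (hi j), Finset.smul_sum]
    refine Finset.sum_congr rfl fun j _ => ?_
    rw [hy]
    congr 1
    refine integral_congr_ae (Filter.Eventually.of_forall fun t => ?_)
    simp only [smul_smul, ← character_add, sub_eq_add_neg, Submodule.coe_add]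
  constructor
  · intro h
    refine ae_eq_zero_of_fourierCoeff (integrable_finsetSum S fun j _ => hi j) fun γ => ?_
    have h1 := h γ
    rw [key] at h1
    exact (smul_eq_zero.mp h1).resolve_left hc
  · intro h γ
    rw [key, integral_congr_ae (g := fun _ => (0 : Y))
      (h.mono fun t ht => by simp only [ht, smul_zero])]
    simp

theorem forall_fourierCoeff_eq_zero_iff {F : EuclideanSpace ℝ (Fin d) → Y}
    (hF : IntegrableOn F (brillouinZone g)) {c : ℂ} (hc : c ≠ 0) {y : periodLattice g → Y}
    (hy : ∀ γ, y γ = c • ∫ t in brillouinZone g, character γ t • F t) :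
    (∀ γ, y γ = 0) ↔ ∀ᵐ t ∂(volume.restrict (brillouinZone g)), F t = 0 := by
  have h := forall_sum_fourierCoeff_eq_zero_iff (Finset.univ : Finset Unit) (F := fun _ => F)
    (fun _ => hF) hc (y := fun _ => y) (fun _ => hy) 0
  simpa using h

theorem forall_fourierCoeff_eq_iff {F F' : EuclideanSpace ℝ (Fin d) → Y}
    (hF : IntegrableOn F (brillouinZone g)) (hF' : IntegrableOn F' (brillouinZone g))
    {c : ℂ} (hc : c ≠ 0) {y y' : periodLattice g → Y}
    (hy : ∀ γ, y γ = c • ∫ t in brillouinZone g, character γ t • F t)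
    (hy' : ∀ γ, y' γ = c • ∫ t in brillouinZone g, character γ t • F' t)
    (δ δ' : periodLattice g) :
    (∀ γ, y (γ - δ) = y' (γ - δ')) ↔ ∀ᵐ t ∂(volume.restrict (brillouinZone g)),
      character (-δ : periodLattice g) t • F t = character (-δ' : periodLattice g) t • F' t := by
  have h := forall_sum_fourierCoeff_eq_zero_iff (Finset.univ : Finset Bool)
    (F := fun s t => if s then F t else - F' t)
    (fun s => by cases s; exacts [by simpa using hF'.neg, by simpa using hF]) hc
    (y := fun s γ => if s then y γ else - y' γ)
    (fun s γ => by cases s; exacts [by simp [hy', integral_neg], by simp [hy]])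
    (fun s => if s then δ else δ')
  simpa [← sub_eq_add_neg, sub_eq_zero] using h

end Relations

/-! ### Translations and gauge transformations of edges -/

namespace EdgeL2

variable {l l' : ℝ}

/-- The identification of the spaces of two edges of the same length. -/
def castLen (h : l = l') : EdgeL2 l ≃ₗᵢ[ℂ] EdgeL2 l' := by
  subst h; exact LinearIsometryEquiv.refl ℂ _

theorem coeFn_castLen (h : l = l') (f : EdgeL2 l) : (castLen h f : ℝ → ℂ) = f := by
  subst h; rfl

theorem castLen_trans {l'' : ℝ} (h : l = l') (h' : l' = l'') (f : EdgeL2 l) :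
    castLen h' (castLen h f) = castLen (h.trans h') f := by
  subst h; subst h'; rfl

theorem continuous_twistFun (l s : ℝ) :
    Continuous fun x : ℝ => Complex.exp (-Complex.I * (x / l) * s) := by
  fun_prop

theorem norm_twistFun (l s x : ℝ) : ‖Complex.exp (-Complex.I * (x / l) * s)‖ = 1 := by
  have : -Complex.I * (x / l) * s = ((-(x / l * s) : ℝ) : ℂ) * Complex.I := by push_cast; ring
  rw [this]; exact Complex.norm_exp_ofReal_mul_I _

theorem twistFun_neg_mul (l s x : ℝ) :
    Complex.exp (-Complex.I * (x / l) * (-s : ℝ)) * Complex.exp (-Complex.I * (x / l) * s) = 1 := by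
  rw [← Complex.exp_add]; push_cast; ring_nf; exact Complex.exp_zero

/-- The multiplication by `exp (- i s x / l)`, as an operator. -/
def twistCLM (l s : ℝ) : EdgeL2 l →L[ℂ] EdgeL2 l :=
  mul (fun x : ℝ => Complex.exp (-Complex.I * (x / l) * s)) (continuous_twistFun l s).continuousOn

theorem coeFn_twistCLM (s : ℝ) (f : EdgeL2 l) :
    (twistCLM l s f : ℝ → ℂ) =ᵐ[volume.restrict (Ioo 0 l)]
      fun x => Complex.exp (-Complex.I * (x / l) * s) * f x :=
  coeFn_mul _ f

theorem twistCLM_neg_twistCLM (s : ℝ) (f : EdgeL2 l) : twistCLM l (-s) (twistCLM l s f) = f := by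
  refine Lp.ext ?_
  filter_upwards [coeFn_twistCLM (-s) (twistCLM l s f), coeFn_twistCLM s f] with x h1 h2
  rw [h1, h2, ← mul_assoc, twistFun_neg_mul, one_mul]

theorem norm_twistCLM (s : ℝ) (f : EdgeL2 l) : ‖twistCLM l s f‖ = ‖f‖ := by
  have h : ∀ (s : ℝ) (f : EdgeL2 l), ‖twistCLM l s f‖ ≤ ‖f‖ := fun s f => by
    have := norm_mul_le (continuous_twistFun l s).continuousOn
      (fun x _ => (norm_twistFun l s x).le) f
    rwa [one_mul] at this
  refine le_antisymm (h s f) ?_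
  simpa [twistCLM_neg_twistCLM] using h (-s) (twistCLM l s f)

/-- The multiplication by `exp (- i s x / l)`. -/
def twist (l s : ℝ) : EdgeL2 l ≃ₗᵢ[ℂ] EdgeL2 l where
  toLinearEquiv := LinearEquiv.ofLinearMap (twistCLM l s) (twistCLM l (-s))
    (LinearMap.ext fun f => by simpa using twistCLM_neg_twistCLM (-s) f)
    (LinearMap.ext fun f => twistCLM_neg_twistCLM s f)
  norm_map' := norm_twistCLM s

theorem coeFn_twist (s : ℝ) (f : EdgeL2 l) :
    (twist l s f : ℝ → ℂ) =ᵐ[volume.restrict (Ioo 0 l)]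
      fun x => Complex.exp (-Complex.I * (x / l) * s) * f x :=
  coeFn_twistCLM s f

theorem twist_symm_eq (s : ℝ) (f : EdgeL2 l) : (twist l s).symm f = twist l (-s) f := rfl

theorem norm_twist_sub_le (hl : 0 < l) (s s' : ℝ) (f : EdgeL2 l) :
    ‖twist l s f - twist l s' f‖ ≤ |s - s'| * ‖f‖ := by
  refine Lp.norm_le_mul_norm_of_ae_le_mul ?_
  filter_upwards [Lp.coeFn_sub (twist l s f) (twist l s' f), coeFn_twist s f, coeFn_twist s' f,
    ae_restrict_mem measurableSet_Ioo] with x h1 h2 h3 hx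
  rw [h1, Pi.sub_apply, h2, h3, ← sub_mul, norm_mul]
  refine mul_le_mul_of_nonneg_right ?_ (norm_nonneg _)
  have e : Complex.exp (-Complex.I * (x / l) * s)
      = Complex.exp (-Complex.I * (x / l) * s')
        * Complex.exp (Complex.I * ((-(x / l * (s - s')) : ℝ) : ℂ)) := by
    rw [← Complex.exp_add]; push_cast; ring_nf
  have h01 : |x / l| ≤ 1 := by
    rw [abs_of_nonneg (div_nonneg hx.1.le hl.le), div_le_one hl]; exact hx.2.le
  calc _ = ‖Complex.exp (Complex.I * ((-(x / l * (s - s')) : ℝ) : ℂ)) - 1‖ := by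
        rw [e, ← mul_sub_one, norm_mul, norm_twistFun, one_mul]
    _ ≤ ‖(-(x / l * (s - s')) : ℝ)‖ := Real.norm_exp_I_mul_ofReal_sub_one_le
    _ ≤ |s - s'| := by
        rw [Real.norm_eq_abs, abs_neg, abs_mul]
        exact mul_le_of_le_one_left (abs_nonneg _) h01

theorem continuous_twist (hl : 0 < l) : Continuous fun p : ℝ × EdgeL2 l => twist l p.1 p.2 := by
  refine continuous_prod_of_continuous_lipschitzWith' (fun p : ℝ × EdgeL2 l => twist l p.1 p.2) 1
    (fun s => (twist l s).isometry.lipschitz) fun f => ?_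
  refine LipschitzWith.continuous (K := ‖f‖₊) (LipschitzWith.of_dist_le_mul fun s s' => ?_)
  rw [dist_eq_norm, Real.dist_eq, mul_comm]
  exact norm_twist_sub_le hl s s' f

end EdgeL2

/-- The gauge transformation by `exp (- i s x / l)` adds `s / l` to the potential. -/
theorem IsFluxPair.twist {l : ℝ} (hl : 0 < l) {b A : ℝ → ℝ} {f h u w : ℝ → ℂ}
    (hp : IsFluxPair l b A f h u w) (s : ℝ) :
    IsFluxPair l b (fun x => A x + s / l)
      (fun x => Complex.exp (-Complex.I * (x / l) * s) * f x)
      (fun x => Complex.exp (-Complex.I * (x / l) * s) * h x)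
      (fun x => Complex.exp (-Complex.I * (x / l) * s) * u x)
      (fun x => Complex.exp (-Complex.I * (x / l) * s) * w x) := by
  refine hp.gauge hl (a := fun _ => s / l) continuousOn_const
    (EdgeL2.continuous_twistFun l s).continuousOn fun x _ => ?_
  have h1 : HasDerivAt (fun x : ℝ => (x : ℂ)) 1 x := Complex.ofRealCLM.hasDerivAt
  have h2 := (((h1.div_const (l : ℂ)).const_mul (-Complex.I)).mul_const (s : ℂ)).cexp
  convert h2 using 1
  push_cast; ring

namespace EdgeL2

/-- The twist is jointly continuous, hence it preserves strong measurability. -/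
theorem integrable_twist {T : Type*} [TopologicalSpace T] [MeasurableSpace T]
    [OpensMeasurableSpace T] [SecondCountableTopology T] {μ : Measure T} {l : ℝ} (hl : 0 < l)
    {s : T → ℝ} (hs : Continuous s) {F : T → EdgeL2 l} (hF : Integrable F μ) :
    Integrable (fun t => twist l (s t) (F t)) μ := by
  have h1 : AEStronglyMeasurable s μ := hs.aestronglyMeasurable
  have h2 : AEStronglyMeasurable (fun t => (s t, F t)) μ := h1.prodMk hF.1
  have h3 := (continuous_twist hl).comp_aestronglyMeasurable h2
  refine Integrable.mono hF h3 ?_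
  exact Filter.Eventually.of_forall fun t => ((twist l (s t)).norm_map (F t)).le

end EdgeL2

theorem MeasureTheory.Lp.integrable_of_finite {T H : Type*} [MeasurableSpace T]
    [NormedAddCommGroup H] {μ : Measure T} [IsFiniteMeasure μ] (ψ : Lp H 2 μ) : Integrable ψ μ :=
  (Lp.memLp ψ).integrable one_le_two

/-! ### Orbits of edges under the period lattice -/

section Floor

variable {d : ℕ} (g : Module.Basis (Fin d) ℝ (EuclideanSpace ℝ (Fin d)))

theorem floor_add_lattice (v : EuclideanSpace ℝ (Fin d)) (γ : periodLattice g) :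
    ZSpan.floor g (v + γ) = ZSpan.floor g v + γ := by
  have h := ZSpan.fract_add_ZSpan g v γ.2
  rw [ZSpan.fract_apply, ZSpan.fract_apply] at h
  refine Subtype.ext ?_
  rw [Submodule.coe_add]
  rw [sub_eq_sub_iff_add_eq_add] at h
  have h' : v + ((ZSpan.floor g v : EuclideanSpace ℝ (Fin d)) + γ)
      = v + (ZSpan.floor g (v + γ) : EuclideanSpace ℝ (Fin d)) := by
    rw [← h]; abel
  exact (add_left_cancel h').symm

theorem floor_eq_zero_of_mem {v : EuclideanSpace ℝ (Fin d)} (hv : v ∈ ZSpan.fundamentalDomain g) :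
    ZSpan.floor g v = 0 := by
  have := (ZSpan.fract_eq_self (b := g)).mpr hv
  rw [ZSpan.fract_apply, sub_eq_self] at this
  exact Subtype.ext this

end Floor

namespace PeriodicMetricGraph

variable {d k : ℕ} {g : Module.Basis (Fin d) ℝ (EuclideanSpace ℝ (Fin d))} {E : Type*}
  (G : PeriodicMetricGraph d k g E)

/-- The lattice part of the origin of the edge `e`. -/
def orbitIndex (e : E) : periodLattice g := ZSpan.floor g (G.src e).1.1

/-- The translate of the edge `e` that originates in the fundamental vertex set. -/
def orbitRep (e : E) : G.CellEdge :=
  ⟨G.shift (-G.orbitIndex e) e, by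
    rw [G.src_shift]
    have h := (G.reduce (G.src e)).2
    simp only [reduce, ZSpan.fract_apply] at h
    simpa [orbitIndex, sub_eq_add_neg] using h⟩

theorem shift_orbitRep (e : E) : G.shift (G.orbitIndex e) (G.orbitRep e) = e := by
  rw [orbitRep, ← G.shift_add, add_neg_cancel, G.shift_zero]

theorem orbitIndex_shift (γ : periodLattice g) (e : G.CellEdge) :
    G.orbitIndex (G.shift γ e) = γ := by
  rw [orbitIndex, G.src_shift, floor_add_lattice, floor_eq_zero_of_mem g e.2.2, zero_add]

theorem orbitRep_shift (γ : periodLattice g) (e : G.CellEdge) :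
    G.orbitRep (G.shift γ e) = e := by
  refine Subtype.ext ?_
  rw [orbitRep]
  simp only
  rw [orbitIndex_shift, ← G.shift_add, neg_add_cancel, G.shift_zero]

theorem len_eq (γ : periodLattice g) (e : G.CellEdge) :
    G.toMetricGraph.len (G.shift γ e) = G.fundamentalGraph.len e :=
  G.len_shift γ e

theorem len_orbitRep (e : E) :
    G.toMetricGraph.len e = G.fundamentalGraph.len (G.orbitRep e) :=
  (G.len_shift _ e).symm

/-- The function `f` on the translate by `γ` of the edge `e` of the fundamental graph. -/
def orbitComp (f : G.toMetricGraph.L2) (γ : periodLattice g) (e : G.CellEdge) :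
    EdgeL2 (G.fundamentalGraph.len e) :=
  EdgeL2.castLen (G.len_eq γ e) (f (G.shift γ e))

theorem coeFn_orbitComp (f : G.toMetricGraph.L2) (γ : periodLattice g) (e : G.CellEdge) :
    (G.orbitComp f γ e : ℝ → ℂ) = f (G.shift γ e) :=
  EdgeL2.coeFn_castLen _ _

/-! ### The Gelfand transform -/

/-- The quasimomentum paired with the index of an edge: the total phase that the fibre operator
accumulates along the edge. -/
def edgePhase (e : G.CellEdge) (t : EuclideanSpace ℝ (Fin d)) : ℝ :=
  inner ℝ (G.edgeIndex e : EuclideanSpace ℝ (Fin d)) t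

theorem continuous_edgePhase (e : G.CellEdge) : Continuous (G.edgePhase e) :=
  continuous_const.inner continuous_id

/-- The restriction of a function on the fundamental graph to an edge. -/
def edgeEval (e : G.CellEdge) : G.fundamentalGraph.L2 →L[ℂ] EdgeL2 (G.fundamentalGraph.len e) :=
  LinearMap.mkContinuous
    { toFun := fun f => f e
      map_add' := fun _ _ => rfl
      map_smul' := fun _ _ => rfl } 1 fun f => by
    rw [one_mul]; exact lp.norm_apply_le_norm two_ne_zero f e

/-- The component of `ψ` on the edge `e`, with the phase factor of the Gelfand transform
removed. -/
def fibreComp (ψ : G.FibreSpace) (e : G.CellEdge) (t : EuclideanSpace ℝ (Fin d)) :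
    EdgeL2 (G.fundamentalGraph.len e) :=
  EdgeL2.twist _ (-G.edgePhase e t) (ψ t e)

theorem twist_fibreComp (ψ : G.FibreSpace) (e : G.CellEdge) (t : EuclideanSpace ℝ (Fin d)) :
    EdgeL2.twist _ (G.edgePhase e t) (G.fibreComp ψ e t) = ψ t e :=
  (EdgeL2.twist _ (G.edgePhase e t)).apply_symm_apply (ψ t e)

theorem integrableOn_fibreComp (ψ : G.FibreSpace) (e : G.CellEdge) :
    IntegrableOn (G.fibreComp ψ e) (brillouinZone g) := by
  refine EdgeL2.integrable_twist (G.fundamentalGraph.len_pos e) (G.continuous_edgePhase e).neg ?_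
  refine (Lp.integrable_of_finite ψ).mono
    ((G.edgeEval e).continuous.comp_aestronglyMeasurable (Lp.aestronglyMeasurable ψ)) ?_
  exact Filter.Eventually.of_forall fun t => lp.norm_apply_le_norm two_ne_zero (ψ t) e

/-- The normalization constant of the Gelfand transform. -/
def normConst (g : Module.Basis (Fin d) ℝ (EuclideanSpace ℝ (Fin d))) : ℝ :=
  (Real.sqrt (volume.real (brillouinZone g)))⁻¹

theorem normConst_pos : 0 < normConst g :=
  inv_pos.mpr (Real.sqrt_pos.mpr (volume_real_brillouinZone_pos g))

theorem normConst_sq_mul : normConst g * normConst g * volume.real (brillouinZone g) = 1 := by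
  have h := volume_real_brillouinZone_pos g
  rw [normConst, ← mul_inv, Real.mul_self_sqrt h.le, inv_mul_cancel₀ h.ne']

/-- The Fourier coefficient with index `γ` of the component on the edge `e`, normalized such that
it is the inverse of the Gelfand transform. -/
def fibreCoeff (γ : periodLattice g) (e : G.CellEdge) (ψ : G.FibreSpace) :
    EdgeL2 (G.fundamentalGraph.len e) :=
  (normConst g : ℂ) • ∫ t in brillouinZone g, character γ t • G.fibreComp ψ e t

open Classical in
/-- The Gelfand transform at `t` of a function which is `a` on the translate by `γ` of the edge
`e` and zero on the other edges. -/
def wave (γ : periodLattice g) (e : G.CellEdge) (a : EdgeL2 (G.fundamentalGraph.len e))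
    (t : EuclideanSpace ℝ (Fin d)) : G.fundamentalGraph.L2 :=
  lp.single 2 e ((normConst g * character (-γ) t) • EdgeL2.twist _ (G.edgePhase e t) a)

theorem continuous_wave (γ : periodLattice g) (e : G.CellEdge)
    (a : EdgeL2 (G.fundamentalGraph.len e)) : Continuous (G.wave γ e a) := by
  classical
  have h1 : Continuous fun b : EdgeL2 (G.fundamentalGraph.len e) =>
      (lp.single 2 e b : G.fundamentalGraph.L2) :=
    (lp.isometry_single (E := fun e => EdgeL2 (G.fundamentalGraph.len e)) (p := 2) e).continuous
  have h2 := (EdgeL2.continuous_twist (G.fundamentalGraph.len_pos e)).comp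
    ((G.continuous_edgePhase e).prodMk (continuous_const (y := a)))
  exact h1.comp ((continuous_const.mul (continuous_character _)).smul h2)

theorem memLp_wave (γ : periodLattice g) (e : G.CellEdge)
    (a : EdgeL2 (G.fundamentalGraph.len e)) :
    MemLp (G.wave γ e a) 2 ((volume : Measure (EuclideanSpace ℝ (Fin d))).restrict
      (brillouinZone g)) := by
  classical
  refine MemLp.of_bound (G.continuous_wave γ e a).aestronglyMeasurable (normConst g * ‖a‖) ?_
  refine Filter.Eventually.of_forall fun t => ?_
  rw [wave, lp.norm_single (by norm_num), norm_smul, norm_mul, norm_character, mul_one,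
    LinearIsometryEquiv.norm_map, Complex.norm_real, Real.norm_of_nonneg normConst_pos.le]

theorem wave_add (γ : periodLattice g) (e : G.CellEdge) (a a' : EdgeL2 (G.fundamentalGraph.len e))
    (t : EuclideanSpace ℝ (Fin d)) : G.wave γ e (a + a') t = G.wave γ e a t + G.wave γ e a' t := by
  classical
  simp only [wave]
  rw [map_add, smul_add, lp.single_add]

theorem wave_smul (γ : periodLattice g) (e : G.CellEdge) (c : ℂ)
    (a : EdgeL2 (G.fundamentalGraph.len e))
    (t : EuclideanSpace ℝ (Fin d)) : G.wave γ e (c • a) t = c • G.wave γ e a t := by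
  classical
  simp only [wave]
  rw [map_smul, smul_comm, lp.single_smul]

/-- `wave` as a linear map into the direct integral. -/
def waveLin (γ : periodLattice g) (e : G.CellEdge) :
    EdgeL2 (G.fundamentalGraph.len e) →ₗ[ℂ] G.FibreSpace where
  toFun a := (G.memLp_wave γ e a).toLp
  map_add' a a' := by
    rw [← MemLp.toLp_add]
    exact MemLp.toLp_congr _ _ (Filter.Eventually.of_forall (G.wave_add γ e a a'))
  map_smul' c a := by
    rw [RingHom.id_apply, ← MemLp.toLp_const_smul]
    exact MemLp.toLp_congr _ _ (Filter.Eventually.of_forall (G.wave_smul γ e c a))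

theorem coeFn_waveLin (γ : periodLattice g) (e : G.CellEdge)
    (a : EdgeL2 (G.fundamentalGraph.len e)) :
    G.waveLin γ e a =ᵐ[volume.restrict (brillouinZone g)] G.wave γ e a :=
  (G.memLp_wave γ e a).coeFn_toLp

/-- The Fourier coefficient `fibreCoeff` is the adjoint of `waveLin`. -/
theorem inner_waveLin (γ : periodLattice g) (e : G.CellEdge)
    (a : EdgeL2 (G.fundamentalGraph.len e)) (ψ : G.FibreSpace) :
    inner ℂ (G.waveLin γ e a) ψ = inner ℂ a (G.fibreCoeff γ e ψ) := by
  classical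
  rw [L2.inner_def, fibreCoeff, ← integral_smul, ← integral_inner]
  · refine integral_congr_ae ?_
    filter_upwards [G.coeFn_waveLin γ e a] with t ht
    rw [ht, wave, lp.inner_single_left, inner_smul_left, inner_smul_right, inner_smul_right,
      map_mul, Complex.conj_ofReal, Submodule.coe_neg, character_neg, Complex.conj_conj, mul_assoc,
      ← G.twist_fibreComp ψ e t, LinearIsometryEquiv.inner_map_map]
  · exact Integrable.smul (normConst g : ℂ)
      (integrable_character_smul _ (G.integrableOn_fibreComp ψ e))

theorem fibreComp_waveLin_self (γ : periodLattice g) (e : G.CellEdge)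
    (a : EdgeL2 (G.fundamentalGraph.len e)) :
    ∀ᵐ t ∂(volume.restrict (brillouinZone g)),
      G.fibreComp (G.waveLin γ e a) e t = (normConst g * character (-γ) t) • a := by
  classical
  filter_upwards [G.coeFn_waveLin γ e a] with t ht
  rw [fibreComp, ht, wave, lp.single_apply_self, map_smul, ← EdgeL2.twist_symm_eq,
    LinearIsometryEquiv.symm_apply_apply]

theorem fibreCoeff_waveLin_self (γ γ' : periodLattice g) (e : G.CellEdge)
    (a : EdgeL2 (G.fundamentalGraph.len e)) :
    G.fibreCoeff γ e (G.waveLin γ' e a) = if γ = γ' then a else 0 := by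
  have h : ∫ t in brillouinZone g, character γ t • G.fibreComp (G.waveLin γ' e a) e t
      = ((normConst g : ℂ) * ∫ t in brillouinZone g,
        character ((γ - γ' : periodLattice g) : EuclideanSpace ℝ (Fin d)) t) • a := by
    rw [← integral_const_mul, ← integral_smul_const]
    refine integral_congr_ae ?_
    filter_upwards [G.fibreComp_waveLin_self γ' e a] with t ht
    rw [ht, smul_smul, Submodule.coe_sub, sub_eq_add_neg, character_add, Submodule.coe_neg]
    congr 1
    ring
  rw [fibreCoeff, h]
  split_ifs with hγ
  · subst hγ
    have h1 := normConst_sq_mul (g := g)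
    have h2 : ((normConst g : ℂ) * ((normConst g : ℂ) * (volume.real (brillouinZone g) : ℂ)))
        = 1 := by
      rw [← mul_assoc]; exact_mod_cast h1
    simp only [sub_self, Submodule.coe_zero, character_zero, integral_const, smul_smul,
      measureReal_restrict_apply_univ, Complex.real_smul, mul_one, h2, one_smul]
  · rw [integral_character g (γ - γ').2 (by simpa [sub_eq_zero] using hγ), mul_zero, zero_smul,
      smul_zero]

theorem fibreCoeff_waveLin_of_ne (γ γ' : periodLattice g) {e e' : G.CellEdge} (h : e ≠ e')
    (a : EdgeL2 (G.fundamentalGraph.len e')) :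
    G.fibreCoeff γ e (G.waveLin γ' e' a) = 0 := by
  classical
  have h1 : ∫ t in brillouinZone g, character γ t • G.fibreComp (G.waveLin γ' e' a) e t = 0 := by
    rw [integral_congr_ae (g := fun _ => 0), integral_zero]
    filter_upwards [G.coeFn_waveLin γ' e' a] with t ht
    rw [fibreComp, ht, wave, lp.single_apply_ne _ _ _ h, map_zero, smul_zero]
  rw [fibreCoeff, h1, smul_zero]

/-- A function in the direct integral with vanishing Fourier coefficients is zero. -/
theorem eq_zero_of_fibreCoeff {ψ : G.FibreSpace} (h : ∀ γ e, G.fibreCoeff γ e ψ = 0) : ψ = 0 := by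
  have h1 : ∀ e, ∀ᵐ t ∂(volume.restrict (brillouinZone g)), G.fibreComp ψ e t = 0 := fun e =>
    ae_eq_zero_of_fourierCoeff (G.integrableOn_fibreComp ψ e) fun γ =>
      (smul_eq_zero.mp (h γ e)).resolve_left (Complex.ofReal_ne_zero.mpr normConst_pos.ne')
  rw [← ae_all_iff] at h1
  refine Lp.ext ?_
  filter_upwards [h1, Lp.coeFn_zero G.fundamentalGraph.L2 2
    ((volume : Measure (EuclideanSpace ℝ (Fin d))).restrict (brillouinZone g))] with t ht h0
  rw [h0]
  refine lp.ext (funext fun e => ?_)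
  rw [← G.twist_fibreComp ψ e t, ht e, map_zero]
  rfl

/-- The Gelfand transform of the functions supported on the edge `e`. -/
def edgeWave (e : E) : EdgeL2 (G.toMetricGraph.len e) →ₗᵢ[ℂ] G.FibreSpace where
  toLinearMap := (G.waveLin (G.orbitIndex e) (G.orbitRep e)).comp
    (EdgeL2.castLen (G.len_orbitRep e)).toLinearEquiv.toLinearMap
  norm_map' φ := by
    set a := EdgeL2.castLen (G.len_orbitRep e) φ with ha
    have h := G.inner_waveLin (G.orbitIndex e) (G.orbitRep e) a
      (G.waveLin (G.orbitIndex e) (G.orbitRep e) a)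
    rw [fibreCoeff_waveLin_self, if_pos rfl, inner_self_eq_norm_sq_to_K,
      inner_self_eq_norm_sq_to_K] at h
    have h' : ‖G.waveLin (G.orbitIndex e) (G.orbitRep e) a‖ ^ 2 = ‖a‖ ^ 2 := by exact_mod_cast h
    have h2 := (sq_eq_sq₀ (norm_nonneg _) (norm_nonneg _)).mp h'
    change ‖G.waveLin (G.orbitIndex e) (G.orbitRep e) a‖ = ‖φ‖
    rw [h2, ha, LinearIsometryEquiv.norm_map]

theorem edgeWave_shift (γ : periodLattice g) (e : G.CellEdge)
    (a : EdgeL2 (G.fundamentalGraph.len e)) :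
    G.edgeWave (G.shift γ e) (EdgeL2.castLen (G.len_eq γ e).symm a) = G.waveLin γ e a := by
  have key : ∀ (γ' : periodLattice g) (e' : G.CellEdge) (hγ : γ' = γ) (he : e' = e)
      (hl : G.fundamentalGraph.len e = G.fundamentalGraph.len e'),
      G.waveLin γ' e' (EdgeL2.castLen hl a) = G.waveLin γ e a := by
    intro γ' e' hγ he hl
    subst hγ; subst he
    rfl
  change G.waveLin _ _ (EdgeL2.castLen _ (EdgeL2.castLen _ a)) = _
  rw [EdgeL2.castLen_trans]
  exact key _ _ (G.orbitIndex_shift γ e) (G.orbitRep_shift γ e) _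

theorem isHilbertSum_edgeWave :
    IsHilbertSum ℂ (fun e => EdgeL2 (G.toMetricGraph.len e)) G.edgeWave := by
  refine IsHilbertSum.mk ?_ ?_
  · intro e e' hne φ φ'
    change inner ℂ (G.waveLin _ _ _) (G.waveLin _ _ _) = 0
    rw [inner_waveLin]
    by_cases he : G.orbitRep e = G.orbitRep e'
    · have hγ : G.orbitIndex e ≠ G.orbitIndex e' := fun hγ => hne <| by
        rw [← G.shift_orbitRep e, ← G.shift_orbitRep e', he, hγ]
      have key : ∀ (e₁ e₂ : G.CellEdge) (_ : e₁ = e₂)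
          (a : EdgeL2 (G.fundamentalGraph.len e₂)),
          G.fibreCoeff (G.orbitIndex e) e₁ (G.waveLin (G.orbitIndex e') e₂ a) = 0 := by
        intro e₁ e₂ h a
        subst h
        rw [fibreCoeff_waveLin_self, if_neg hγ]
      rw [key _ _ he, inner_zero_right]
    · rw [fibreCoeff_waveLin_of_ne _ _ _ he, inner_zero_right]
  · rw [top_le_iff, Submodule.topologicalClosure_eq_top_iff, Submodule.eq_bot_iff]
    intro ψ hψ
    refine G.eq_zero_of_fibreCoeff fun γ e => ?_
    refine ext_inner_left ℂ fun a => ?_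
    rw [← inner_waveLin, inner_zero_right, ← edgeWave_shift]
    refine (Submodule.mem_orthogonal _ _).mp hψ _ ?_
    exact Submodule.mem_iSup_of_mem (G.shift γ e) ⟨_, rfl⟩

/-- The Gelfand transform. The functions on single edges are mapped isometrically onto mutually
orthogonal subspaces that span the direct integral. -/
def gelfandEquiv : G.toMetricGraph.L2 ≃ₗᵢ[ℂ] G.FibreSpace :=
  G.isHilbertSum_edgeWave.linearIsometryEquiv.symm

open Classical in
theorem gelfandEquiv_single (e : E) (φ : EdgeL2 (G.toMetricGraph.len e)) :
    G.gelfandEquiv (lp.single 2 e φ) = G.edgeWave e φ :=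
  G.isHilbertSum_edgeWave.linearIsometryEquiv_symm_apply_single φ

/-- The Fourier coefficients of the Gelfand transform are the values on the translated edges. -/
theorem fibreCoeff_gelfandEquiv (f : G.toMetricGraph.L2) (γ : periodLattice g) (e : G.CellEdge) :
    G.fibreCoeff γ e (G.gelfandEquiv f) = G.orbitComp f γ e := by
  classical
  refine ext_inner_left ℂ fun a => ?_
  rw [← inner_waveLin, ← edgeWave_shift, ← gelfandEquiv_single, LinearIsometryEquiv.inner_map_map,
    lp.inner_single_left, orbitComp, ← LinearIsometryEquiv.inner_map_map
      (EdgeL2.castLen (G.len_eq γ e)), EdgeL2.castLen_trans]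
  rfl

end PeriodicMetricGraph

namespace PeriodicMetricGraph

variable {d k : ℕ} {g : Module.Basis (Fin d) ℝ (EuclideanSpace ℝ (Fin d))} {E : Type*}
  (G : PeriodicMetricGraph d k g E)

theorem eq_of_inner_waveLin {ψ χ : G.FibreSpace}
    (h : ∀ γ e a, inner ℂ (G.waveLin γ e a) ψ = inner ℂ (G.waveLin γ e a) χ) : ψ = χ := by
  rw [← sub_eq_zero]
  refine G.eq_zero_of_fibreCoeff fun γ e => ext_inner_left ℂ fun a => ?_
  rw [← inner_waveLin, inner_sub_right, h, sub_self, inner_zero_right]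

/-- The Gelfand transform of a function with compact support as a finite sum. -/
theorem gelfandEquiv_eq_sum [Fintype G.CellEdge] (f : G.toMetricGraph.L2)
    (P : Finset (periodLattice g))
    (hP : ∀ (γ : periodLattice g) (e : G.CellEdge), f (G.shift γ e) ≠ 0 → γ ∈ P) :
    G.gelfandEquiv f = ∑ e : G.CellEdge, ∑ γ ∈ P, G.waveLin γ e (G.orbitComp f γ e) := by
  classical
  refine G.eq_of_inner_waveLin fun γ e a => ?_
  simp only [inner_sum]
  simp only [inner_waveLin, fibreCoeff_gelfandEquiv]
  rw [Finset.sum_eq_single e]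
  · simp only [fibreCoeff_waveLin_self]
    by_cases hγ : γ ∈ P
    · rw [Finset.sum_eq_single_of_mem γ hγ fun γ' _ hne => by
        rw [if_neg (Ne.symm hne), inner_zero_right], if_pos rfl]
    · have h0 : f (G.shift γ e) = 0 := by
        by_contra hne; exact hγ (hP γ e hne)
      rw [orbitComp, h0, map_zero, inner_zero_right]
      refine (Finset.sum_eq_zero fun γ' hγ' => ?_).symm
      rw [if_neg fun h => hγ (by rwa [h]), inner_zero_right]
  · intro e' _ hne
    refine Finset.sum_eq_zero fun γ' _ => ?_
    rw [fibreCoeff_waveLin_of_ne _ _ _ (Ne.symm hne), inner_zero_right]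
  · intro h; exact absurd (Finset.mem_univ e) h

theorem wave_apply_self (γ : periodLattice g) (e : G.CellEdge)
    (a : EdgeL2 (G.fundamentalGraph.len e)) (t : EuclideanSpace ℝ (Fin d)) :
    G.edgeEval e (G.wave γ e a t)
      = (normConst g * character (-γ) t) • EdgeL2.twist _ (G.edgePhase e t) a := by
  classical
  exact lp.single_apply_self 2 _ _

theorem wave_apply_of_ne (γ : periodLattice g) {e e' : G.CellEdge} (h : e' ≠ e)
    (a : EdgeL2 (G.fundamentalGraph.len e)) (t : EuclideanSpace ℝ (Fin d)) :
    G.edgeEval e' (G.wave γ e a t) = 0 := by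
  classical
  exact lp.single_apply_ne 2 _ _ h

/-- The Gelfand transform is given by its formula on functions with compact support. -/
theorem isGelfandTransform_gelfandEquiv :
    G.IsGelfandTransform (G.gelfandEquiv : G.toMetricGraph.L2 →L[ℂ] G.FibreSpace) := by
  classical
  intro f hf
  cases nonempty_fintype G.CellEdge
  set P : Finset (periodLattice g) := (hf.image G.orbitIndex).toFinset with hPdef
  have hP : ∀ (γ : periodLattice g) (e : G.CellEdge), f (G.shift γ e) ≠ 0 → γ ∈ P := by
    intro γ e h
    rw [hPdef, Finite.mem_toFinset]
    exact ⟨G.shift γ e, h, G.orbitIndex_shift γ e⟩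
  have hU : (G.gelfandEquiv : G.toMetricGraph.L2 →L[ℂ] G.FibreSpace) f
      = ∑ e : G.CellEdge, ∑ γ ∈ P, G.waveLin γ e (G.orbitComp f γ e) :=
    G.gelfandEquiv_eq_sum f P hP
  rw [hU, ← Finset.sum_product']
  have hw : ∀ p : G.CellEdge × periodLattice g,
      ∀ᵐ t ∂(volume.restrict (brillouinZone g)), p ∈ Finset.univ ×ˢ P →
        G.waveLin p.2 p.1 (G.orbitComp f p.2 p.1) t = G.wave p.2 p.1 (G.orbitComp f p.2 p.1) t :=
    fun p => (G.coeFn_waveLin _ _ _).mono fun t ht _ => ht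
  rw [← ae_all_iff] at hw
  filter_upwards [Lp.coeFn_finsetSum (Finset.univ ×ˢ P)
    (fun p : G.CellEdge × periodLattice g => G.waveLin p.2 p.1 (G.orbitComp f p.2 p.1)), hw]
    with t ht hwt e
  have h1 : G.edgeEval e ((∑ p ∈ Finset.univ ×ˢ P,
        G.waveLin p.2 p.1 (G.orbitComp f p.2 p.1) : G.FibreSpace) t)
      = ∑ γ ∈ P, (normConst g * character (-γ) t) •
          EdgeL2.twist _ (G.edgePhase e t) (G.orbitComp f γ e) := by
    rw [ht, Finset.sum_apply, map_sum, Finset.sum_congr rfl fun p hp => by rw [hwt p hp],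
      Finset.sum_product, Finset.sum_eq_single e]
    · exact Finset.sum_congr rfl fun γ _ => G.wave_apply_self _ _ _ _
    · intro e' _ hne
      exact Finset.sum_eq_zero fun γ _ => G.wave_apply_of_ne _ (Ne.symm hne) _ _
    · intro h; exact absurd (Finset.mem_univ e) h
  change ∀ᵐ x ∂(volume.restrict (Ioo 0 (G.len e))), (G.edgeEval e ((∑ p ∈ Finset.univ ×ˢ P,
        G.waveLin p.2 p.1 (G.orbitComp f p.2 p.1) : G.FibreSpace) t) : ℝ → ℂ) x = _
  rw [h1]
  have h2 : ∀ᵐ x ∂(volume.restrict (Ioo 0 (G.len e))), ∀ γ : periodLattice g,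
      (((normConst g * character (-γ) t) • EdgeL2.twist _ (G.edgePhase e t) (G.orbitComp f γ e) :
        EdgeL2 (G.fundamentalGraph.len e)) : ℝ → ℂ) x
      = normConst g * (f (G.shift γ e) x * character (-γ) t *
        Complex.exp (-Complex.I * (x / G.len e) * G.edgePhase e t)) := by
    rw [ae_all_iff]
    intro γ
    have e1 := Lp.coeFn_smul (normConst g * character (-γ) t)
      (EdgeL2.twist _ (G.edgePhase e t) (G.orbitComp f γ e))
    have e2 := EdgeL2.coeFn_twist (G.edgePhase e t) (G.orbitComp f γ e)
    filter_upwards [e1, e2] with x h1 h2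
    rw [h1, Pi.smul_apply, h2, coeFn_orbitComp, smul_eq_mul]
    change _ * (Complex.exp (-Complex.I * (x / G.len e) * G.edgePhase e t) * _) = _
    ring
  have h3 : ∀ᵐ x ∂(volume.restrict (Ioo 0 (G.len e))), ∀ γ : periodLattice g,
      γ ∉ P → (f (G.shift γ e) : ℝ → ℂ) x = 0 := by
    rw [ae_all_iff]
    intro γ
    by_cases hγ : γ ∈ P
    · simp [hγ]
    · have h0 : f (G.shift γ e) = 0 := by
        by_contra hne; exact hγ (hP γ e hne)
      have e1 := Lp.coeFn_zero ℂ 2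
        ((volume : Measure ℝ).restrict (Ioo 0 (G.fundamentalGraph.len e)))
      rw [← G.coeFn_orbitComp, orbitComp, h0, map_zero]
      filter_upwards [e1] with x hx _ using hx
  have h4 := Lp.coeFn_finsetSum P (fun γ : periodLattice g =>
    ((normConst g * character (-γ) t) • EdgeL2.twist _ (G.edgePhase e t) (G.orbitComp f γ e) :
        EdgeL2 (G.fundamentalGraph.len e)))
  filter_upwards [h2, h3, h4] with x a2 a3 a4
  rw [a4, Finset.sum_apply, gelfand, tsum_eq_sum (s := P) fun γ hγ => by rw [a3 γ hγ]; simp,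
    Finset.mul_sum]
  refine Finset.sum_congr rfl fun γ _ => ?_
  rw [a2 γ, character, Submodule.coe_neg, inner_neg_left]
  simp only [edgePhase, normConst]
  push_cast
  ring_nf

/-- A bounded operator is determined by the formula of the Gelfand transform, because the functions
with compact support are dense. -/
theorem eq_of_isGelfandTransform {T U : G.toMetricGraph.L2 →L[ℂ] G.FibreSpace}
    (hT : G.IsGelfandTransform T) (hU : G.IsGelfandTransform U) : T = U := by
  classical
  have hfin : ∀ f : G.toMetricGraph.L2, {e | f e ≠ 0}.Finite → T f = U f := by
    intro f hf
    refine Lp.ext ?_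
    filter_upwards [hT f hf, hU f hf] with t h1 h2
    refine lp.ext (funext fun e => Lp.ext ?_)
    filter_upwards [h1 e, h2 e] with x h1 h2
    rw [h1, h2]
  refine ContinuousLinearMap.ext fun f => ?_
  have hs := lp.hasSum_single (p := 2) (by norm_num) f
  refine (T.hasSum hs).unique ?_
  convert U.hasSum hs using 1
  funext e
  refine hfin _ ((finite_singleton e).subset fun e' he' => ?_)
  by_contra hne
  exact he' (lp.single_apply_ne _ _ _ hne)

end PeriodicMetricGraph

/-! ### The vertex conditions in terms of the ends of edges -/

namespace MetricGraph

variable {V E : Type*} (G : MetricGraph V E)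

/-- The vertex at an end of an edge; as in `endPos`, `false` stands for the origin. -/
def endVertex (a : E × Bool) : V := match a.2 with
  | false => G.src a.1
  | true => G.tgt a.1

/-- The sign with which the flux at an end of an edge enters the Kirchhoff sum. -/
def endSign : Bool → ℂ
  | false => 1
  | true => -1

theorem isContAtVertices_iff (u : E → ℝ → ℂ) :
    G.IsContAtVertices u ↔ ∀ a a' : E × Bool, G.endVertex a = G.endVertex a' →
      u a.1 (endPos (G.len a.1) a.2) = u a'.1 (endPos (G.len a'.1) a'.2) := by
  classical
  constructor
  · rintro ⟨val, hval⟩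
    have h : ∀ a : E × Bool, u a.1 (endPos (G.len a.1) a.2) = val (G.endVertex a) := by
      rintro ⟨e, s⟩
      cases s
      · exact (hval e).1
      · exact (hval e).2
    intro a a' haa
    rw [h a, h a', haa]
  · intro h
    -- the value at an isolated vertex is irrelevant
    refine ⟨fun v => if hv : ∃ a, G.endVertex a = v then
      u hv.choose.1 (endPos (G.len hv.choose.1) hv.choose.2) else 0, fun e => ⟨?_, ?_⟩⟩
    · have hv : ∃ a, G.endVertex a = G.src e := ⟨(e, false), rfl⟩
      refine Eq.trans ?_ (dif_pos hv).symm
      exact h (e, false) _ hv.choose_spec.symm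
    · have hv : ∃ a, G.endVertex a = G.tgt e := ⟨(e, true), rfl⟩
      refine Eq.trans ?_ (dif_pos hv).symm
      exact h (e, true) _ hv.choose_spec.symm

open Classical in
theorem outflow_eq_sum (w : E → ℝ → ℂ) (v : V) (e : E) :
    G.outflow w v e = ∑ s : Bool, if G.endVertex (e, s) = v then
      endSign s * w e (endPos (G.len e) s) else 0 := by
  rw [Fintype.sum_bool, outflow, add_comm]
  simp [endVertex, endSign, endPos]

open Classical in
/-- The graph of the magnetic Laplacian in terms of the boundary values `val` and `flx` of the
solutions of the first order systems on the edges and of their fluxes. -/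
theorem mem_laplacianGraph_iff_of_values {b A : E → ℝ → ℝ}
    (hb : ∀ e, ContinuousOn (b e) (Icc 0 (G.len e)))
    (hA : ∀ e, ContinuousOn (A e) (Icc 0 (G.len e)))
    (hpos : ∀ e, ∀ x ∈ Icc 0 (G.len e), 0 < b e x) (p : G.L2 × G.L2) (val flx : E → Bool → ℂ)
    (hval : ∀ e u w, IsFluxPair (G.len e) (b e) (A e) (p.1 e) (p.2 e) u w →
      ∀ s, u (endPos (G.len e) s) = val e s ∧ w (endPos (G.len e) s) = flx e s) :
    p ∈ G.laplacianGraph b A ↔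
      (∀ e, ∃ u w, IsFluxPair (G.len e) (b e) (A e) (p.1 e) (p.2 e) u w) ∧
      (∃ f₁ f₂ : G.L2, G.IsSobolevTwo p.1 f₁ f₂) ∧
      (∀ a a' : E × Bool, G.endVertex a = G.endVertex a' → val a.1 a.2 = val a'.1 a'.2) ∧
      ∀ v, ∑ᶠ e, ∑ s : Bool, (if G.endVertex (e, s) = v then endSign s * flx e s else 0) = 0 := by
  rw [G.mem_laplacianGraph_iff hb hA hpos]
  have hflow : ∀ u w : E → ℝ → ℂ,
      (∀ e, IsFluxPair (G.len e) (b e) (A e) (p.1 e) (p.2 e) (u e) (w e)) → ∀ v e,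
      G.outflow w v e = ∑ s : Bool, if G.endVertex (e, s) = v then
        endSign s * flx e s else 0 := fun u w hp v e => by
    rw [outflow_eq_sum]
    exact Finset.sum_congr rfl fun s _ => by rw [(hval e _ _ (hp e) s).2]
  constructor
  · rintro ⟨u, w, hp, hs, hc, hk⟩
    refine ⟨fun e => ⟨_, _, hp e⟩, hs, fun a a' haa => ?_, fun v => ?_⟩
    · rw [← (hval _ _ _ (hp a.1) a.2).1, ← (hval _ _ _ (hp a'.1) a'.2).1]
      exact (G.isContAtVertices_iff u).mp hc a a' haa
    · exact (finsum_congr fun e => (hflow u w hp v e).symm).trans (hk v)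
  · rintro ⟨hp, hs, hc, hk⟩
    choose u w hp using hp
    refine ⟨u, w, hp, hs, (G.isContAtVertices_iff u).mpr fun a a' haa => ?_, fun v => ?_⟩
    · rw [(hval _ _ _ (hp a.1) a.2).1, (hval _ _ _ (hp a'.1) a'.2).1]
      exact hc a a' haa
    · exact (finsum_congr fun e => hflow u w hp v e).trans (hk v)

end MetricGraph

namespace PeriodicMetricGraph

variable {d k : ℕ} {g : Module.Basis (Fin d) ℝ (EuclideanSpace ℝ (Fin d))} {E : Type*}
  (G : PeriodicMetricGraph d k g E)

/-! ### Vertices and ends of edges modulo the period lattice -/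

/-- The lattice part of the vertex at an end of an edge that originates in the fundamental vertex
set. -/
def endIndex (a : G.CellEdge × Bool) : periodLattice g := match a.2 with
  | false => 0
  | true => G.edgeIndex a.1

/-- The translate by `γ` of a vertex in the fundamental vertex set. -/
def translate (γ : periodLattice g) (v : G.cellVerts) : G.verts :=
  ⟨(v.1.1 + γ, v.1.2), G.verts_add γ v.1 v.2.1⟩

theorem floor_translate (γ : periodLattice g) (v : G.cellVerts) :
    ZSpan.floor g (G.translate γ v).1.1 = γ := by
  rw [translate, floor_add_lattice, floor_eq_zero_of_mem g v.2.2, zero_add]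

theorem translate_injective (γ : periodLattice g) : Function.Injective (G.translate γ) := by
  intro v w h
  have h1 := congrArg Subtype.val h
  simp only [translate, Prod.mk.injEq, add_left_inj] at h1
  exact Subtype.ext (Prod.ext h1.1 h1.2)

theorem exists_translate_eq (v : G.verts) : ∃ γ w, G.translate γ w = v := by
  refine ⟨ZSpan.floor g v.1.1, G.reduce v, Subtype.ext (Prod.ext ?_ rfl)⟩
  simp [translate, reduce, ZSpan.fract_apply]

theorem endVertex_shift (γ : periodLattice g) (a : G.CellEdge × Bool) :
    G.toMetricGraph.endVertex (G.shift (γ - G.endIndex a) a.1, a.2)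
      = G.translate γ (G.fundamentalGraph.endVertex a) := by
  obtain ⟨e, s⟩ := a
  refine Subtype.ext ?_
  cases s
  · change (G.src _).1 = _
    rw [G.src_shift]
    simp [endIndex, translate, MetricGraph.endVertex, fundamentalGraph]
  · change (G.tgt _).1 = _
    rw [G.tgt_shift]
    simp only [endIndex, translate, MetricGraph.endVertex, fundamentalGraph, reduce, edgeIndex,
      ZSpan.fract_apply, floor_eq_zero_of_mem g e.2.2, sub_zero, Submodule.coe_sub]
    refine Prod.ext ?_ rfl
    simp only
    abel

/-- Every end of an edge is a translate of an end of an edge of the fundamental graph. The shift by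
`endIndex` makes `γ` the lattice part of the vertex at this end (see `endVertex_shift`). -/
theorem exists_end_eq (a : E × Bool) : ∃ (γ : periodLattice g) (e : G.CellEdge),
    a = (G.shift (γ - G.endIndex (e, a.2)) e, a.2) :=
  ⟨G.orbitIndex a.1 + G.endIndex (G.orbitRep a.1, a.2), G.orbitRep a.1,
    Prod.ext (by rw [add_sub_cancel_right, G.shift_orbitRep]) rfl⟩

theorem shift_injective (s : Bool) (γ : periodLattice g) :
    Function.Injective fun e : G.CellEdge => G.shift (γ - G.endIndex (e, s)) e := by
  intro e e' h
  have := congrArg G.orbitRep h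
  simpa only [orbitRep_shift] using this

/-- Continuity at the vertices, modulo the period lattice. -/
theorem forall_endVertex_eq_iff (val : E → Bool → ℂ) :
    (∀ a a' : E × Bool, G.toMetricGraph.endVertex a = G.toMetricGraph.endVertex a' →
      val a.1 a.2 = val a'.1 a'.2) ↔
    ∀ a a' : G.CellEdge × Bool, G.fundamentalGraph.endVertex a = G.fundamentalGraph.endVertex a' →
      ∀ γ, val (G.shift (γ - G.endIndex a) a.1) a.2
        = val (G.shift (γ - G.endIndex a') a'.1) a'.2 := by
  constructor
  · intro h a a' haa γ
    exact h (G.shift (γ - G.endIndex a) a.1, a.2) (G.shift (γ - G.endIndex a') a'.1, a'.2)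
      (by rw [endVertex_shift, endVertex_shift, haa])
  · intro h a a' haa
    obtain ⟨γ, e, ha⟩ := G.exists_end_eq a
    obtain ⟨γ', e', ha'⟩ := G.exists_end_eq a'
    have h1 := G.endVertex_shift γ (e, a.2)
    have h2 := G.endVertex_shift γ' (e', a'.2)
    simp only [← ha] at h1
    simp only [← ha'] at h2
    rw [h1, h2] at haa
    have hγ : γ = γ' := by
      rw [← G.floor_translate γ, haa, G.floor_translate]
    subst hγ
    have h3 := h _ _ (G.translate_injective γ haa) γ
    rw [ha, ha']
    exact h3

open Classical in
/-- The Kirchhoff sum at a vertex, as a sum over the edges of the fundamental graph. -/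
theorem finsum_endVertex_eq [Fintype G.CellEdge] (flx : E → Bool → ℂ) (γ : periodLattice g)
    (v : G.cellVerts) :
    ∑ᶠ e, ∑ s : Bool, (if G.toMetricGraph.endVertex (e, s) = G.translate γ v then
        MetricGraph.endSign s * flx e s else 0)
      = ∑ a : G.CellEdge × Bool with G.fundamentalGraph.endVertex a = v,
        MetricGraph.endSign a.2 * flx (G.shift (γ - G.endIndex a) a.1) a.2 := by
  have hs : ∀ s : Bool, Function.support (fun e => if G.toMetricGraph.endVertex (e, s)
      = G.translate γ v then MetricGraph.endSign s * flx e s else 0)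
      ⊆ (Finset.univ.image fun e : G.CellEdge => G.shift (γ - G.endIndex (e, s)) e : Finset E) := by
    intro s e he
    simp only [Function.mem_support, ne_eq, ite_eq_right_iff, not_forall] at he
    obtain ⟨hv, -⟩ := he
    obtain ⟨γ', e', ha⟩ := G.exists_end_eq (e, s)
    have h1 := G.endVertex_shift γ' (e', s)
    simp only [← ha] at h1
    rw [hv] at h1
    have hγ : γ = γ' := by
      rw [← G.floor_translate γ, h1, G.floor_translate]
    subst hγ
    simp only [Finset.coe_image, Finset.coe_univ, image_univ, mem_range]
    exact ⟨e', (congrArg Prod.fst ha).symm⟩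
  have h1 : ∀ s : Bool, ∑ᶠ e, (if G.toMetricGraph.endVertex (e, s) = G.translate γ v then
        MetricGraph.endSign s * flx e s else 0)
      = ∑ e : G.CellEdge, if G.fundamentalGraph.endVertex (e, s) = v then
        MetricGraph.endSign s * flx (G.shift (γ - G.endIndex (e, s)) e) s else 0 := by
    intro s
    rw [finsum_eq_sum_of_support_subset _ (hs s),
      Finset.sum_image fun e _ e' _ h => G.shift_injective s γ h]
    refine Finset.sum_congr rfl fun e _ => ?_
    have h2 := G.endVertex_shift γ (e, s)
    simp only at h2
    simp only [h2, (G.translate_injective γ).eq_iff]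
  rw [finsum_sum_comm _ _ fun s _ => (Finset.finite_toSet _).subset (hs s)]
  simp only [h1]
  rw [Finset.sum_comm, Finset.sum_filter, Fintype.sum_prod_type]

end PeriodicMetricGraph

namespace PeriodicMetricGraph

variable {d k : ℕ} {g : Module.Basis (Fin d) ℝ (EuclideanSpace ℝ (Fin d))} {E : Type*}
  (G : PeriodicMetricGraph d k g E)

/-! ### The magnetic Laplacian on the orbits of edges and in the fibres -/

/-- A pair of functions on the translate by `γ` of the edge `e` of the fundamental graph. -/
def orbitPair (p : G.toMetricGraph.L2 × G.toMetricGraph.L2) (γ : periodLattice g)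
    (e : G.CellEdge) : EdgeL2 (G.fundamentalGraph.len e) × EdgeL2 (G.fundamentalGraph.len e) :=
  (G.orbitComp p.1 γ e, G.orbitComp p.2 γ e)

/-- The components on the edge `e` of a pair of fibre functions, with the phase factor of the
Gelfand transform removed. -/
def fibrePair (q : G.FibreSpace × G.FibreSpace) (e : G.CellEdge) (t : EuclideanSpace ℝ (Fin d)) :
    EdgeL2 (G.fundamentalGraph.len e) × EdgeL2 (G.fundamentalGraph.len e) :=
  (G.fibreComp q.1 e t, G.fibreComp q.2 e t)

section Coefficients

variable {Y : Type*} [NormedAddCommGroup Y] [NormedSpace ℂ Y]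

theorem integrableOn_map_fibrePair (q : G.FibreSpace × G.FibreSpace) (e : G.CellEdge)
    (T : EdgeL2 (G.fundamentalGraph.len e) × EdgeL2 (G.fundamentalGraph.len e) →L[ℂ] Y) :
    IntegrableOn (fun t => T (G.fibrePair q e t)) (brillouinZone g) :=
  T.integrable_comp ((G.integrableOn_fibreComp q.1 e).prodMk (G.integrableOn_fibreComp q.2 e))

/-- Bounded operators that act on a single edge commute with the Gelfand transform. -/
theorem map_orbitPair [CompleteSpace Y] (p : G.toMetricGraph.L2 × G.toMetricGraph.L2)
    (γ : periodLattice g) (e : G.CellEdge)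
    (T : EdgeL2 (G.fundamentalGraph.len e) × EdgeL2 (G.fundamentalGraph.len e) →L[ℂ] Y) :
    T (G.orbitPair p γ e) = (normConst g : ℂ) • ∫ t in brillouinZone g,
      character γ t • T (G.fibrePair (G.gelfandEquiv p.1, G.gelfandEquiv p.2) e t) := by
  have h1 := integrable_character_smul (γ : EuclideanSpace ℝ (Fin d))
    (G.integrableOn_fibreComp (G.gelfandEquiv p.1) e)
  have h2 := integrable_character_smul (γ : EuclideanSpace ℝ (Fin d))
    (G.integrableOn_fibreComp (G.gelfandEquiv p.2) e)
  rw [orbitPair, ← fibreCoeff_gelfandEquiv, ← fibreCoeff_gelfandEquiv, fibreCoeff, fibreCoeff,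
    ← Prod.smul_mk, ← integral_pair h1 h2, map_smul, ← T.integral_comp_comm (h1.prodMk h2)]
  congr 1
  refine integral_congr_ae (Filter.Eventually.of_forall fun t => ?_)
  simp only
  rw [← Prod.smul_mk, map_smul, fibrePair]

end Coefficients

/-- Uniformly bounded edgewise operators act on the functions on the periodic graph. -/
theorem exists_coeFn_shift_eq
    (D : ∀ e : G.CellEdge, EdgeL2 (G.fundamentalGraph.len e) × EdgeL2 (G.fundamentalGraph.len e)
      →L[ℂ] EdgeL2 (G.fundamentalGraph.len e))
    (p : G.toMetricGraph.L2 × G.toMetricGraph.L2) :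
    ∃ F : G.toMetricGraph.L2, ∀ γ (e : G.CellEdge),
      (F (G.shift γ e) : ℝ → ℂ) = D e (G.orbitPair p γ e) := by
  obtain ⟨C, hC⟩ := Set.Finite.bddAbove (Set.finite_range fun e => ‖D e‖)
  have hC : ∀ e, ‖D e‖ ≤ C := fun e => hC ⟨e, rfl⟩
  let F : ∀ e : E, EdgeL2 (G.toMetricGraph.len e) := fun e =>
    EdgeL2.castLen (G.len_orbitRep e).symm
      (D (G.orbitRep e) (G.orbitPair p (G.orbitIndex e) (G.orbitRep e)))
  have hn : ∀ (f : G.toMetricGraph.L2) e,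
      ‖G.orbitComp f (G.orbitIndex e) (G.orbitRep e)‖ = ‖f e‖ := fun f e => by
    rw [orbitComp, LinearIsometryEquiv.norm_map, G.shift_orbitRep]
  have hF : Memℓp F 2 := by
    refine memℓp_gen ?_
    have h1 := ((lp.memℓp p.1).summable (by norm_num)).add ((lp.memℓp p.2).summable (by norm_num))
    refine Summable.of_nonneg_of_le (fun e => by positivity) (fun e => ?_) (h1.mul_left (C ^ 2))
    simp only [ENNReal.toReal_ofNat, Real.rpow_ofNat]
    have h2 : ‖F e‖ ≤ C * max ‖p.1 e‖ ‖p.2 e‖ := by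
      rw [LinearIsometryEquiv.norm_map]
      refine ((D _).le_of_opNorm_le (hC _) _).trans_eq ?_
      rw [orbitPair, Prod.norm_mk, hn, hn]
    have h3 : max ‖p.1 e‖ ‖p.2 e‖ ^ 2 ≤ ‖p.1 e‖ ^ 2 + ‖p.2 e‖ ^ 2 := by
      rcases max_choice ‖p.1 e‖ ‖p.2 e‖ with h | h <;> rw [h]
      · exact le_add_of_nonneg_right (by positivity)
      · exact le_add_of_nonneg_left (by positivity)
    calc ‖F e‖ ^ 2 ≤ (C * max ‖p.1 e‖ ‖p.2 e‖) ^ 2 := by gcongr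
      _ = C ^ 2 * max ‖p.1 e‖ ‖p.2 e‖ ^ 2 := by ring
      _ ≤ _ := by gcongr
  refine ⟨⟨F, hF⟩, fun γ e => ?_⟩
  have h : ∀ γ' e', γ' = γ → e' = e →
      (D e' (G.orbitPair p γ' e') : ℝ → ℂ) = D e (G.orbitPair p γ e) := by
    rintro _ _ rfl rfl; rfl
  exact (EdgeL2.coeFn_castLen _ _).trans (h _ _ (G.orbitIndex_shift γ e) (G.orbitRep_shift γ e))

section Laplacian

variable {b A : E → ℝ → ℝ}

theorem isFluxPair_shift_iff
    (hb_per : ∀ γ e, ∀ x ∈ Icc 0 (G.len e), b (G.shift γ e) x = b e x)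
    (hA_per : ∀ γ e, ∀ x ∈ Icc 0 (G.len e), A (G.shift γ e) x = A e x)
    (p : G.toMetricGraph.L2 × G.toMetricGraph.L2) (γ : periodLattice g) (e : G.CellEdge)
    (u w : ℝ → ℂ) :
    IsFluxPair (G.toMetricGraph.len (G.shift γ e)) (b (G.shift γ e)) (A (G.shift γ e))
        (p.1 (G.shift γ e)) (p.2 (G.shift γ e)) u w ↔
      IsFluxPair (G.fundamentalGraph.len e) (b e) (A e) (G.orbitPair p γ e).1
        (G.orbitPair p γ e).2 u w := by
  have hl := G.len_eq γ e
  refine IsFluxPair.congr_iff hl (fun x hx => ?_) (fun x hx => ?_)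
    (Filter.EventuallyEq.of_eq (G.coeFn_orbitComp _ γ e).symm)
    (Filter.EventuallyEq.of_eq (G.coeFn_orbitComp _ γ e).symm)
  · exact hb_per γ e x (by rw [hl] at hx; exact hx)
  · exact hA_per γ e x (by rw [hl] at hx; exact hx)

variable (O : ∀ e : G.CellEdge, EdgeOperators (G.fundamentalGraph.len e) (b e) (A e))

open Classical in
/-- Membership in the graph of the magnetic Laplacian, as relations between the images of the
components on the translated edges under finitely many bounded operators. -/
theorem mem_laplacianGraph_iff_orbitPair [Fintype G.CellEdge]
    (hb : ∀ e, ContDiffOn ℝ 1 (b e) (Icc 0 (G.len e)))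
    (hA : ∀ e, ContDiffOn ℝ 1 (A e) (Icc 0 (G.len e)))
    (hb_per : ∀ γ e, ∀ x ∈ Icc 0 (G.len e), b (G.shift γ e) x = b e x)
    (hA_per : ∀ γ e, ∀ x ∈ Icc 0 (G.len e), A (G.shift γ e) x = A e x)
    (hpos : ∀ e, ∀ x ∈ Icc 0 (G.len e), 0 < b e x)
    (p : G.toMetricGraph.L2 × G.toMetricGraph.L2) :
    p ∈ G.toMetricGraph.laplacianGraph b A ↔
      (∀ e γ, (O e).defect (G.orbitPair p γ e) = 0) ∧
      (∀ a a' : G.CellEdge × Bool,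
        G.fundamentalGraph.endVertex a = G.fundamentalGraph.endVertex a' →
        ∀ γ, (O a.1).value a.2 (G.orbitPair p (γ - G.endIndex a) a.1)
          = (O a'.1).value a'.2 (G.orbitPair p (γ - G.endIndex a') a'.1)) ∧
      ∀ v γ, ∑ a : G.CellEdge × Bool with G.fundamentalGraph.endVertex a = v,
        MetricGraph.endSign a.2 * (O a.1).flux a.2 (G.orbitPair p (γ - G.endIndex a) a.1) = 0 := by
  have hiff := G.isFluxPair_shift_iff hb_per hA_per p
  have hval : ∀ γ (e : G.CellEdge) s, (O (G.orbitRep (G.shift γ e))).value s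
      (G.orbitPair p (G.orbitIndex (G.shift γ e)) (G.orbitRep (G.shift γ e)))
        = (O e).value s (G.orbitPair p γ e) := fun γ e s => by
    rw [orbitIndex_shift, orbitRep_shift]
  have hflx : ∀ γ (e : G.CellEdge) s, (O (G.orbitRep (G.shift γ e))).flux s
      (G.orbitPair p (G.orbitIndex (G.shift γ e)) (G.orbitRep (G.shift γ e)))
        = (O e).flux s (G.orbitPair p γ e) := fun γ e s => by
    rw [orbitIndex_shift, orbitRep_shift]
  have hall : ∀ e : E, ∃ γ e₀, e = G.shift γ (e₀ : G.CellEdge) := fun e =>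
    ⟨_, _, (G.shift_orbitRep e).symm⟩
  rw [G.toMetricGraph.mem_laplacianGraph_iff_of_values (fun e => (hb e).continuousOn)
    (fun e => (hA e).continuousOn) hpos p
    (fun e s => (O (G.orbitRep e)).value s (G.orbitPair p (G.orbitIndex e) (G.orbitRep e)))
    (fun e s => (O (G.orbitRep e)).flux s (G.orbitPair p (G.orbitIndex e) (G.orbitRep e))) ?_,
    G.forall_endVertex_eq_iff fun e s =>
      (O (G.orbitRep e)).value s (G.orbitPair p (G.orbitIndex e) (G.orbitRep e))]
  · simp only [hval]
    have hdef : (∀ e : E, ∃ u w, IsFluxPair (G.toMetricGraph.len e) (b e) (A e) (p.1 e) (p.2 e) u w)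
        ↔ ∀ e γ, (O e).defect (G.orbitPair p γ e) = 0 := by
      constructor
      · intro h e γ
        obtain ⟨u, w, huw⟩ := h (G.shift γ e)
        exact (O e).defect_eq_zero _ u w ((hiff γ e u w).mp huw)
      · intro h e
        obtain ⟨γ, e, rfl⟩ := hall e
        obtain ⟨u, w, huw⟩ := (O e).exists_of_defect _ (h e γ)
        exact ⟨u, w, (hiff γ e u w).mpr huw⟩
    have hsob : (∀ e γ, (O e).defect (G.orbitPair p γ e) = 0) →
        ∃ f₁ f₂ : G.toMetricGraph.L2, G.toMetricGraph.IsSobolevTwo p.1 f₁ f₂ := by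
      intro h
      choose D₁ D₂ hD using fun e : G.CellEdge => exists_sobolevOperators (G.len_pos e) (hb e)
        (hA e) (hpos e)
      obtain ⟨f₁, hf₁⟩ := G.exists_coeFn_shift_eq D₁ p
      obtain ⟨f₂, hf₂⟩ := G.exists_coeFn_shift_eq D₂ p
      refine ⟨f₁, f₂, fun e => ?_⟩
      obtain ⟨γ, e, rfl⟩ := hall e
      obtain ⟨u, w, huw⟩ := (O e).exists_of_defect _ (h e γ)
      have h1 := hD e _ u w huw
      rw [hf₁, hf₂, ← G.coeFn_orbitComp, G.len_eq]
      exact h1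
    have hkir : (∀ v : G.verts, ∑ᶠ e, ∑ s : Bool, (if G.toMetricGraph.endVertex (e, s) = v then
        MetricGraph.endSign s * (O (G.orbitRep e)).flux s
          (G.orbitPair p (G.orbitIndex e) (G.orbitRep e)) else 0) = 0) ↔
        ∀ v γ, ∑ a : G.CellEdge × Bool with G.fundamentalGraph.endVertex a = v,
          MetricGraph.endSign a.2 * (O a.1).flux a.2 (G.orbitPair p (γ - G.endIndex a) a.1)
            = 0 := by
      have key : ∀ v γ, _ = _ := fun v γ => G.finsum_endVertex_eq (fun e s =>
        (O (G.orbitRep e)).flux s (G.orbitPair p (G.orbitIndex e) (G.orbitRep e))) γ v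
      simp only [hflx] at key
      constructor
      · intro h v γ
        rw [← key]
        exact h _
      · intro h v
        obtain ⟨γ, w, rfl⟩ := G.exists_translate_eq v
        rw [key]
        exact h w γ
    rw [hdef]
    refine Iff.trans (and_congr_right fun _ => and_congr_right fun _ => and_congr_right fun _ =>
      (Iff.trans (by congr!) hkir)) ⟨fun h => ⟨h.1, h.2.2⟩, fun h => ⟨h.1, hsob h.1, h.2⟩⟩
  · intro e u w huw s
    obtain ⟨γ, e, rfl⟩ := hall e
    have h1 := (hiff γ e u w).mp huw
    rw [hval, hflx, G.len_eq]
    exact ⟨(O e).value_eq _ u w h1 s, (O e).flux_eq _ u w h1 s⟩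

/-- The phase factor of the Gelfand transform at the ends of an edge. -/
theorem twistFun_endPos (e : G.CellEdge) (t : EuclideanSpace ℝ (Fin d)) (s : Bool) :
    Complex.exp (-Complex.I * (endPos (G.fundamentalGraph.len e) s / G.fundamentalGraph.len e)
      * G.edgePhase e t) = character (-G.endIndex (e, s) : periodLattice g) t := by
  have hl : (G.fundamentalGraph.len e : ℂ) ≠ 0 :=
    Complex.ofReal_ne_zero.mpr (G.fundamentalGraph.len_pos e).ne'
  cases s
  · simp [endPos, endIndex]
  · simp [endPos, endIndex, character, hl, edgePhase, inner_neg_left]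

/-- The phase factor of the Gelfand transform is the gauge transformation that produces the
potential of the fibre operator. -/
theorem isFluxPair_fibre_iff (q : G.FibreSpace × G.FibreSpace) (e : G.CellEdge)
    (t : EuclideanSpace ℝ (Fin d)) (u w : ℝ → ℂ) :
    IsFluxPair (G.fundamentalGraph.len e) (b e) (A e) (G.fibrePair q e t).1 (G.fibrePair q e t).2
        u w ↔
      IsFluxPair (G.fundamentalGraph.len e) (b e)
        (fun x => A e x + G.edgePhase e t / G.fundamentalGraph.len e) (q.1 t e) (q.2 t e)
        (fun x => Complex.exp (-Complex.I * (x / G.fundamentalGraph.len e) * G.edgePhase e t) * u x)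
        (fun x => Complex.exp (-Complex.I * (x / G.fundamentalGraph.len e) * G.edgePhase e t)
          * w x) := by
  have hl := G.fundamentalGraph.len_pos e
  constructor
  · intro h
    refine (h.twist hl (G.edgePhase e t)).congr (eqOn_refl _ _) (eqOn_refl _ _) ?_ ?_
    · refine (EdgeL2.coeFn_twist _ _).symm.trans (Filter.EventuallyEq.of_eq ?_)
      exact congrArg (fun f : EdgeL2 _ => (f : ℝ → ℂ)) (G.twist_fibreComp q.1 e t)
    · refine (EdgeL2.coeFn_twist _ _).symm.trans (Filter.EventuallyEq.of_eq ?_)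
      exact congrArg (fun f : EdgeL2 _ => (f : ℝ → ℂ)) (G.twist_fibreComp q.2 e t)
  · intro h
    have h1 := h.twist hl (-G.edgePhase e t)
    simp only [← mul_assoc, EdgeL2.twistFun_neg_mul, one_mul] at h1
    refine h1.congr (eqOn_refl _ _) (fun x _ => by ring) ?_ ?_
    · exact (EdgeL2.coeFn_twist _ _).symm
    · exact (EdgeL2.coeFn_twist _ _).symm

end Laplacian

end PeriodicMetricGraph

namespace MetricGraph

variable {V E : Type*} (G : MetricGraph V E)

theorem exists_L2_eq [Finite E] (F : ∀ e, EdgeL2 (G.len e)) : ∃ f : G.L2, ∀ e, f e = F e :=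
  ⟨⟨F, Memℓp.all F⟩, fun _ => rfl⟩

end MetricGraph

namespace PeriodicMetricGraph

variable {d k : ℕ} {g : Module.Basis (Fin d) ℝ (EuclideanSpace ℝ (Fin d))} {E : Type*}
  (G : PeriodicMetricGraph d k g E)
variable {b A : E → ℝ → ℝ}
variable (O : ∀ e : G.CellEdge, EdgeOperators (G.fundamentalGraph.len e) (b e) (A e))

open Classical in
/-- Membership in the graph of a fibre operator. The gauge transformation that removes the
quasimomentum from the potential puts it into the vertex conditions. -/
theorem mem_fibreLaplacian_graph_iff [Fintype G.CellEdge]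
    (hb : ∀ e, ContDiffOn ℝ 1 (b e) (Icc 0 (G.len e)))
    (hA : ∀ e, ContDiffOn ℝ 1 (A e) (Icc 0 (G.len e)))
    (hpos : ∀ e, ∀ x ∈ Icc 0 (G.len e), 0 < b e x)
    (q : G.FibreSpace × G.FibreSpace) (t : EuclideanSpace ℝ (Fin d)) :
    (q.1 t, q.2 t) ∈ (G.fibreLaplacian b A t).graph ↔
      (∀ e, (O e).defect (G.fibrePair q e t) = 0) ∧
      (∀ a a' : G.CellEdge × Bool,
        G.fundamentalGraph.endVertex a = G.fundamentalGraph.endVertex a' →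
        character (-G.endIndex a : periodLattice g) t • (O a.1).value a.2 (G.fibrePair q a.1 t)
          = character (-G.endIndex a' : periodLattice g) t •
            (O a'.1).value a'.2 (G.fibrePair q a'.1 t)) ∧
      ∀ v, ∑ a : G.CellEdge × Bool with G.fundamentalGraph.endVertex a = v,
        character (-G.endIndex a : periodLattice g) t •
          (MetricGraph.endSign a.2 * (O a.1).flux a.2 (G.fibrePair q a.1 t)) = 0 := by
  have hiff := G.isFluxPair_fibre_iff (b := b) (A := A) q
  set At : G.CellEdge → ℝ → ℝ := fun e x =>
    A e x + G.edgePhase e t / G.fundamentalGraph.len e with hAt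
  have hAt1 : ∀ e : G.CellEdge, ContDiffOn ℝ 1 (At e) (Icc 0 (G.fundamentalGraph.len e)) :=
    fun e => (hA e).add contDiffOn_const
  -- every solution of the system with the potential of the fibre is a gauge transform
  have hungauge : ∀ e u w, IsFluxPair (G.fundamentalGraph.len e) (b e) (At e) (q.1 t e) (q.2 t e)
      u w → ∃ u₀ w₀, IsFluxPair (G.fundamentalGraph.len e) (b e) (A e) (G.fibrePair q e t).1
        (G.fibrePair q e t).2 u₀ w₀ ∧
      (u = fun x : ℝ => Complex.exp (-Complex.I * (x / G.fundamentalGraph.len e) * G.edgePhase e t)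
        * u₀ x) ∧
      w = fun x : ℝ => Complex.exp (-Complex.I * (x / G.fundamentalGraph.len e) * G.edgePhase e t)
        * w₀ x := by
    intro e u w h
    have hφ : ∀ (z : ℝ → ℂ), z = fun x : ℝ =>
        Complex.exp (-Complex.I * (x / G.fundamentalGraph.len e) * G.edgePhase e t) *
        (Complex.exp (-Complex.I * (x / G.fundamentalGraph.len e) * (-G.edgePhase e t : ℝ))
          * z x) := fun z => by
      funext x
      have := EdgeL2.twistFun_neg_mul (G.fundamentalGraph.len e) (G.edgePhase e t) x
      rw [← mul_assoc, mul_comm (Complex.exp _), this, one_mul]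
    refine ⟨_, _, (hiff e t _ _).mpr ?_, hφ u, hφ w⟩
    rw [← hφ u, ← hφ w]
    exact h
  rw [fibreLaplacian, MetricGraph.magneticLaplacian_graph]
  change (q.1 t, q.2 t) ∈ G.fundamentalGraph.laplacianGraph (fun e => b e) At ↔ _
  rw [G.fundamentalGraph.mem_laplacianGraph_iff_of_values (fun e => (hb e).continuousOn)
    (fun e => (hAt1 e).continuousOn) (fun e => hpos e) (q.1 t, q.2 t)
    (fun e s => character (-G.endIndex (e, s) : periodLattice g) t •
      (O e).value s (G.fibrePair q e t))
    (fun e s => character (-G.endIndex (e, s) : periodLattice g) t •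
      (O e).flux s (G.fibrePair q e t)) ?_]
  · have hdef : (∀ e, ∃ u w, IsFluxPair (G.fundamentalGraph.len e) (b e) (At e) (q.1 t e) (q.2 t e)
        u w) ↔ ∀ e, (O e).defect (G.fibrePair q e t) = 0 := by
      refine forall_congr' fun e => ⟨?_, fun h => ?_⟩
      · rintro ⟨u, w, h⟩
        obtain ⟨u₀, w₀, h₀, -⟩ := hungauge e u w h
        exact (O e).defect_eq_zero _ _ _ h₀
      · obtain ⟨u, w, h₀⟩ := (O e).exists_of_defect _ h
        exact ⟨_, _, (hiff e t u w).mp h₀⟩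
    have hsob : (∀ e, ∃ u w, IsFluxPair (G.fundamentalGraph.len e) (b e) (At e) (q.1 t e)
        (q.2 t e) u w) →
        ∃ f₁ f₂ : G.fundamentalGraph.L2, G.fundamentalGraph.IsSobolevTwo (q.1 t) f₁ f₂ := by
      intro h
      choose u w h using h
      choose D₁ D₂ hD using fun e : G.CellEdge => exists_sobolevOperators
        (G.fundamentalGraph.len_pos e) (hb e) (hAt1 e) (hpos e)
      obtain ⟨f₁, hf₁⟩ := G.fundamentalGraph.exists_L2_eq fun e => D₁ e (q.1 t e, q.2 t e)
      obtain ⟨f₂, hf₂⟩ := G.fundamentalGraph.exists_L2_eq fun e => D₂ e (q.1 t e, q.2 t e)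
      refine ⟨f₁, f₂, fun e => ?_⟩
      rw [hf₁, hf₂]
      exact hD e (q.1 t e, q.2 t e) _ _ (h e)
    refine Iff.trans (and_congr_right fun h => ((and_iff_right (hsob h)).trans
      (and_congr_right fun _ => forall_congr' fun v => ?_))) (and_congr_left' hdef)
    rw [finsum_eq_sum_of_fintype, Finset.sum_filter, Fintype.sum_prod_type]
    simp only [smul_eq_mul, mul_left_comm (MetricGraph.endSign _)]
  · intro e u w h s
    obtain ⟨u₀, w₀, h₀, rfl, rfl⟩ := hungauge e u w h
    rw [← (O e).value_eq _ u₀ w₀ h₀ s, ← (O e).flux_eq _ u₀ w₀ h₀ s]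
    simp only [G.twistFun_endPos, smul_eq_mul, and_self]

/-- The Gelfand transform maps the graph of the magnetic Laplacian onto the graph of the direct
integral of the fibre operators. -/
theorem mem_laplacianGraph_iff_ae
    (hb : ∀ e, ContDiffOn ℝ 1 (b e) (Icc 0 (G.len e)))
    (hA : ∀ e, ContDiffOn ℝ 1 (A e) (Icc 0 (G.len e)))
    (hb_per : ∀ γ e, ∀ x ∈ Icc 0 (G.len e), b (G.shift γ e) x = b e x)
    (hA_per : ∀ γ e, ∀ x ∈ Icc 0 (G.len e), A (G.shift γ e) x = A e x)
    (hpos : ∀ e, ∀ x ∈ Icc 0 (G.len e), 0 < b e x)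
    (p : G.toMetricGraph.L2 × G.toMetricGraph.L2) :
    p ∈ G.toMetricGraph.laplacianGraph b A ↔
      ∀ᵐ t ∂(volume.restrict (brillouinZone g)),
        (G.gelfandEquiv p.1 t, G.gelfandEquiv p.2 t) ∈ (G.fibreLaplacian b A t).graph := by
  classical
  have := Fintype.ofFinite G.CellEdge
  have : Finite G.cellVerts := G.finite_cell.to_subtype
  have hO : ∀ e : G.CellEdge,
      Nonempty (EdgeOperators (G.fundamentalGraph.len e) (b e) (A e)) := fun e =>
    exists_edgeOperators (G.fundamentalGraph.len_pos e) (hb e).continuousOn (hA e).continuousOn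
      (hpos e)
  let O := fun e => (hO e).some
  have hc : (normConst g : ℂ) ≠ 0 := Complex.ofReal_ne_zero.mpr normConst_pos.ne'
  set q := (G.gelfandEquiv p.1, G.gelfandEquiv p.2)
  rw [G.mem_laplacianGraph_iff_orbitPair O hb hA hb_per hA_per hpos]
  have hfib := G.mem_fibreLaplacian_graph_iff O hb hA hpos q
  simp only [q] at hfib
  simp only [hfib, Filter.eventually_and, ae_all_iff]
  refine and_congr (forall_congr' fun e => ?_) (and_congr (forall_congr' fun a =>
    forall_congr' fun a' => forall_congr' fun _ => ?_) (forall_congr' fun v => ?_))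
  · exact forall_fourierCoeff_eq_zero_iff (G.integrableOn_map_fibrePair q e _) hc
      fun γ => G.map_orbitPair p γ e _
  · exact forall_fourierCoeff_eq_iff (G.integrableOn_map_fibrePair q a.1 _)
      (G.integrableOn_map_fibrePair q a'.1 _) hc (fun γ => G.map_orbitPair p γ a.1 _)
      (fun γ => G.map_orbitPair p γ a'.1 _) _ _
  · let T : ∀ a : G.CellEdge × Bool, EdgeL2 (G.fundamentalGraph.len a.1) ×
        EdgeL2 (G.fundamentalGraph.len a.1) →L[ℂ] ℂ := fun a =>
      (MetricGraph.endSign a.2 • ContinuousLinearMap.id ℂ ℂ).comp ((O a.1).flux a.2)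
    exact forall_sum_fourierCoeff_eq_zero_iff
      (F := fun (a : G.CellEdge × Bool) t =>
        MetricGraph.endSign a.2 * (O a.1).flux a.2 (G.fibrePair q a.1 t))
      (y := fun (a : G.CellEdge × Bool) γ =>
        MetricGraph.endSign a.2 * (O a.1).flux a.2 (G.orbitPair p γ a.1)) _
      (fun a => G.integrableOn_map_fibrePair q a.1 (T a)) hc
      (fun a γ => G.map_orbitPair p γ a.1 (T a)) _

end PeriodicMetricGraph

/-! ### Unitary equivalence -/

theorem mem_graph_unitaryConj_iff {H K : Type*} [NormedAddCommGroup H] [InnerProductSpace ℂ H]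
    [NormedAddCommGroup K] [InnerProductSpace ℂ K] (U : H ≃ₗᵢ[ℂ] K) (S : H →ₗ.[ℂ] H) (q : K × K) :
    q ∈ (unitaryConj U S).graph ↔ (U.symm q.1, U.symm q.2) ∈ S.graph := by
  simp only [LinearPMap.mem_graph_iff]
  constructor
  · rintro ⟨y, h1, h2⟩
    refine ⟨⟨U.symm y, y.2⟩, by simp [h1], ?_⟩
    rw [← h2]
    exact (U.symm_apply_apply _).symm
  · rintro ⟨y, h1, h2⟩
    refine ⟨⟨q.1, ?_⟩, rfl, ?_⟩
    · change U.symm q.1 ∈ S.domain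
      rw [← h1]; exact y.2
    · change U (S ⟨U.symm q.1, _⟩) = q.2
      rw [← U.apply_symm_apply q.2, ← h2]
      congr 2
      exact Subtype.ext h1.symm

end

theorem theorem3p2 {d k : ℕ} (hd : 1 ≤ d)
    (g : Module.Basis (Fin d) ℝ (EuclideanSpace ℝ (Fin d))) {E : Type*}
    (G : PeriodicMetricGraph d k g E) (b A : E → ℝ → ℝ)
    (hb : ∀ e, ContDiffOn ℝ 1 (b e) (Set.Icc 0 (G.len e)))
    (hA : ∀ e, ContDiffOn ℝ 1 (A e) (Set.Icc 0 (G.len e)))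
    (hb_per : ∀ γ e, ∀ x ∈ Set.Icc 0 (G.len e), b (G.shift γ e) x = b e x)
    (hA_per : ∀ γ e, ∀ x ∈ Set.Icc 0 (G.len e), A (G.shift γ e) x = A e x)
    (hb_pos : ∃ c₀ > 0, ∀ e, ∀ x ∈ Set.Icc 0 (G.len e), c₀ ≤ b e x) :
    ∃ U : G.toMetricGraph.L2 ≃ₗᵢ[ℂ] G.FibreSpace,
      G.IsGelfandTransform (U : G.toMetricGraph.L2 →L[ℂ] G.FibreSpace) ∧
      (∀ T : G.toMetricGraph.L2 →L[ℂ] G.FibreSpace, G.IsGelfandTransform T →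
        T = (U : G.toMetricGraph.L2 →L[ℂ] G.FibreSpace)) ∧
      unitaryConj U (G.toMetricGraph.magneticLaplacian b A) =
        directIntegral (MeasureTheory.volume.restrict (brillouinZone g))
          (G.fibreLaplacian b A) := by
  obtain ⟨c₀, hc₀, hb_pos⟩ := hb_pos
  have hU := G.isGelfandTransform_gelfandEquiv
  refine ⟨G.gelfandEquiv, hU, fun T hT => G.eq_of_isGelfandTransform hT hU,
    LinearPMap.eq_of_eq_graph ?_⟩
  ext q : 1
  rw [mem_graph_unitaryConj_iff, MetricGraph.magneticLaplacian_graph, directIntegral_graph,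
    G.mem_laplacianGraph_iff_ae hb hA hb_per hA_per fun e x hx => hc₀.trans_le (hb_pos e x hx)]
  simp only [LinearIsometryEquiv.apply_symm_apply]
  rfl
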